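/- Let $N\ge 1$, write $x=(x',x_N)\in\mathbb R^{N-1}\times\mathbb R$ and $\mathbb R^N_+=\{x_N>0\}$. For $f$ on $\mathbb R^N_+$ let $\widetilde f$ be its odd extension, $\widetilde f(x',x_N)=f(x',x_N)$ if $x_N>0$, $\widetilde f(x',x_N)=-f(x',-x_N)$ if $x_N<0$ (and $0$ if $x_N=0$); let $\mathscr F(f)(\xi)=\int_{\mathbb R^N}e^{-ix\cdot\xi}f(x)\,dx$. **Assumptions.** (i) $J_0\in C(\mathbb R^N;\mathbb R)$ satisfies $J_0(\xi)=1-a|\xi|^\beta+o(|\xi|^\beta)$ as $\xi\to0$, with $a>0$, $0<\beta\le 2$, and $\sup_{|\xi|\ge r}J_0(\xi)<1$ for every $r>0$. (ii) $(G(t))_{t>0}$ is a family of probability measures on $\mathbb R^N$, continuous in $t$ for narrow convergence (in particular, if it is continuous in total variation), each $G(t)$ being even with respect to $x_N$ and with respect to $x'$ (that is, $\int\phi\,dG(t)=0$ for every bounded continuous $\phi$ with $\phi(x',-x_N)=-\phi(x',x_N)$, and for every bounded continuous $\phi$ with $\phi(-x',x_N)=-\phi(x',x_N)$), with $\mathscr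 F(G(t))(\xi)=e^{t(J_0(\xi)-1)}$. (iii) $A$ is the infinitesimal generator of $v_0\mapsto G(t)*v_0$: for every Schwartz function $\phi$ and every $x$, $A\phi(x)=\lim_{h\to0^+}h^{-1}\big((G(h)*\phi)(x)-\phi(x)\big)$. (iv) (Linear comparison principle in the half-space.) For every admissible datum $w_0$ and every $t>0$, $G(t)*\widetilde w_0\ge0$ a.e. in $\mathbb R^N_+$. Here an *admissible datum* is a function $u_0\in L^1(\mathbb R^N_+)\cap L^\infty(\mathbb R^N_+)$ with $u_0\ge0$ a.e., $u_0\not\equiv0$ and $m_1(u_0):=\int_{\mathbb R^N_+}x_Nu_0(x)\,dx<\infty$. **Solutions.** A solution on $[0,T]$ of $$\partial_tu=Au+|u|^\alpha u\ \text{ in }(0,T)\times\mathbb R^N_+,\qquad u(0,\cdot)=u_0,\qquad u(t,x',0)=0 \tag{P}$$ is a function $u$ whose odd extension $w=\widetilde u$ belongs to $C([0,T];L^1(\mathbb R^N)\cap L^{\alpha+1}(\mathbb R^N))$, is bounded on $[0,T]\times\mathbb R^N$, satisfies $w(0)=\widetilde u_0$, and for all $\phi\in C^1([0,T];\mathscr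 S(\mathbb R^N))$ $$\int_0^T\!\!\int_{\mathbb R^N}\big[w(\partial_t\phi+A\phi)+|w|^\alpha w\,\phi\big]\,dx\,dt=\int_{\mathbb R^N}\big[w(T,x)\phi(T,x)-\widetilde u_0(x)\phi(0,x)\big]\,dx .$$ **Theorem.** Under (i)–(iv), let $\alpha>\beta/(N+1)$. Then there is $\varepsilon_*>0$ such that for every admissible datum $u_0$ with $$m_1(u_0)+\|\mathscr F(\widetilde u_0)\|_{L^1(\mathbb R^N)}<\varepsilon_*$$ the problem (P) has a global solution $u$ (that is, $u$ is a solution on $[0,T]$ for every $T>0$); it is unique, in the sense that every solution on some $[0,T]$ coincides with $u$ there (for every $t\in[0,T]$, a.e. in $\mathbb R^N_+$); if $u\in C^1((0,T);L^1(\mathbb R^N_+))$ for some $T>0$, then $u\in C^1((0,\infty);L^1(\mathbb R^N_+))$; and for some constant $C=C(u_0)>0$, $$\forall t\ge0,\qquad \|u(t,\cdot)\|_{L^\infty(\mathbb R^N_+)}\le C(1+t)^{-(N+1)/\beta}.$$ -/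

import Mathlib

open MeasureTheory Filter Topology Asymptotics

noncomputable section

/-- Euclidean space `ℝ^N` with `N = n + 1 ≥ 1`. The distinguished coordinate `x_N` is the last one. -/
abbrev Space (n : ℕ) : Type := EuclideanSpace ℝ (Fin (n + 1))

/-- The coordinate `x_N`. -/
def lastCoord {n : ℕ} (x : Space n) : ℝ := x (Fin.last n)

/-- The reflection `(x', x_N) ↦ (x', -x_N)`. -/
def reflectNormal {n : ℕ} (x : Space n) : Space n :=
  WithLp.toLp 2 (fun i => if i = Fin.last n then -x i else x i)

/-- The reflection `(x', x_N) ↦ (-x', x_N)`. -/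
def reflectTangential {n : ℕ} (x : Space n) : Space n :=
  WithLp.toLp 2 (fun i => if i = Fin.last n then x i else -x i)

/-- The open half-space `{x_N > 0}`. -/
def halfSpace (n : ℕ) : Set (Space n) := {x | 0 < lastCoord x}

/-- Lebesgue measure on the half-space. -/
def halfVolume (n : ℕ) : Measure (Space n) := volume.restrict (halfSpace n)

/-- The extension of a function on the half-space that is odd with respect to `x_N`;
only the values of `f` in the half-space are used. -/
def oddExt {n : ℕ} (f : Space n → ℝ) (x : Space n) : ℝ :=
  if 0 < lastCoord x then f x
  else if lastCoord x < 0 then -f (reflectNormal x)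
  else 0

/-- The Fourier transform `∫ e^{-i x·ξ} f(x) dx`. -/
def fourierHat {n : ℕ} (f : Space n → ℝ) (ξ : Space n) : ℂ :=
  ∫ x, Complex.exp (-(Complex.I * ((inner ℝ x ξ : ℝ) : ℂ))) * ((f x : ℝ) : ℂ)

/-- The first moment `∫_{x_N > 0} x_N u₀(x) dx ∈ [0, ∞]` of a nonnegative function `u₀`. -/
def firstMoment {n : ℕ} (u₀ : Space n → ℝ) : ENNReal :=
  ∫⁻ x, ENNReal.ofReal (lastCoord x * u₀ x) ∂(halfVolume n)

/-- Admissible initial data on the half-space. -/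
structure IsInitialDatum {n : ℕ} (u₀ : Space n → ℝ) : Prop where
  memL1 : MemLp u₀ 1 (halfVolume n)
  memLinf : MemLp u₀ ⊤ (halfVolume n)
  nontrivial : ¬ u₀ =ᵐ[halfVolume n] 0
  nonneg : ∀ᵐ x ∂(halfVolume n), 0 ≤ u₀ x
  moment_lt_top : firstMoment u₀ < ⊤

/-- The conditions on the symbol: continuity, `J₀(ξ) = 1 - a|ξ|^β + o(|ξ|^β)` at the origin with
`a > 0` and `0 < β ≤ 2`, and `sup_{|ξ| ≥ r} J₀(ξ) < 1` for every `r > 0`. -/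
structure IsSymbol {n : ℕ} (a β : ℝ) (J₀ : Space n → ℝ) : Prop where
  a_pos : 0 < a
  beta_pos : 0 < β
  beta_le : β ≤ 2
  continuous : Continuous J₀
  expansion : (fun ξ => J₀ ξ - (1 - a * ‖ξ‖ ^ β)) =o[𝓝 0] (fun ξ : Space n => ‖ξ‖ ^ β)
  away : ∀ r : ℝ, 0 < r → ∃ c : ℝ, c < 1 ∧ ∀ ξ : Space n, r ≤ ‖ξ‖ → J₀ ξ ≤ c

/-- A diffusion kernel with symbol `J₀`: probability measures `G(t)`, `t > 0`, depending continuously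
on `t` (for narrow convergence), even with respect to `x_N` and with respect to `x'`, with Fourier
transform `e^{t(J₀(ξ) - 1)}`. -/
structure IsDiffusionKernel {n : ℕ} (J₀ : Space n → ℝ) (G : ℝ → ProbabilityMeasure (Space n)) :
    Prop where
  continuousOn : ContinuousOn G (Set.Ioi 0)
  even_normal : ∀ t : ℝ, 0 < t → ∀ φ : BoundedContinuousFunction (Space n) ℝ,
    (∀ x, φ (reflectNormal x) = -φ x) → ∫ x, φ x ∂(G t : Measure (Space n)) = 0
  even_tangential : ∀ t : ℝ, 0 < t → ∀ φ : BoundedContinuousFunction (Space n) ℝ,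
    (∀ x, φ (reflectTangential x) = -φ x) → ∫ x, φ x ∂(G t : Measure (Space n)) = 0
  fourier : ∀ t : ℝ, 0 < t → ∀ ξ : Space n,
    ∫ x, Complex.exp (-(Complex.I * ((inner ℝ x ξ : ℝ) : ℂ))) ∂(G t : Measure (Space n)) =
      ((Real.exp (t * (J₀ ξ - 1)) : ℝ) : ℂ)

/-- The convolution `(μ * f)(x) = ∫ f(x - y) dμ(y)`. -/
def convMeasure {n : ℕ} (μ : ProbabilityMeasure (Space n)) (f : Space n → ℝ) (x : Space n) : ℝ :=
  ∫ y, f (x - y) ∂(μ : Measure (Space n))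

/-- `A` is the operator, on Schwartz functions, whose evolution `∂_t v = A v` is `v(t) = G(t) * v₀`:
it is the infinitesimal generator of `G(t) *`. This determines `A`. -/
def IsGenerator {n : ℕ} (G : ℝ → ProbabilityMeasure (Space n))
    (A : SchwartzMap (Space n) ℝ → Space n → ℝ) : Prop :=
  ∀ (φ : SchwartzMap (Space n) ℝ) (x : Space n),
    Tendsto (fun h : ℝ => h⁻¹ * (convMeasure (G h) (fun y => φ y) x - φ x)) (𝓝[>] 0) (𝓝 (A φ x))

/-- The comparison principle for the linear problem in the half-space with zero boundary values,
whose solution is the restriction of `G(t) * w̃₀` with `w̃₀` the odd extension of the datum: the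
solution starting from an admissible nonnegative datum remains nonnegative. -/
def LinearComparison {n : ℕ} (G : ℝ → ProbabilityMeasure (Space n)) : Prop :=
  ∀ w₀ : Space n → ℝ, IsInitialDatum w₀ →
    ∀ t : ℝ, 0 < t → ∀ᵐ x ∂(halfVolume n), 0 ≤ convMeasure (G t) (oddExt w₀) x

/-- `w ∈ C([0,T]; L^p(ℝ^N))`. -/
def IsContInLp {n : ℕ} (p : ENNReal) (T : ℝ) (w : ℝ → Space n → ℝ) : Prop :=
  (∀ t ∈ Set.Icc (0 : ℝ) T, MemLp (w t) p volume) ∧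
  ∀ t ∈ Set.Icc (0 : ℝ) T,
    Tendsto (fun s => eLpNorm (fun x => w s x - w t x) p volume) (𝓝[Set.Icc 0 T] t) (𝓝 0)

/-- `φ ∈ C¹([0,T]; 𝒮(ℝ^N))` with time derivative `dφ`. -/
def IsC1TestFunction {n : ℕ} (T : ℝ) (φ dφ : ℝ → SchwartzMap (Space n) ℝ) : Prop :=
  ContinuousOn φ (Set.Icc 0 T) ∧ ContinuousOn dφ (Set.Icc 0 T) ∧
  ∀ t ∈ Set.Icc (0 : ℝ) T,
    Tendsto (fun s : ℝ => (s - t)⁻¹ • (φ s - φ t)) (𝓝[Set.Icc 0 T \ {t}] t) (𝓝 (dφ t))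

/-- Bounded weak solutions on `[0,T]` of `∂_t w = A w + |w|^α w` in `ℝ^N`, `w(0) = w₀`. -/
structure IsWeakSolution {n : ℕ} (A : SchwartzMap (Space n) ℝ → Space n → ℝ) (α T : ℝ)
    (w₀ : Space n → ℝ) (w : ℝ → Space n → ℝ) : Prop where
  cont_L1 : IsContInLp 1 T w
  cont_Lp : IsContInLp (ENNReal.ofReal (α + 1)) T w
  bounded : ∃ M : ℝ, ∀ t ∈ Set.Icc (0 : ℝ) T, ∀ᵐ x, |w t x| ≤ M
  initial : w 0 =ᵐ[volume] w₀
  weak : ∀ φ dφ : ℝ → SchwartzMap (Space n) ℝ, IsC1TestFunction T φ dφ →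
    ∫ t in (0 : ℝ)..T, ∫ x, (w t x * (dφ t x + A (φ t) x) + |w t x| ^ α * w t x * φ t x) =
      ∫ x, (w T x * φ T x - w₀ x * φ 0 x)

/-- Solutions on `[0,T]` of the semilinear problem in the half-space with zero boundary values: the
odd extension solves the problem in the whole space. -/
def IsHalfSpaceSolution {n : ℕ} (A : SchwartzMap (Space n) ℝ → Space n → ℝ) (α T : ℝ)
    (u₀ : Space n → ℝ) (u : ℝ → Space n → ℝ) : Prop :=
  IsWeakSolution A α T (oddExt u₀) (fun t => oddExt (u t))

/-- `u ∈ C¹((0,T); L¹)` in the half-space. -/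
def IsC1InL1 {n : ℕ} (T : ℝ) (u : ℝ → Space n → ℝ) : Prop :=
  ∃ v : ℝ → Space n → ℝ, ∀ t ∈ Set.Ioo (0 : ℝ) T,
    MemLp (v t) 1 (halfVolume n) ∧
    Tendsto (fun h : ℝ => eLpNorm (fun x => h⁻¹ * (u (t + h) x - u t x) - v t x) 1 (halfVolume n))
      (𝓝[≠] 0) (𝓝 0) ∧
    Tendsto (fun s => eLpNorm (fun x => v s x - v t x) 1 (halfVolume n)) (𝓝 t) (𝓝 0)

end

/-!
The odd extension turns the problem in the half-space into a problem in the whole space, which is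
solved in `L¹(ℝ^N)` for the contraction semigroup `S(t) f = G(t) * f`.

*Decay.* The Fourier transform of an odd datum vanishes at the origin, and there it is bounded by a
multiple of `m₁ |ξ|` (`norm_hat_le_of_odd`). Since `1 - J₀` is comparable to `|ξ|^β` from below near the
origin and bounded away from zero elsewhere, Fourier inversion gives
`|S(t) w₀| ≤ C (m₁ + ‖ŵ₀‖₁) (1 + t)^{-p}` with `p = (N + 1)/β`, the extra power of `|ξ|` accounting for
`N + 1` in place of `N` (`IsSymbol.exists_linear_decay`).

*Existence.* Let `M` be a bound for `2 |S(t) w₀|`. The power `|r|^α r` is replaced by a function that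
agrees with it for `|r| ≤ M` and is globally Lipschitz, so that Duhamel's equation is solved by a
contraction in an exponentially weighted space. The fixed point map preserves the constraint
`0 ≤ U(t) ≤ 2 S(t) w₀` in the half-space: under it the nonlinearity is at most `2 (2b(s))^α S(s) w₀`,
where `b(t)` bounds `|S(t) w₀|`, so the Duhamel integral is at most
`(∫ 2 (2b)^α) S(t) w₀`. As `α p > 1` is exactly the condition `α > β/(N + 1)`, the integral is at most `1`
for small data. Order in the half-space is order with respect to the closed convex cone `oddCone`,
which the semigroup preserves by the comparison principle
(`LinearComparison.kernelOp_mem_oddCone`, `LinearComparison.exists_isMild_trunc`). The constraint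
yields the decay of the solution, and it shows that the truncation is never active.

*Weak and mild solutions.* On Schwartz functions the generator is the Fourier multiplier `J₀ - 1`, which
grows at most quadratically, so it maps continuously into the bounded continuous functions
(`IsGenerator.exists_clm`). A mild solution is weak because `t ↦ ∫ V(t) φ(t)` has the expected
derivative from the right (`IsGenerator.weak_of_isMild`). Conversely, a weak solution of the
homogeneous linear problem with zero initial value vanishes: its time integral solves an ordinary
differential equation for each frequency (`IsGenerator.eq_zero_of_weak`). So bounded weak solutions
are mild, and uniqueness follows from Grönwall's inequality (`IsGenerator.ae_eq_of_isWeakSolution`).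

*Regularity in time.* If `U` is differentiable at one time `t₀ > 0`, let `Z` be the mild solution of the
linearised equation issued from the derivative at `t₀`. The difference quotients of `U` converge to
`Z` by Grönwall's inequality, although the superposition operator is not differentiable on `L¹`: it
has a first-order expansion along `U`, by uniform integrability
(`ContractionSemigroup.IsMild.exists_continuous_hasDerivAt`, `exists_truncL1_expansion`).
-/

open scoped FourierTransform

/-- A strongly continuous semigroup of linear contractions of a Banach space. It is extended to
negative times by the identity, so that the orbits are continuous on all of `ℝ`. -/
structure ContractionSemigroup (X : Type*) [NormedAddCommGroup X] [NormedSpace ℝ X] where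
  /-- The operator at time `t`. -/
  op : ℝ → X →L[ℝ] X
  op_of_nonpos : ∀ t ≤ 0, ∀ x, op t x = x
  op_add : ∀ s t, 0 ≤ s → 0 ≤ t → ∀ x, op (s + t) x = op s (op t x)
  norm_op_le : ∀ t x, ‖op t x‖ ≤ ‖x‖
  continuous_orbit : ∀ x, Continuous fun t => op t x

/-! ### Grönwall's inequality in integral form -/

section IntegralInequality

/-- Grönwall's inequality in integral form. -/
theorem le_mul_exp_of_le_add_integral {e : ℝ → ℝ} (he : Continuous e) {a L T : ℝ} (hL : 0 ≤ L)
    (h : ∀ t ∈ Set.Icc 0 T, e t ≤ a + L * ∫ s in (0 : ℝ)..t, e s) :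
    ∀ t ∈ Set.Icc 0 T, e t ≤ a * Real.exp (L * t) := by
  intro t ht
  set J : ℝ → ℝ := fun t => a + L * ∫ s in (0 : ℝ)..t, e s with hJ
  have hJd : ∀ t, HasDerivAt J (L * e t) t := fun t => by
    have := (intervalIntegral.integral_hasDerivAt_right (he.intervalIntegrable 0 t)
      (he.stronglyMeasurableAtFilter _ _) he.continuousAt).const_mul L
    simpa [hJ] using this.const_add a
  have hd : ∀ t, HasDerivAt (fun t => J t * Real.exp (-(L * t)))
      ((L * e t - L * J t) * Real.exp (-(L * t))) t := fun t => by
    have h2 : HasDerivAt (fun t : ℝ => Real.exp (-(L * t))) (Real.exp (-(L * t)) * -(L * 1)) t :=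
      (((hasDerivAt_id t).const_mul L).neg).exp
    refine ((hJd t).mul h2).congr_deriv ?_
    ring
  have hanti : AntitoneOn (fun t => J t * Real.exp (-(L * t))) (Set.Icc 0 T) := by
    apply antitoneOn_of_deriv_nonpos (convex_Icc 0 T)
    · exact fun x _ => (hd x).continuousAt.continuousWithinAt
    · exact fun x _ => (hd x).differentiableAt.differentiableWithinAt
    · intro x hx
      rw [interior_Icc] at hx
      rw [(hd x).deriv]
      have := h x ⟨hx.1.le, hx.2.le⟩
      have h3 : L * e x ≤ L * J x := mul_le_mul_of_nonneg_left this hL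
      exact mul_nonpos_of_nonpos_of_nonneg (by linarith) (Real.exp_pos _).le
  have h0 := hanti ⟨le_rfl, ht.1.trans ht.2⟩ ht ht.1
  simp only [hJ, intervalIntegral.integral_same, mul_zero, add_zero, neg_zero, Real.exp_zero,
    mul_one] at h0
  calc e t ≤ J t := h t ht
    _ = J t * Real.exp (-(L * t)) * Real.exp (L * t) := by
      rw [mul_assoc, ← Real.exp_add]; simp
    _ ≤ a * Real.exp (L * t) := mul_le_mul_of_nonneg_right h0 (Real.exp_pos _).le

theorem eq_of_norm_sub_le_integral {X : Type*} [NormedAddCommGroup X] {U V : ℝ → X}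
    (hU : Continuous U) (hV : Continuous V) {L T : ℝ}
    (hL : 0 ≤ L) (h : ∀ t ∈ Set.Icc 0 T, ‖U t - V t‖ ≤ L * ∫ s in (0 : ℝ)..t, ‖U s - V s‖) :
    ∀ t ∈ Set.Icc 0 T, U t = V t := by
  intro t ht
  have := le_mul_exp_of_le_add_integral (hU.sub hV).norm hL (a := 0) (T := T)
    (by simpa using h) t ht
  simp only [zero_mul, Pi.sub_apply] at this
  exact sub_eq_zero.1 (norm_le_zero_iff.1 this)

end IntegralInequality

/-! ### Contraction semigroups and mild solutions -/

namespace ContractionSemigroup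

variable {X : Type*} [NormedAddCommGroup X] [NormedSpace ℝ X] (S : ContractionSemigroup X)

theorem op_zero (x : X) : S.op 0 x = x := S.op_of_nonpos 0 le_rfl x

theorem continuous_op : Continuous fun p : ℝ × X => S.op p.1 p.2 := by
  rw [continuous_iff_continuousAt]
  rintro ⟨t₀, x₀⟩
  rw [ContinuousAt, tendsto_iff_norm_sub_tendsto_zero]
  have h1 : Tendsto (fun p : ℝ × X => ‖p.2 - x₀‖ + ‖S.op p.1 x₀ - S.op t₀ x₀‖) (𝓝 (t₀, x₀))
      (𝓝 0) := by
    have hc : Continuous fun p : ℝ × X => ‖p.2 - x₀‖ + ‖S.op p.1 x₀ - S.op t₀ x₀‖ :=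
      (continuous_snd.sub continuous_const).norm.add
        (((S.continuous_orbit x₀).comp continuous_fst).sub continuous_const).norm
    simpa using hc.tendsto (t₀, x₀)
  refine squeeze_zero (fun _ => norm_nonneg _) (fun p => ?_) h1
  calc ‖S.op p.1 p.2 - S.op t₀ x₀‖
      = ‖S.op p.1 (p.2 - x₀) + (S.op p.1 x₀ - S.op t₀ x₀)‖ := by rw [map_sub]; abel_nf
    _ ≤ _ := (norm_add_le _ _).trans (by gcongr; exact S.norm_op_le _ _)

/-- The Duhamel integral `∫_0^t S(t - s) g(s) ds`. -/
noncomputable def duhamel (g : ℝ → X) (t : ℝ) : X := ∫ s in (0 : ℝ)..t, S.op (t - s) (g s)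

variable {S} in
theorem continuous_duhamel_integrand {g : ℝ → X} (hg : Continuous g) :
    Continuous (Function.uncurry fun t s : ℝ => S.op (t - s) (g s)) :=
  S.continuous_op.comp
    ((continuous_fst.sub continuous_snd).prodMk (hg.comp continuous_snd))

variable {S} in
theorem continuous_duhamel_integrand_right {g : ℝ → X} (hg : Continuous g) (t : ℝ) :
    Continuous fun s : ℝ => S.op (t - s) (g s) :=
  S.continuous_op.comp ((continuous_const.sub continuous_id).prodMk hg)

theorem continuous_duhamel {g : ℝ → X} (hg : Continuous g) : Continuous (S.duhamel g) :=
  intervalIntegral.continuous_parametric_intervalIntegral_of_continuous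
    (continuous_duhamel_integrand hg) continuous_id

@[simp] theorem duhamel_zero_time (g : ℝ → X) : S.duhamel g 0 = 0 := by simp [duhamel]

theorem duhamel_sub {g₁ g₂ : ℝ → X} (h₁ : Continuous g₁) (h₂ : Continuous g₂) (t : ℝ) :
    S.duhamel g₁ t - S.duhamel g₂ t = S.duhamel (fun s => g₁ s - g₂ s) t := by
  simp only [duhamel, map_sub]
  rw [intervalIntegral.integral_sub]
  · exact (continuous_duhamel_integrand_right h₁ t).intervalIntegrable _ _
  · exact (continuous_duhamel_integrand_right h₂ t).intervalIntegrable _ _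

theorem duhamel_smul (c : ℝ) (g : ℝ → X) (t : ℝ) :
    S.duhamel (fun s => c • g s) t = c • S.duhamel g t := by
  simp only [duhamel, map_smul]
  rw [intervalIntegral.integral_smul]

theorem duhamel_congr {g₁ g₂ : ℝ → X} {t : ℝ} (ht : 0 ≤ t)
    (h : ∀ s ∈ Set.Icc 0 t, g₁ s = g₂ s) : S.duhamel g₁ t = S.duhamel g₂ t := by
  apply intervalIntegral.integral_congr
  intro s hs
  rw [Set.uIcc_of_le ht] at hs
  simp only [h s hs]

theorem norm_duhamel_le {g : ℝ → X} {b : ℝ → ℝ} (hb : Continuous b) {t : ℝ} (ht : 0 ≤ t)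
    (h : ∀ s ∈ Set.Icc 0 t, ‖g s‖ ≤ b s) : ‖S.duhamel g t‖ ≤ ∫ s in (0 : ℝ)..t, b s := by
  apply intervalIntegral.norm_integral_le_of_norm_le ht
  · exact ae_of_all _ fun s hs => (S.norm_op_le _ _).trans (h s ⟨hs.1.le, hs.2⟩)
  · exact hb.intervalIntegrable _ _

theorem duhamel_add [CompleteSpace X] {g : ℝ → X} (hg : Continuous g) {t h : ℝ} (ht : 0 ≤ t)
    (hh : 0 ≤ h) :
    S.duhamel g (t + h) = S.op h (S.duhamel g t) + S.duhamel (fun s => g (t + s)) h := by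
  have hi := fun a b => (continuous_duhamel_integrand_right (S := S) hg (t + h)).intervalIntegrable
    (μ := volume) a b
  rw [duhamel, ← intervalIntegral.integral_add_adjacent_intervals (hi 0 t) (hi t (t + h))]
  congr 1
  · rw [duhamel, ← ContinuousLinearMap.intervalIntegral_comp_comm _
      ((continuous_duhamel_integrand_right (S := S) hg t).intervalIntegrable 0 t)]
    apply intervalIntegral.integral_congr
    intro s hs
    rw [Set.uIcc_of_le ht] at hs
    simp only
    rw [← S.op_add _ _ hh (by linarith [hs.2])]
    congr 2; ring
  · have := intervalIntegral.integral_comp_add_left (a := 0) (b := h)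
      (fun s => S.op (t + h - s) (g s)) t
    rw [duhamel]
    simp only [add_zero] at this
    rw [← this]
    apply intervalIntegral.integral_congr
    intro s _
    simp only
    congr 2; ring

/-- Mild solutions of `U' = A U + F(t, U)`, where `A` generates the semigroup. -/
structure IsMild (F : ℝ → X → X) (x₀ : X) (U : ℝ → X) : Prop where
  continuous : Continuous U
  eq : ∀ t, 0 ≤ t → U t = S.op t x₀ + S.duhamel (fun s => F s (U s)) t

variable {S}

theorem IsMild.zero {F : ℝ → X → X} {x₀ : X} {U : ℝ → X} (h : S.IsMild F x₀ U) : U 0 = x₀ := by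
  rw [h.eq 0 le_rfl, op_zero, duhamel_zero_time, add_zero]

/-- A mild solution restarted at a later time is a mild solution. -/
theorem IsMild.restart [CompleteSpace X] {F : ℝ → X → X} (hF : Continuous (Function.uncurry F))
    {x₀ : X} {U : ℝ → X} (h : S.IsMild F x₀ U) {r t : ℝ} (hr : 0 ≤ r) (ht : 0 ≤ t) :
    U (r + t) = S.op t (U r) + S.duhamel (fun s => F (r + s) (U (r + s))) t := by
  have hg : Continuous fun s => F s (U s) := hF.comp (continuous_id.prodMk h.continuous)
  rw [h.eq (r + t) (by linarith), S.duhamel_add hg hr ht, h.eq r hr, map_add, add_comm r t,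
    S.op_add t r ht hr, add_assoc]

/-! ### Existence of mild solutions under a closed constraint -/

section Existence

/-- The map whose fixed points are the mild solutions; it is frozen for negative times. -/
noncomputable def mildMap (S : ContractionSemigroup X) (F : ℝ → X → X) (x₀ : X) (v : ℝ → X)
    (t : ℝ) : X :=
  S.op t x₀ + S.duhamel (fun s => F s (v s)) (max t 0)

theorem continuous_mildMap {F : ℝ → X → X} (hF : Continuous (Function.uncurry F)) (x₀ : X)
    {v : ℝ → X} (hv : Continuous v) : Continuous (mildMap S F x₀ v) :=
  (S.continuous_orbit x₀).add ((S.continuous_duhamel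
    (hF.comp (continuous_id.prodMk hv))).comp (continuous_id.max continuous_const))

theorem integral_mul_exp_le {c : ℝ} (hc : 0 < c) {t : ℝ} :
    ∫ s in (0 : ℝ)..t, Real.exp (c * s) ≤ Real.exp (c * t) / c := by
  have h : ∀ s, HasDerivAt (fun s => Real.exp (c * s) / c) (Real.exp (c * s)) s := fun s => by
    refine ((((hasDerivAt_id s).const_mul c).exp).div_const c).congr_deriv ?_
    field_simp
    simp
  rw [intervalIntegral.integral_eq_sub_of_hasDerivAt (fun s _ => h s)
    ((by fun_prop : Continuous fun s => Real.exp (c * s)).intervalIntegrable _ _)]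
  simp only [mul_zero, Real.exp_zero]
  have : 0 < 1 / c := by positivity
  linarith

variable {F : ℝ → X → X} {L : ℝ}

theorem norm_mildMap_sub_le (hF : Continuous (Function.uncurry F)) (hL : 0 ≤ L)
    (hlip : ∀ s x y, ‖F s x - F s y‖ ≤ L * ‖x - y‖) (x₀ : X) {c : ℝ} (hc : 0 < c)
    {v w : ℝ → X} (hv : Continuous v) (hw : Continuous w) {D : ℝ}
    (h : ∀ s, 0 ≤ s → ‖v s - w s‖ ≤ D * Real.exp (c * s)) (t : ℝ) :
    ‖mildMap S F x₀ v t - mildMap S F x₀ w t‖ ≤ L * D * (Real.exp (c * max t 0) / c) := by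
  have hD : 0 ≤ D := by simpa using (norm_nonneg _).trans (h 0 le_rfl)
  have h1 : Continuous fun s => F s (v s) := hF.comp (continuous_id.prodMk hv)
  have h2 : Continuous fun s => F s (w s) := hF.comp (continuous_id.prodMk hw)
  rw [mildMap, mildMap, add_sub_add_left_eq_sub, S.duhamel_sub h1 h2]
  refine (S.norm_duhamel_le (b := fun s => L * D * Real.exp (c * s)) (by fun_prop)
    (le_max_right _ _) fun s hs => ?_).trans ?_
  · calc _ ≤ L * ‖v s - w s‖ := hlip s _ _
      _ ≤ L * (D * Real.exp (c * s)) := by gcongr; exact h s hs.1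
      _ = _ := by ring
  · rw [intervalIntegral.integral_const_mul]
    exact mul_le_mul_of_nonneg_left (integral_mul_exp_le hc) (by positivity)

/-- Global existence of mild solutions for a Lipschitz nonlinearity, by the contraction principle in
a space of curves with exponential weight. The solution satisfies any closed pointwise constraint
that holds along the free evolution and is preserved by the fixed point map. -/
theorem exists_isMild [CompleteSpace X] (hF : Continuous (Function.uncurry F)) (hL : 0 ≤ L)
    (hlip : ∀ s x y, ‖F s x - F s y‖ ≤ L * ‖x - y‖) (hF0 : ∀ s, F s 0 = 0) (x₀ : X)
    (K : ℝ → Set X) (hK : ∀ t, IsClosed (K t)) (hK0 : ∀ t, 0 ≤ t → S.op t x₀ ∈ K t)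
    (hKmap : ∀ v : ℝ → X, Continuous v → (∀ t, 0 ≤ t → v t ∈ K t) →
      ∀ t, 0 ≤ t → S.op t x₀ + S.duhamel (fun s => F s (v s)) t ∈ K t) :
    ∃ U, S.IsMild F x₀ U ∧ ∀ t, 0 ≤ t → U t ∈ K t := by
  -- With the weight `e^{-ct}`, `c = 2L + 1`, the fixed point map contracts by the factor `1/2`.
  set c : ℝ := 2 * L + 1 with hc
  have hc0 : 0 < c := by positivity
  have hLc : L / c ≤ 1 / 2 := by rw [div_le_iff₀ hc0, hc]; linarith
  let lift : (BoundedContinuousFunction ℝ X) → ℝ → X := fun y s => Real.exp (c * s) • y s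
  have hlift : ∀ y, Continuous (lift y) := fun y => by
    exact Continuous.smul (by fun_prop) y.continuous
  have hsub : ∀ y z : BoundedContinuousFunction ℝ X, ∀ t,
      ‖Real.exp (-(c * max t 0)) • mildMap S F x₀ (lift y) t -
        Real.exp (-(c * max t 0)) • mildMap S F x₀ (lift z) t‖ ≤ 1 / 2 * ‖y - z‖ := by
    intro y z t
    have := norm_mildMap_sub_le (S := S) hF hL hlip x₀ hc0 (hlift y) (hlift z) (D := ‖y - z‖)
      (fun s _ => by
        simp only [lift]
        rw [← smul_sub, norm_smul, Real.norm_of_nonneg (Real.exp_pos _).le, mul_comm]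
        gcongr
        exact (y - z).norm_coe_le_norm s) t
    rw [← smul_sub, norm_smul, Real.norm_of_nonneg (Real.exp_pos _).le]
    calc _ ≤ Real.exp (-(c * max t 0)) * (L * ‖y - z‖ * (Real.exp (c * max t 0) / c)) := by gcongr
      _ = (Real.exp (-(c * max t 0)) * Real.exp (c * max t 0)) * (L / c * ‖y - z‖) := by ring
      _ = L / c * ‖y - z‖ := by rw [← Real.exp_add]; simp
      _ ≤ _ := by gcongr
  have hzero : ∀ t, mildMap S F x₀ (lift 0) t = S.op t x₀ := by
    intro t
    simp [mildMap, lift, duhamel, hF0]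
  have hbound : ∀ y : BoundedContinuousFunction ℝ X, ∀ t,
      ‖Real.exp (-(c * max t 0)) • mildMap S F x₀ (lift y) t‖ ≤ 1 / 2 * ‖y‖ + ‖x₀‖ := by
    intro y t
    have h1 := hsub y 0 t
    have h2 : ‖Real.exp (-(c * max t 0)) • mildMap S F x₀ (lift 0) t‖ ≤ ‖x₀‖ := by
      rw [hzero, norm_smul, Real.norm_of_nonneg (Real.exp_pos _).le]
      calc _ ≤ 1 * ‖x₀‖ := by
            gcongr
            · exact Real.exp_le_one_iff.2 (by simp; positivity)
            · exact S.norm_op_le _ _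
        _ = _ := one_mul _
    rw [sub_zero] at h1
    calc _ ≤ _ := norm_le_norm_sub_add _ (Real.exp (-(c * max t 0)) • mildMap S F x₀ (lift 0) t)
      _ ≤ _ := add_le_add h1 h2
  let Ψ : BoundedContinuousFunction ℝ X → BoundedContinuousFunction ℝ X := fun y =>
    BoundedContinuousFunction.ofNormedAddCommGroup
      (fun t => Real.exp (-(c * max t 0)) • mildMap S F x₀ (lift y) t)
      (Continuous.smul (by fun_prop) (continuous_mildMap hF x₀ (hlift y))) _ (hbound y)
  have hΨ : ∀ y t, Ψ y t = Real.exp (-(c * max t 0)) • mildMap S F x₀ (lift y) t :=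
    fun _ _ => rfl
  have hcontr : ContractingWith (1 / 2) Ψ := by
    refine ⟨by rw [← NNReal.coe_lt_coe]; norm_num, LipschitzWith.of_dist_le_mul fun y z => ?_⟩
    rw [dist_eq_norm, dist_eq_norm]
    refine (BoundedContinuousFunction.norm_le (by positivity)).2 fun t => ?_
    simpa [hΨ] using hsub y z t
  have hexp : ∀ t : ℝ, 0 ≤ t → ∀ x : X, Real.exp (c * t) • Real.exp (-(c * max t 0)) • x = x := by
    intro t ht x
    rw [smul_smul, ← Real.exp_add, max_eq_left ht]; simp
  set y := ContractingWith.fixedPoint Ψ hcontr with hy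
  have hfix : Ψ y = y := hcontr.fixedPoint_isFixedPt
  have hiter : ∀ k : ℕ, ∀ t, 0 ≤ t → lift (Ψ^[k + 1] 0) t ∈ K t := by
    intro k
    induction k with
    | zero =>
      intro t ht
      simp only [zero_add, Function.iterate_one, lift, hΨ]
      rw [hexp t ht]
      have := hzero t
      simp only [lift] at this
      rw [this]
      exact hK0 t ht
    | succ k ih =>
      intro t ht
      rw [Function.iterate_succ_apply']
      simp only [lift, hΨ]
      rw [hexp t ht, mildMap, max_eq_left ht]
      exact hKmap _ (hlift (Ψ^[k + 1] 0)) ih t ht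
  have heq : ∀ t, 0 ≤ t → lift y t = S.op t x₀ + S.duhamel (fun s => F s (lift y s)) t := by
    intro t ht
    conv_lhs => rw [← hfix]
    simp only [lift, hΨ]
    rw [hexp t ht, mildMap, max_eq_left ht]
  refine ⟨lift y, ⟨hlift y, heq⟩, fun t ht => ?_⟩
  have hlim : Tendsto (fun k => Ψ^[k + 1] 0) atTop (𝓝 y) :=
    (hcontr.tendsto_iterate_fixedPoint 0).comp (tendsto_add_atTop_nat 1)
  have hlim2 : Tendsto (fun k => lift (Ψ^[k + 1] 0) t) atTop (𝓝 (lift y t)) :=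
    (((continuous_eval_const (F := BoundedContinuousFunction ℝ X) t).tendsto y).comp hlim).const_smul _
  exact (hK t).mem_of_tendsto hlim2 (Eventually.of_forall fun k => hiter k t ht)

end Existence

/-! ### Propagation of time regularity for mild solutions -/

/-- Propagation of differentiability in time: a mild solution that is differentiable at one positive
time `t₀` is continuously differentiable from then on, and its derivative is the mild solution `z`
of the linearised equation. The nonlinearity `N` need not be differentiable on `X`; a first-order
expansion along the curve `U` suffices. -/
theorem IsMild.exists_continuous_hasDerivAt [CompleteSpace X] {N : X → X} {x₀ : X} {U : ℝ → X}
    {L C : ℝ} (hU : S.IsMild (fun _ => N) x₀ U) (hL : 0 ≤ L) (hLC : L ≤ C)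
    (hN : ∀ x y, ‖N x - N y‖ ≤ L * ‖x - y‖) (hNc : Continuous N) {V : ℝ → X → X}
    (hV : Continuous (Function.uncurry V)) (hVlip : ∀ s x y, ‖V s x - V s y‖ ≤ L * ‖x - y‖)
    (hV0 : ∀ s, V s 0 = 0)
    (hexp : ∀ s z, ∀ η > 0, ∀ᶠ h in 𝓝[≠] (0 : ℝ),
      ‖N (U (s + h)) - N (U s) - h • V s z‖ ≤ C * ‖U (s + h) - U s - h • z‖ + η * |h|)
    {t₀ : ℝ} (ht₀ : 0 < t₀) {z₀ : X} (hz₀ : HasDerivAt U z₀ t₀) :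
    ∃ z : ℝ → X, Continuous z ∧ ∀ t, t₀ ≤ t → HasDerivAt U (z t) t := by
  have hF : Continuous (Function.uncurry fun s x => V (t₀ + s) x) :=
    hV.comp ((continuous_const.add continuous_fst).prodMk continuous_snd)
  obtain ⟨Z, hZ, -⟩ := exists_isMild (S := S) hF hL (fun s => hVlip _) (fun s => hV0 _) z₀
    (fun _ => Set.univ) (fun _ => isClosed_univ) (fun _ _ => trivial) (fun _ _ _ _ _ => trivial)
  have hC : 0 ≤ C := hL.trans hLC
  -- The difference quotients `d` of `U`, those of `N ∘ U` corrected by the linearisation (`g`), and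
  -- the part `r` of `‖g‖` that is not controlled by `‖d - Z‖`. Since `r → 0` pointwise and is
  -- dominated, Grönwall's inequality for `‖d - Z‖` gives `d → Z`.
  let d : ℝ → ℝ → X := fun h t => h⁻¹ • (U (t₀ + h + t) - U (t₀ + t))
  let g : ℝ → ℝ → X := fun h s => h⁻¹ • (N (U (t₀ + h + s)) - N (U (t₀ + s))) - V (t₀ + s) (Z s)
  let r : ℝ → ℝ → ℝ := fun h s => max 0 (‖g h s‖ - C * ‖d h s - Z s‖)
  have hUc := hU.continuous
  have hZc := hZ.continuous
  have hUs : ∀ a, Continuous fun s => U (a + s) := fun a =>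
    hUc.comp (continuous_const.add continuous_id)
  have hNU : ∀ a, Continuous fun s => N (U (a + s)) := fun a => hNc.comp (hUs a)
  have hd : ∀ h, Continuous (d h) := fun h => ((hUs _).sub (hUs _)).const_smul _
  have hVZ : Continuous fun s => V (t₀ + s) (Z s) := hF.comp (continuous_id.prodMk hZc)
  have hNd : ∀ h, Continuous fun s => h⁻¹ • (N (U (t₀ + h + s)) - N (U (t₀ + s))) := fun h =>
    ((hNU _).sub (hNU _)).const_smul _
  have hg : ∀ h, Continuous (g h) := fun h => (hNd h).sub hVZ
  have hr : ∀ h, Continuous (r h) := fun h =>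
    continuous_const.max ((hg h).norm.sub (((hd h).sub hZc).norm.const_mul C))
  have hrep : ∀ h, |h| < t₀ → ∀ t, 0 ≤ t →
      d h t - Z t = S.op t (d h 0 - z₀) + S.duhamel (g h) t := by
    intro h hh t ht
    have h0 : 0 ≤ t₀ + h := by linarith [neg_abs_le h]
    have hNu : Continuous (Function.uncurry fun (_ : ℝ) => N) := hNc.comp continuous_snd
    have e1 := hU.restart hNu h0 ht
    have e2 := hU.restart hNu ht₀.le ht
    have e3 := hZ.eq t ht
    have e4 : S.duhamel (g h) t = h⁻¹ • (S.duhamel (fun s => N (U (t₀ + h + s))) t -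
        S.duhamel (fun s => N (U (t₀ + s))) t) - S.duhamel (fun s => V (t₀ + s) (Z s)) t := by
      rw [S.duhamel_sub (hNU _) (hNU _), ← S.duhamel_smul,
        S.duhamel_sub (hNd h) hVZ]
    rw [e4, e3]
    simp only [d, add_zero]
    rw [e1, e2]
    simp only [map_sub, map_smul, smul_sub, smul_add]
    abel
  have hgr : ∀ h s, ‖g h s‖ ≤ C * ‖d h s - Z s‖ + r h s := fun h s => by
    have := le_max_right 0 (‖g h s‖ - C * ‖d h s - Z s‖)
    simp only [r]; linarith
  have hrle : ∀ h s, r h s ≤ 2 * L * ‖Z s‖ := by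
    intro h s
    refine max_le (by positivity) ?_
    have h1 : ‖g h s‖ ≤ L * ‖d h s‖ + L * ‖Z s‖ := by
      refine (norm_sub_le _ _).trans (add_le_add ?_ ?_)
      · simp only [d, norm_smul]
        calc _ ≤ ‖h⁻¹‖ * (L * ‖U (t₀ + h + s) - U (t₀ + s)‖) := by gcongr; exact hN _ _
          _ = _ := by ring
      · simpa [hV0] using hVlip (t₀ + s) (Z s) 0
    have h2 : L * ‖d h s‖ ≤ L * (‖d h s - Z s‖ + ‖Z s‖) := by
      gcongr; exact norm_le_norm_sub_add _ _
    have h3 : L * ‖d h s - Z s‖ ≤ C * ‖d h s - Z s‖ := by gcongr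
    linarith
  have hr0 : ∀ s, Tendsto (fun h => r h s) (𝓝[≠] 0) (𝓝 0) := by
    intro s
    rw [Metric.tendsto_nhds]
    intro η hη
    filter_upwards [hexp (t₀ + s) (Z s) (η / 2) (by positivity), self_mem_nhdsWithin] with h hh hne
    have hne' : h ≠ 0 := hne
    have habs : 0 < |h| := abs_pos.2 hne'
    rw [Real.dist_eq, sub_zero, abs_of_nonneg (le_max_left _ _)]
    refine max_lt hη ?_
    have hcomm : t₀ + s + h = t₀ + h + s := by ring
    rw [hcomm] at hh
    have eg : g h s = h⁻¹ • (N (U (t₀ + h + s)) - N (U (t₀ + s)) - h • V (t₀ + s) (Z s)) := by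
      simp only [g, smul_sub, smul_smul, inv_mul_cancel₀ hne', one_smul]
    have ed : d h s - Z s = h⁻¹ • (U (t₀ + h + s) - U (t₀ + s) - h • Z s) := by
      simp only [d, smul_sub, smul_smul, inv_mul_cancel₀ hne', one_smul]
    rw [eg, ed, norm_smul, norm_smul, norm_inv, Real.norm_eq_abs]
    have : |h|⁻¹ * ‖N (U (t₀ + h + s)) - N (U (t₀ + s)) - h • V (t₀ + s) (Z s)‖ ≤
        |h|⁻¹ * (C * ‖U (t₀ + h + s) - U (t₀ + s) - h • Z s‖ + η / 2 * |h|) := by gcongr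
    have e5 : |h|⁻¹ * (C * ‖U (t₀ + h + s) - U (t₀ + s) - h • Z s‖ + η / 2 * |h|) =
      C * (|h|⁻¹ * ‖U (t₀ + h + s) - U (t₀ + s) - h • Z s‖) + η / 2 := by
      field_simp
    linarith
  have hlim : ∀ t, 0 ≤ t → Tendsto (fun h => d h t) (𝓝[≠] 0) (𝓝 (Z t)) := by
    intro t ht
    have hI : Tendsto (fun h => ∫ s in (0 : ℝ)..t, r h s) (𝓝[≠] 0)
        (𝓝 (∫ s in (0 : ℝ)..t, (0 : ℝ))) := by
      apply intervalIntegral.tendsto_integral_filter_of_dominated_convergence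
        (fun s => 2 * L * ‖Z s‖)
      · exact Eventually.of_forall fun h => (hr h).aestronglyMeasurable
      · refine Eventually.of_forall fun h => ae_of_all _ fun s _ => ?_
        rw [Real.norm_of_nonneg (le_max_left _ _)]
        exact hrle h s
      · exact (hZc.norm.const_mul _).intervalIntegrable _ _
      · exact ae_of_all _ fun s _ => hr0 s
    rw [intervalIntegral.integral_zero] at hI
    have h0 : Tendsto (fun h => ‖d h 0 - z₀‖) (𝓝[≠] 0) (𝓝 0) := by
      rw [← tendsto_iff_norm_sub_tendsto_zero]
      simpa [d] using hasDerivAt_iff_tendsto_slope_zero.1 hz₀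
    have hb : Tendsto (fun h => (‖d h 0 - z₀‖ + ∫ s in (0 : ℝ)..t, r h s) * Real.exp (C * t))
        (𝓝[≠] 0) (𝓝 0) := by
      simpa using (h0.add hI).mul_const (Real.exp (C * t))
    rw [tendsto_iff_norm_sub_tendsto_zero]
    refine squeeze_zero' (Eventually.of_forall fun _ => norm_nonneg _) ?_ hb
    have hsmall : ∀ᶠ h in 𝓝[≠] (0 : ℝ), |h| < t₀ :=
      nhdsWithin_le_nhds ((continuous_abs.tendsto' 0 0 abs_zero).eventually_lt_const ht₀)
    filter_upwards [hsmall] with h hh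
    have he : Continuous fun s => ‖d h s - Z s‖ := ((hd h).sub hZc).norm
    refine le_mul_exp_of_le_add_integral he hC (T := t) (fun s hs => ?_) t ⟨ht, le_rfl⟩
    have hi1 : ∀ a b : ℝ, IntervalIntegrable (fun s => C * ‖d h s - Z s‖) volume a b :=
      fun a b => (he.const_mul C).intervalIntegrable _ _
    have hi2 : ∀ a b : ℝ, IntervalIntegrable (r h) volume a b :=
      fun a b => (hr h).intervalIntegrable _ _
    calc ‖d h s - Z s‖ ≤ ‖d h 0 - z₀‖ + ∫ s in (0 : ℝ)..s, (C * ‖d h s - Z s‖ + r h s) := by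
          rw [hrep h hh s hs.1]
          refine (norm_add_le _ _).trans (add_le_add (S.norm_op_le _ _) ?_)
          exact S.norm_duhamel_le ((he.const_mul C).add (hr h)) hs.1 fun s _ => hgr h s
      _ = ‖d h 0 - z₀‖ + (C * ∫ s in (0 : ℝ)..s, ‖d h s - Z s‖) + ∫ s in (0 : ℝ)..s, r h s := by
          rw [intervalIntegral.integral_add (hi1 _ _) (hi2 _ _),
            intervalIntegral.integral_const_mul, add_assoc]
      _ ≤ _ := by
          have : ∫ s in (0 : ℝ)..s, r h s ≤ ∫ s in (0 : ℝ)..t, r h s := by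
            apply intervalIntegral.integral_mono_interval le_rfl hs.1 hs.2
            · exact Eventually.of_forall fun s => le_max_left _ _
            · exact hi2 _ _
          linarith
  refine ⟨fun t => Z (t - t₀), hZc.comp (continuous_id.sub continuous_const), fun t ht => ?_⟩
  rw [hasDerivAt_iff_tendsto_slope_zero]
  refine (hlim (t - t₀) (by linarith)).congr fun h => ?_
  simp only [d]
  congr 3 <;> ring_nf

end ContractionSemigroup

/-- The real Banach space `L¹(ℝ^N)`. -/
abbrev L1 (n : ℕ) : Type := Lp ℝ 1 (volume : Measure (Space n))

/-! ### Convolution with a probability measure on `L¹` -/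

section Convolution

variable {n : ℕ}

theorem L1.integrable_coe (f : L1 n) : Integrable (f : Space n → ℝ) :=
  L1.integrable_coeFn f

theorem integrable_sub_prod (μ : ProbabilityMeasure (Space n)) {E : Type*} [NormedAddCommGroup E]
    {f : Space n → E} (hf : Integrable f) :
    Integrable (fun p : Space n × Space n => f (p.2 - p.1))
      ((μ : Measure (Space n)).prod volume) := by
  have h := (measurePreserving_prod_neg_add (μ : Measure (Space n)) volume).integrable_comp_of_integrable
    (hf.comp_snd (μ : Measure (Space n)))
  refine h.congr (ae_of_all _ fun p => ?_)
  simp [neg_add_eq_sub]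

theorem integrable_convMeasure (μ : ProbabilityMeasure (Space n)) {f : Space n → ℝ}
    (hf : Integrable f) : Integrable (convMeasure μ f) :=
  (integrable_sub_prod μ hf).integral_prod_right

theorem ae_integrable_sub (μ : ProbabilityMeasure (Space n)) {f : Space n → ℝ}
    (hf : Integrable f) : ∀ᵐ x, Integrable (fun y => f (x - y)) (μ : Measure (Space n)) :=
  (integrable_sub_prod μ hf).prod_left_ae

theorem integral_norm_convMeasure_le (μ : ProbabilityMeasure (Space n)) {f : Space n → ℝ}
    (hf : Integrable f) : ∫ x, ‖convMeasure μ f x‖ ≤ ∫ x, ‖f x‖ := by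
  have hp := (integrable_sub_prod μ hf).norm
  calc ∫ x, ‖convMeasure μ f x‖
      ≤ ∫ x, ∫ y, ‖f (x - y)‖ ∂(μ : Measure (Space n)) := by
        refine integral_mono_of_nonneg (ae_of_all _ fun _ => norm_nonneg _) ?_
          (ae_of_all _ fun x => norm_integral_le_integral_norm _)
        exact hp.integral_prod_right
    _ = ∫ y, ∫ x, ‖f (x - y)‖ ∂volume ∂(μ : Measure (Space n)) :=
        (integral_integral_swap (f := fun y x => ‖f (x - y)‖) hp).symm
    _ = ∫ x, ‖f x‖ := by
        have : ∀ y, ∫ x, ‖f (x - y)‖ = ∫ x, ‖f x‖ :=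
          fun y => integral_sub_right_eq_self (fun x => ‖f x‖) y
        simp only [this, integral_const, probReal_univ, one_smul]

theorem convMeasure_add_ae (μ : ProbabilityMeasure (Space n)) {f g : Space n → ℝ}
    (hf : Integrable f) (hg : Integrable g) :
    convMeasure μ (f + g) =ᵐ[volume] convMeasure μ f + convMeasure μ g := by
  filter_upwards [ae_integrable_sub μ hf, ae_integrable_sub μ hg] with x h1 h2
  exact integral_add h1 h2

theorem convMeasure_smul (μ : ProbabilityMeasure (Space n)) (c : ℝ) (f : Space n → ℝ) :
    convMeasure μ (c • f) = c • convMeasure μ f := by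
  ext x
  exact integral_const_mul c _

theorem convMeasure_congr_ae (μ : ProbabilityMeasure (Space n)) {f g : Space n → ℝ}
    (hf : Integrable f) (hfg : f =ᵐ[volume] g) :
    convMeasure μ f =ᵐ[volume] convMeasure μ g := by
  have hg : Integrable g := hf.congr hfg
  have h0 : Integrable (f - g) := hf.sub hg
  have h1 := integral_norm_convMeasure_le μ h0
  have h2 : ∫ x, ‖(f - g) x‖ = 0 := by
    rw [integral_eq_zero_of_ae]
    filter_upwards [hfg] with x hx
    simp [hx]
  rw [h2] at h1
  have h3 := (integral_eq_zero_iff_of_nonneg_ae (ae_of_all _ fun _ => norm_nonneg _)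
    (integrable_convMeasure μ h0).norm).1
    (le_antisymm h1 (integral_nonneg fun _ => norm_nonneg _))
  filter_upwards [h3, convMeasure_add_ae μ h0 hg] with x hx hx2
  rw [sub_add_cancel] at hx2
  rw [hx2, Pi.add_apply, norm_eq_zero.1 hx, zero_add]

/-- Convolution with a probability measure, as an operator on `L¹`. -/
noncomputable def convL1 (μ : ProbabilityMeasure (Space n)) : L1 n →L[ℝ] L1 n :=
  LinearMap.mkContinuous
    { toFun := fun f => (integrable_convMeasure μ (L1.integrable_coe f)).toL1 _
      map_add' := fun f g => by
        rw [← Integrable.toL1_add]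
        apply (Integrable.toL1_eq_toL1_iff _ _ _ _).2
        exact (convMeasure_congr_ae μ (L1.integrable_coe _) (Lp.coeFn_add f g)).trans
          (convMeasure_add_ae μ (L1.integrable_coe f) (L1.integrable_coe g))
      map_smul' := fun c f => by
        simp only [RingHom.id_apply]
        rw [← Integrable.toL1_smul]
        apply (Integrable.toL1_eq_toL1_iff _ _ _ _).2
        refine (convMeasure_congr_ae μ (L1.integrable_coe _) (Lp.coeFn_smul c f)).trans ?_
        rw [convMeasure_smul]
        rfl }
    1 fun f => by
      rw [one_mul, L1.norm_eq_integral_norm, L1.norm_eq_integral_norm]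
      refine le_trans (le_of_eq (integral_congr_ae ?_))
        (integral_norm_convMeasure_le μ (L1.integrable_coe f))
      filter_upwards [(integrable_convMeasure μ (L1.integrable_coe f)).coeFn_toL1] with x hx
      simp only [LinearMap.coe_mk, AddHom.coe_mk]
      rw [hx]

theorem coeFn_convL1 (μ : ProbabilityMeasure (Space n)) (f : L1 n) :
    convL1 μ f =ᵐ[volume] convMeasure μ f :=
  (integrable_convMeasure μ (L1.integrable_coe f)).coeFn_toL1

theorem norm_convL1_le (μ : ProbabilityMeasure (Space n)) (f : L1 n) : ‖convL1 μ f‖ ≤ ‖f‖ := by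
  have := (convL1 μ).le_of_opNorm_le (LinearMap.mkContinuous_norm_le _ zero_le_one _) f
  simpa using this

end Convolution

/-! ### The Fourier transform on `L¹` -/

section Fourier

variable {n : ℕ}

/-- The Fourier transform `ξ ↦ ∫ e^{-2πi x·ξ} f(x) dx` of a real integrable function. -/
noncomputable def hat : L1 n →L[ℝ] BoundedContinuousFunction (Space n) ℂ :=
  ((Real.Lp.fourierTransformCLM (Space n) ℂ).restrictScalars ℝ).comp
    (Complex.ofRealCLM.compLpL 1 volume)

theorem hat_apply (f : L1 n) (ξ : Space n) : hat f ξ = 𝓕 (fun x => ((f x : ℝ) : ℂ)) ξ := by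
  have : hat f ξ = 𝓕 ((Complex.ofRealCLM.compLpL 1 volume f : Lp ℂ 1 volume) : Space n → ℂ) ξ := rfl
  rw [this]
  apply Real.fourier_congr_ae
  exact ContinuousLinearMap.coeFn_compLpL Complex.ofRealCLM f

theorem L1.integrable_ofReal (f : L1 n) : Integrable (fun x => ((f x : ℝ) : ℂ)) :=
  (L1.integrable_coe f).ofReal

/-- The Fourier transform is self-adjoint. -/
theorem integral_mul_fourier {f g : Space n → ℂ} (hf : Integrable f) (hg : Integrable g) :
    ∫ x, f x * 𝓕 g x = ∫ ξ, 𝓕 f ξ * g ξ := by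
  simpa using! (VectorFourier.integral_bilin_fourierIntegral_eq_flip (.mul ℂ ℂ) (L := innerₗ (Space n))
    Real.continuous_fourierChar continuous_inner hf hg).symm

theorem integral_mul_fourierInv {f g : Space n → ℂ} (hf : Integrable f) (hg : Integrable g) :
    ∫ x, f x * 𝓕⁻ g x = ∫ ξ, 𝓕⁻ f ξ * g ξ := by
  have h1 : ∀ g : Space n → ℂ, 𝓕⁻ g = fun x => 𝓕 g (-x) := fun g => by
    ext x; exact Real.fourierInv_eq_fourier_neg g x
  rw [h1 g, h1 f, ← integral_neg_eq_self]
  simp only [neg_neg]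
  have h2 := integral_mul_fourier (f := fun x => f (-x)) (g := g) hf.comp_neg hg
  rw [h2]
  congr 1; ext ξ; congr 1
  rw [← Real.fourierInv_eq_fourier_comp_neg, h1]

theorem L1.hat_pairing (f : L1 n) {g : Space n → ℂ} (hg : Integrable g) :
    ∫ x, ((f x : ℝ) : ℂ) * 𝓕 g x = ∫ ξ, hat f ξ * g ξ := by
  rw [integral_mul_fourier f.integrable_ofReal hg]
  simp only [hat_apply]

/-- Fourier inversion in `L¹`, for functions that need not be continuous. -/
theorem L1.ae_eq_fourierInv (f : L1 n) (hf : Integrable (hat f)) :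
    (fun x => ((f x : ℝ) : ℂ)) =ᵐ[volume] 𝓕⁻ (hat f : Space n → ℂ) := by
  have hcont : Continuous (𝓕⁻ (hat f : Space n → ℂ)) := by
    have h1 : 𝓕⁻ (hat f : Space n → ℂ) = fun x => 𝓕 (hat f : Space n → ℂ) (-x) := by
      ext x; exact Real.fourierInv_eq_fourier_neg _ x
    rw [h1]
    exact (VectorFourier.fourierIntegral_continuous Real.continuous_fourierChar
      (innerSL ℝ).continuous₂ hf).comp continuous_neg
  have hloc : LocallyIntegrable (fun x => ((f x : ℝ) : ℂ) - 𝓕⁻ (hat f : Space n → ℂ) x) volume :=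
    f.integrable_ofReal.locallyIntegrable.sub hcont.locallyIntegrable
  have := ae_eq_zero_of_integral_contDiff_smul_eq_zero hloc ?_
  · filter_upwards [this] with x hx
    exact sub_eq_zero.1 hx
  intro g hg hgc
  have hgc' : HasCompactSupport fun x => ((g x : ℝ) : ℂ) := hgc.comp_left (g := fun r : ℝ => (r : ℂ)) (by simp)
  have hg' : ContDiff ℝ (⊤ : ℕ∞) fun x => ((g x : ℝ) : ℂ) := Complex.ofRealCLM.contDiff.comp hg
  let χ : SchwartzMap (Space n) ℂ := hgc'.toSchwartzMap hg'
  have hχ : ∀ x, χ x = g x := fun x => rfl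
  have hbd : ∀ x, ‖𝓕⁻ (hat f : Space n → ℂ) x‖ ≤ ∫ ξ, ‖hat f ξ‖ := fun x => by
    rw [Real.fourierInv_eq']
    refine (norm_integral_le_integral_norm _).trans (le_of_eq ?_)
    congr 1; ext v
    rw [norm_smul, Complex.norm_exp_ofReal_mul_I, one_mul]
  have e1 : ∀ x, g x • (((f x : ℝ) : ℂ) - 𝓕⁻ (hat f : Space n → ℂ) x) =
      ((f x : ℝ) : ℂ) * χ x - 𝓕⁻ (hat f : Space n → ℂ) x * χ x := fun x => by
    rw [hχ, Complex.real_smul]; ring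
  have hχb : ∃ C, ∀ x, ‖χ x‖ ≤ C := ⟨‖χ.toBoundedContinuousFunction‖, fun x =>
    χ.toBoundedContinuousFunction.norm_coe_le_norm x⟩
  obtain ⟨C, hC⟩ := hχb
  have i1 : Integrable fun x => ((f x : ℝ) : ℂ) * χ x :=
    f.integrable_ofReal.mul_bdd (c := C) χ.continuous.aestronglyMeasurable (ae_of_all _ hC)
  have i2 : Integrable fun x => 𝓕⁻ (hat f : Space n → ℂ) x * χ x :=
    χ.integrable.bdd_mul (c := ∫ ξ, ‖hat f ξ‖) hcont.aestronglyMeasurable (ae_of_all _ hbd)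
  simp only [e1]
  rw [integral_sub i1 i2, sub_eq_zero]
  have e2 : ∀ x, χ x = 𝓕 (𝓕⁻ χ : SchwartzMap (Space n) ℂ) x := fun x => by
    rw [FourierTransform.fourier_fourierInv_eq χ]
  calc ∫ x, ((f x : ℝ) : ℂ) * χ x = ∫ x, ((f x : ℝ) : ℂ) * 𝓕 ((𝓕⁻ χ : SchwartzMap (Space n) ℂ) : Space n → ℂ) x := by
        congr 1; ext x; rw [e2]; rfl
    _ = ∫ ξ, hat f ξ * (𝓕⁻ χ : SchwartzMap (Space n) ℂ) ξ := f.hat_pairing (SchwartzMap.integrable _)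
    _ = ∫ ξ, hat f ξ * 𝓕⁻ (χ : Space n → ℂ) ξ := by
        rw [SchwartzMap.fourierInv_coe]
    _ = ∫ x, 𝓕⁻ (hat f : Space n → ℂ) x * χ x := integral_mul_fourierInv hf χ.integrable

theorem L1.ae_norm_le (f : L1 n) (hf : Integrable (hat f)) :
    ∀ᵐ x, |f x| ≤ ∫ ξ, ‖hat f ξ‖ := by
  filter_upwards [f.ae_eq_fourierInv hf] with x hx
  have : |f x| = ‖((f x : ℝ) : ℂ)‖ := by simp
  rw [this, hx, Real.fourierInv_eq]
  refine (norm_integral_le_integral_norm _).trans (le_of_eq ?_)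
  simp

theorem L1.hat_injective : Function.Injective (hat : L1 n → _) := by
  rw [injective_iff_map_eq_zero]
  intro f hf
  have h := f.ae_norm_le (by rw [hf]; exact integrable_zero _ _ _)
  rw [Lp.eq_zero_iff_ae_eq_zero]
  filter_upwards [h] with x hx
  simpa [hf] using hx

/-- Convolution with `μ` acts as multiplication by the Fourier transform of `μ`. -/
theorem hat_convL1 (μ : ProbabilityMeasure (Space n)) (f : L1 n) (ξ : Space n) :
    hat (convL1 μ f) ξ = (∫ y, Complex.exp (-(Complex.I * ((inner ℝ y ((2 * Real.pi) • ξ) : ℝ) : ℂ)))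
      ∂(μ : Measure (Space n))) * hat f ξ := by
  have hc : (fun x => ((convL1 μ f x : ℝ) : ℂ)) =ᵐ[volume] fun x =>
      ∫ y, ((f (x - y) : ℝ) : ℂ) ∂(μ : Measure (Space n)) := by
    filter_upwards [coeFn_convL1 μ f] with x hx
    rw [hx, convMeasure]; exact integral_ofReal.symm
  rw [hat_apply, hat_apply, Real.fourier_congr_ae hc, Real.fourier_eq', Real.fourier_eq']
  have hint : Integrable (fun p : Space n × Space n =>
      Complex.exp (↑(-2 * Real.pi * inner ℝ p.2 ξ) * Complex.I) • ((f (p.2 - p.1) : ℝ) : ℂ))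
      ((μ : Measure (Space n)).prod volume) := by
    refine (integrable_sub_prod μ f.integrable_ofReal).bdd_mul (c := 1) ?_ (ae_of_all _ fun p => ?_)
    · exact (by fun_prop : Continuous fun p : Space n × Space n =>
        Complex.exp (↑(-2 * Real.pi * inner ℝ p.2 ξ) * Complex.I)).aestronglyMeasurable
    · rw [Complex.norm_exp_ofReal_mul_I]
  calc ∫ v, Complex.exp (↑(-2 * Real.pi * inner ℝ v ξ) * Complex.I) •
        ∫ y, ((f (v - y) : ℝ) : ℂ) ∂(μ : Measure (Space n))
      = ∫ v, ∫ y, Complex.exp (↑(-2 * Real.pi * inner ℝ v ξ) * Complex.I) •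
        ((f (v - y) : ℝ) : ℂ) ∂(μ : Measure (Space n)) := by
        congr 1; ext v; rw [integral_smul]
    _ = ∫ y, ∫ v, Complex.exp (↑(-2 * Real.pi * inner ℝ v ξ) * Complex.I) •
        ((f (v - y) : ℝ) : ℂ) ∂volume ∂(μ : Measure (Space n)) :=
        (integral_integral_swap (f := fun y v => Complex.exp (↑(-2 * Real.pi * inner ℝ v ξ) * Complex.I) •
        ((f (v - y) : ℝ) : ℂ)) hint).symm
    _ = ∫ y, Complex.exp (-(Complex.I * ((inner ℝ y ((2 * Real.pi) • ξ) : ℝ) : ℂ))) *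
        (∫ v, Complex.exp (↑(-2 * Real.pi * inner ℝ v ξ) * Complex.I) • ((f v : ℝ) : ℂ))
        ∂(μ : Measure (Space n)) := by
        congr 1; ext y
        rw [← integral_const_mul, ← integral_sub_right_eq_self (fun v => Complex.exp (-(Complex.I *
          ((inner ℝ y ((2 * Real.pi) • ξ) : ℝ) : ℂ))) *
          Complex.exp (↑(-2 * Real.pi * inner ℝ v ξ) * Complex.I) • ((f v : ℝ) : ℂ)) y]
        congr 1; ext v
        rw [smul_eq_mul, smul_eq_mul, ← mul_assoc, ← Complex.exp_add]
        congr 2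
        rw [inner_sub_left, inner_smul_right]
        push_cast; ring
    _ = _ := by rw [integral_mul_const]

end Fourier

/-! ### The semigroup of a diffusion kernel -/

section KernelSemigroup

variable {n : ℕ} {J₀ : Space n → ℝ} {G : ℝ → ProbabilityMeasure (Space n)}

/-- The exponent `m(ξ) = 1 - J₀(2πξ)` of the diffusion: the Fourier multiplier of the generator is
`-m`, in the normalisation `e^{-2πi x·ξ}` of the Fourier transform. -/
noncomputable def exponent (J₀ : Space n → ℝ) (ξ : Space n) : ℝ := 1 - J₀ ((2 * Real.pi) • ξ)

theorem IsDiffusionKernel.integral_exp (hG : IsDiffusionKernel J₀ G) {t : ℝ} (ht : 0 < t)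
    (ξ : Space n) :
    ∫ y, Complex.exp (-(Complex.I * ((inner ℝ y ((2 * Real.pi) • ξ) : ℝ) : ℂ)))
      ∂(G t : Measure (Space n)) = ((Real.exp (-(t * exponent J₀ ξ)) : ℝ) : ℂ) := by
  rw [hG.fourier t ht, exponent]
  congr 2; ring

/-- The Fourier transform of a probability measure is bounded by one. -/
theorem IsDiffusionKernel.symbol_le_one (hG : IsDiffusionKernel J₀ G) (ξ : Space n) :
    J₀ ξ ≤ 1 := by
  have h := hG.fourier 1 one_pos ξ
  have h2 : ‖∫ x, Complex.exp (-(Complex.I * ((inner ℝ x ξ : ℝ) : ℂ))) ∂(G 1 : Measure (Space n))‖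
      ≤ 1 := by
    refine (norm_integral_le_of_norm_le_const (C := 1) (ae_of_all _ fun x => ?_)).trans (by simp)
    rw [show -(Complex.I * ((inner ℝ x ξ : ℝ) : ℂ)) = ((-inner ℝ x ξ : ℝ) : ℂ) * Complex.I by
      push_cast; ring, Complex.norm_exp_ofReal_mul_I]
  rw [h, Complex.norm_real, Real.norm_of_nonneg (Real.exp_pos _).le, Real.exp_le_one_iff] at h2
  linarith

theorem IsDiffusionKernel.exponent_nonneg (hG : IsDiffusionKernel J₀ G) (ξ : Space n) :
    0 ≤ exponent J₀ ξ := sub_nonneg.2 (hG.symbol_le_one _)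

/-- The symbol is even, because the Fourier transforms of the kernels are real. -/
theorem IsDiffusionKernel.symbol_neg (hG : IsDiffusionKernel J₀ G) (ξ : Space n) :
    J₀ (-ξ) = J₀ ξ := by
  have h1 := hG.fourier 1 one_pos ξ
  have h2 := hG.fourier 1 one_pos (-ξ)
  have h3 := congrArg (starRingEnd ℂ) h1
  rw [← integral_conj, Complex.conj_ofReal] at h3
  have h4 : ∀ x : Space n, (starRingEnd ℂ) (Complex.exp (-(Complex.I * ((inner ℝ x ξ : ℝ) : ℂ)))) =
      Complex.exp (-(Complex.I * ((inner ℝ x (-ξ) : ℝ) : ℂ))) := fun x => by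
    rw [← Complex.exp_conj, inner_neg_right]
    simp
  simp only [h4] at h3
  rw [h2] at h3
  have h5 := Real.exp_injective (Complex.ofReal_injective h3)
  linarith

theorem IsDiffusionKernel.exponent_neg (hG : IsDiffusionKernel J₀ G) (ξ : Space n) :
    exponent J₀ (-ξ) = exponent J₀ ξ := by
  rw [exponent, exponent, smul_neg, hG.symbol_neg]

/-- The kernels converge narrowly to the Dirac mass at the origin as `t → 0⁺`, by Lévy's
continuity theorem. -/
theorem IsDiffusionKernel.tendsto_dirac (hG : IsDiffusionKernel J₀ G) :
    Tendsto G (𝓝[>] 0) (𝓝 ⟨Measure.dirac 0, Measure.dirac.isProbabilityMeasure⟩) := by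
  refine tendsto_of_seq_tendsto fun u hu => ?_
  have hpos : ∀ᶠ k in atTop, 0 < u k := hu self_mem_nhdsWithin
  have hu0 : Tendsto u atTop (𝓝 0) := hu.mono_right nhdsWithin_le_nhds
  apply ProbabilityMeasure.tendsto_of_tendsto_charFun
  intro ξ
  have hlim : Tendsto (fun k => ((Real.exp (u k * (J₀ (-ξ) - 1)) : ℝ) : ℂ)) atTop (𝓝 1) := by
    have h0 : Tendsto (fun k => u k * (J₀ (-ξ) - 1)) atTop (𝓝 0) := by
      simpa using hu0.mul_const (J₀ (-ξ) - 1)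
    have h1 := (Real.continuous_exp.tendsto _).comp h0
    rw [Real.exp_zero] at h1
    have := (Complex.continuous_ofReal.tendsto _).comp h1
    rw [Complex.ofReal_one] at this
    exact this
  have hd : charFun (Measure.dirac (0 : Space n)) ξ = 1 := by simp [charFun_apply]
  simp only [ProbabilityMeasure.coe_mk, hd]
  refine hlim.congr' ?_
  filter_upwards [hpos] with k hk
  rw [← hG.fourier (u k) hk (-ξ), charFun_apply]
  congr 1; ext x
  rw [inner_neg_right]
  congr 1; push_cast; ring

/-- Convolution with `G(t)` on `L¹`, extended to nonpositive times by the identity. -/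
noncomputable def kernelOp (G : ℝ → ProbabilityMeasure (Space n)) (t : ℝ) : L1 n →L[ℝ] L1 n :=
  if t ≤ 0 then ContinuousLinearMap.id ℝ _ else convL1 (G t)

theorem kernelOp_of_nonpos {t : ℝ} (ht : t ≤ 0) (f : L1 n) : kernelOp G t f = f := by
  simp [kernelOp, ht]

theorem kernelOp_of_pos {t : ℝ} (ht : 0 < t) (f : L1 n) : kernelOp G t f = convL1 (G t) f := by
  simp [kernelOp, ht.not_ge]

theorem norm_kernelOp_le (t : ℝ) (f : L1 n) : ‖kernelOp G t f‖ ≤ ‖f‖ := by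
  rcases le_or_gt t 0 with h | h
  · rw [kernelOp_of_nonpos h]
  · rw [kernelOp_of_pos h]; exact norm_convL1_le _ _

theorem IsDiffusionKernel.hat_kernelOp (hG : IsDiffusionKernel J₀ G) {t : ℝ} (ht : 0 ≤ t)
    (f : L1 n) (ξ : Space n) :
    hat (kernelOp G t f) ξ = ((Real.exp (-(t * exponent J₀ ξ)) : ℝ) : ℂ) * hat f ξ := by
  rcases ht.eq_or_lt with rfl | h
  · rw [kernelOp_of_nonpos le_rfl]; simp
  · rw [kernelOp_of_pos h, hat_convL1, hG.integral_exp h]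

/-- The semigroup law, read off from the Fourier transforms. -/
theorem IsDiffusionKernel.kernelOp_add (hG : IsDiffusionKernel J₀ G) {s t : ℝ} (hs : 0 ≤ s)
    (ht : 0 ≤ t) (f : L1 n) : kernelOp G (s + t) f = kernelOp G s (kernelOp G t f) := by
  apply L1.hat_injective
  ext ξ
  rw [hG.hat_kernelOp (by positivity), hG.hat_kernelOp hs, hG.hat_kernelOp ht, ← mul_assoc,
    ← Complex.ofReal_mul, ← Real.exp_add]
  congr 3; ring

/-- The translate `x ↦ f(x - y)` of an integrable function. -/
noncomputable def translateL1 (f : L1 n) (y : Space n) : L1 n :=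
  Lp.compMeasurePreserving (fun x => x - y) (measurePreserving_sub_right volume y) f

theorem continuous_translate (f : L1 n) : Continuous (translateL1 f) := by
  have hc : Continuous fun y : Space n => (⟨fun x => x - y, by fun_prop⟩ : C(Space n, Space n)) :=
    ContinuousMap.continuous_of_continuous_uncurry _
      (by exact (continuous_snd.sub continuous_fst))
  exact Continuous.compMeasurePreservingLp (continuous_const (y := f)) hc
    (fun y => measurePreserving_sub_right volume y) ENNReal.one_ne_top

theorem coeFn_translate (f : L1 n) (y : Space n) : translateL1 f y =ᵐ[volume] fun x => f (x - y) :=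
  Lp.coeFn_compMeasurePreserving _ _

/-- Strong continuity of the semigroup at `t = 0` reduces to narrow convergence of the kernels, tested
against the modulus of continuity `y ↦ ‖f(· - y) - f‖` of translations. -/
theorem norm_convL1_sub_le (μ : ProbabilityMeasure (Space n)) (f : L1 n) :
    ‖convL1 μ f - f‖ ≤ ∫ y, ‖translateL1 f y - f‖ ∂(μ : Measure (Space n)) := by
  have h1 : Integrable (fun p : Space n × Space n => f (p.2 - p.1) - f p.2)
      ((μ : Measure (Space n)).prod volume) :=
    (integrable_sub_prod μ f.integrable_coe).sub (f.integrable_coe.comp_snd _)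
  calc ‖convL1 μ f - f‖ = ∫ x, ‖∫ y, (f (x - y) - f x) ∂(μ : Measure (Space n))‖ := by
        rw [L1.norm_eq_integral_norm]
        apply integral_congr_ae
        filter_upwards [Lp.coeFn_sub (convL1 μ f) f, coeFn_convL1 μ f,
          ae_integrable_sub μ f.integrable_coe] with x hx hx2 hx3
        rw [hx, Pi.sub_apply, hx2, convMeasure, integral_sub hx3 (integrable_const _)]
        simp
    _ ≤ ∫ x, ∫ y, ‖f (x - y) - f x‖ ∂(μ : Measure (Space n)) := by
        refine integral_mono_of_nonneg (ae_of_all _ fun _ => norm_nonneg _) ?_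
          (ae_of_all _ fun x => norm_integral_le_integral_norm _)
        exact h1.norm.integral_prod_right
    _ = ∫ y, ∫ x, ‖f (x - y) - f x‖ ∂volume ∂(μ : Measure (Space n)) :=
        (integral_integral_swap (f := fun y x => ‖f (x - y) - f x‖) h1.norm).symm
    _ = _ := by
        congr 1; ext y
        rw [L1.norm_eq_integral_norm]
        apply integral_congr_ae
        filter_upwards [Lp.coeFn_sub (translateL1 f y) f, coeFn_translate f y] with x hx hx2
        rw [hx, Pi.sub_apply, hx2]

theorem IsDiffusionKernel.tendsto_norm_kernelOp_sub (hG : IsDiffusionKernel J₀ G) (f : L1 n) :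
    Tendsto (fun h => ‖kernelOp G h f - f‖) (𝓝 0) (𝓝 0) := by
  have hk : Continuous fun y => ‖translateL1 f y - f‖ :=
    ((continuous_translate f).sub continuous_const).norm
  have hkb : ∀ y, ‖(‖translateL1 f y - f‖)‖ ≤ 2 * ‖f‖ := fun y => by
    rw [norm_norm]
    refine (norm_sub_le _ _).trans ?_
    rw [translateL1, Lp.norm_compMeasurePreserving]
    linarith
  let k : BoundedContinuousFunction (Space n) ℝ :=
    BoundedContinuousFunction.ofNormedAddCommGroup _ hk _ hkb
  have h1 := ProbabilityMeasure.tendsto_iff_forall_integral_tendsto.1 hG.tendsto_dirac k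
  have h2 : ∫ y, k y ∂(Measure.dirac (0 : Space n)) = 0 := by
    rw [integral_dirac]
    have : translateL1 f 0 = f := by
      apply Lp.ext
      filter_upwards [coeFn_translate f 0] with x hx
      simpa using hx
    change ‖translateL1 f 0 - f‖ = 0
    simp [this]
  simp only [ProbabilityMeasure.coe_mk, h2] at h1
  have hpos : Tendsto (fun h => ‖kernelOp G h f - f‖) (𝓝[>] 0) (𝓝 0) := by
    refine squeeze_zero' (Eventually.of_forall fun _ => norm_nonneg _) ?_ h1
    filter_upwards [self_mem_nhdsWithin] with h hh
    rw [kernelOp_of_pos hh]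
    exact norm_convL1_sub_le _ _
  have hneg : Tendsto (fun h => ‖kernelOp G h f - f‖) (𝓝[≤] 0) (𝓝 0) := by
    refine tendsto_const_nhds.congr' ?_
    filter_upwards [self_mem_nhdsWithin] with h hh
    rw [kernelOp_of_nonpos hh]; simp
  have h3 := hneg.sup hpos
  rwa [nhdsLE_sup_nhdsGT] at h3

theorem IsDiffusionKernel.norm_kernelOp_sub_le (hG : IsDiffusionKernel J₀ G) (f : L1 n)
    (s t : ℝ) :
    ‖kernelOp G t f - kernelOp G s f‖ ≤ ‖kernelOp G |max t 0 - max s 0| f - f‖ := by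
  have hmax : ∀ r, kernelOp G r f = kernelOp G (max r 0) f := fun r => by
    rcases le_total r 0 with h | h
    · rw [max_eq_right h, kernelOp_of_nonpos h, kernelOp_of_nonpos le_rfl]
    · rw [max_eq_left h]
  have key : ∀ a b : ℝ, 0 ≤ a → a ≤ b →
      ‖kernelOp G b f - kernelOp G a f‖ ≤ ‖kernelOp G (b - a) f - f‖ := by
    intro a b ha hab
    have : kernelOp G b f = kernelOp G a (kernelOp G (b - a) f) := by
      rw [← hG.kernelOp_add ha (by linarith)]; congr 2; ring
    rw [this, ← map_sub]
    exact norm_kernelOp_le _ _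
  rw [hmax t, hmax s]
  rcases le_total (max s 0) (max t 0) with h | h
  · rw [abs_of_nonneg (by linarith)]
    exact key _ _ (le_max_right _ _) h
  · rw [abs_of_nonpos (by linarith), norm_sub_rev, neg_sub]
    exact key _ _ (le_max_right _ _) h

/-- The semigroup `S(t) f = G(t) * f` on `L¹(ℝ^N)`. -/
noncomputable def IsDiffusionKernel.semigroup (hG : IsDiffusionKernel J₀ G) :
    ContractionSemigroup (L1 n) where
  op := kernelOp G
  op_of_nonpos _ ht f := kernelOp_of_nonpos ht f
  op_add _ _ hs ht f := hG.kernelOp_add hs ht f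
  norm_op_le := norm_kernelOp_le
  continuous_orbit f := by
    rw [continuous_iff_continuousAt]
    intro s
    rw [ContinuousAt, tendsto_iff_norm_sub_tendsto_zero]
    refine squeeze_zero (fun _ => norm_nonneg _) (fun t => hG.norm_kernelOp_sub_le f s t) ?_
    have hc : Tendsto (fun t : ℝ => |max t 0 - max s 0|) (𝓝 s) (𝓝 0) := by
      have : Continuous fun t : ℝ => |max t 0 - max s 0| := by fun_prop
      simpa using this.tendsto s
    exact (hG.tendsto_norm_kernelOp_sub f).comp hc

theorem IsDiffusionKernel.semigroup_op (hG : IsDiffusionKernel J₀ G) (t : ℝ) :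
    hG.semigroup.op t = kernelOp G t := rfl

end KernelSemigroup

/-! ### Quadratic growth of the exponent -/

section ExponentGrowth

variable {n : ℕ} {J₀ : Space n → ℝ} {G : ℝ → ProbabilityMeasure (Space n)}

theorem IsDiffusionKernel.integral_one_sub_cos (hG : IsDiffusionKernel J₀ G) {t : ℝ} (ht : 0 < t)
    (ξ : Space n) :
    ∫ x, (1 - Real.cos (inner ℝ x ξ)) ∂(G t : Measure (Space n)) =
      1 - Real.exp (t * (J₀ ξ - 1)) := by
  have hcos : Integrable (fun x => Real.cos (inner ℝ x ξ)) (G t : Measure (Space n)) :=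
    Integrable.of_bound (by fun_prop : Continuous fun x : Space n =>
      Real.cos (inner ℝ x ξ)).aestronglyMeasurable 1 (ae_of_all _ fun x => Real.abs_cos_le_one _)
  have hexp : Integrable (fun x => Complex.exp (-(Complex.I * ((inner ℝ x ξ : ℝ) : ℂ))))
      (G t : Measure (Space n)) := by
    refine Integrable.of_bound (by fun_prop : Continuous fun x : Space n =>
      Complex.exp (-(Complex.I * ((inner ℝ x ξ : ℝ) : ℂ)))).aestronglyMeasurable 1
      (ae_of_all _ fun x => ?_)
    rw [show -(Complex.I * ((inner ℝ x ξ : ℝ) : ℂ)) = ((-inner ℝ x ξ : ℝ) : ℂ) * Complex.I by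
      push_cast; ring, Complex.norm_exp_ofReal_mul_I]
  rw [integral_sub (integrable_const _) hcos]
  have h := congrArg Complex.re (hG.fourier t ht ξ)
  rw [Complex.ofReal_re] at h
  have h2 : (∫ x, Complex.exp (-(Complex.I * ((inner ℝ x ξ : ℝ) : ℂ))) ∂(G t : Measure (Space n))).re
      = ∫ x, Real.cos (inner ℝ x ξ) ∂(G t : Measure (Space n)) := by
    have := (integral_re hexp)
    simp only [RCLike.re_eq_complex_re] at this
    rw [← this]
    congr 1; ext x
    rw [show -(Complex.I * ((inner ℝ x ξ : ℝ) : ℂ)) = ((-inner ℝ x ξ : ℝ) : ℂ) * Complex.I by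
      push_cast; ring, Complex.exp_ofReal_mul_I_re, Real.cos_neg]
  rw [← h, h2]; simp

/-- Doubling inequality for the exponent, from `1 - cos 2θ ≤ 4 (1 - cos θ)`. -/
theorem IsDiffusionKernel.one_sub_symbol_two_smul_le (hG : IsDiffusionKernel J₀ G) (ξ : Space n) :
    1 - J₀ ((2 : ℝ) • ξ) ≤ 4 * (1 - J₀ ξ) := by
  have key : ∀ t : ℝ, 0 < t →
      t⁻¹ * (1 - Real.exp (t * (J₀ ((2 : ℝ) • ξ) - 1))) ≤ 4 * (1 - J₀ ξ) := by
    intro t ht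
    have hi : ∀ η : Space n, Integrable (fun x => 1 - Real.cos (inner ℝ x η))
        (G t : Measure (Space n)) := fun η =>
      Integrable.of_bound (by fun_prop : Continuous fun x : Space n =>
        1 - Real.cos (inner ℝ x η)).aestronglyMeasurable 2 (ae_of_all _ fun x => by
          have := Real.neg_one_le_cos (inner ℝ x η)
          have := Real.cos_le_one (inner ℝ x η)
          rw [Real.norm_eq_abs, abs_le]; constructor <;> linarith)
    have h1 : ∫ x, (1 - Real.cos (inner ℝ x ((2 : ℝ) • ξ))) ∂(G t : Measure (Space n)) ≤
        ∫ x, 4 * (1 - Real.cos (inner ℝ x ξ)) ∂(G t : Measure (Space n)) := by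
      refine integral_mono (hi _) ((hi ξ).const_mul 4) fun x => ?_
      simp only [inner_smul_right, Real.cos_two_mul]
      nlinarith [sq_nonneg (Real.cos (inner ℝ x ξ) - 1)]
    rw [integral_const_mul, hG.integral_one_sub_cos ht, hG.integral_one_sub_cos ht] at h1
    have h2 : 1 - Real.exp (t * (J₀ ξ - 1)) ≤ t * (1 - J₀ ξ) := by
      linarith [Real.add_one_le_exp (t * (J₀ ξ - 1))]
    rw [inv_mul_le_iff₀ ht]
    linarith
  have hd : HasDerivAt (fun t : ℝ => 1 - Real.exp (t * (J₀ ((2 : ℝ) • ξ) - 1)))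
      (1 - J₀ ((2 : ℝ) • ξ)) 0 := by
    refine ((((hasDerivAt_id (0 : ℝ)).mul_const (J₀ ((2 : ℝ) • ξ) - 1)).exp).const_sub
      1).congr_deriv ?_
    simp
  have hs := (hasDerivAt_iff_tendsto_slope_zero.1 hd).mono_left
    (nhdsWithin_mono 0 (fun x (hx : x ∈ Set.Ioi (0 : ℝ)) => (ne_of_gt hx : x ≠ 0)))
  refine le_of_tendsto hs ?_
  filter_upwards [self_mem_nhdsWithin] with t ht
  simpa using key t ht

/-- The exponent grows at most quadratically. -/
theorem IsDiffusionKernel.exists_exponent_le (hG : IsDiffusionKernel J₀ G) (hJ : Continuous J₀) :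
    ∃ C, 0 ≤ C ∧ ∀ ξ, exponent J₀ ξ ≤ C * (1 + ‖ξ‖ ^ 2) := by
  obtain ⟨M, hM⟩ := (isCompact_closedBall (0 : Space n) 2).exists_bound_of_continuousOn
    (f := fun ξ => 1 - J₀ ξ) (by fun_prop)
  have hM0 : 0 ≤ M := (norm_nonneg _).trans (hM 0 (by simp))
  have hball : ∀ ξ : Space n, ‖ξ‖ ≤ 2 → 1 - J₀ ξ ≤ M := fun ξ hξ =>
    (Real.le_norm_self _).trans (hM ξ (by simpa using hξ))
  -- Dyadic induction on the size of the frequency by the doubling inequality.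
  have hind : ∀ k : ℕ, ∀ ξ : Space n, ‖ξ‖ ≤ 2 ^ k → 1 - J₀ ξ ≤ M * max 1 (‖ξ‖ ^ 2) := by
    intro k
    induction k with
    | zero =>
      intro ξ hξ
      calc _ ≤ M := hball ξ (by simp at hξ; linarith)
        _ ≤ _ := le_mul_of_one_le_right hM0 (le_max_left _ _)
    | succ k ih =>
      intro ξ hξ
      rcases le_or_gt ‖ξ‖ 2 with h | h
      · calc _ ≤ M := hball ξ h
          _ ≤ _ := le_mul_of_one_le_right hM0 (le_max_left _ _)
      · have h2 : ‖(2⁻¹ : ℝ) • ξ‖ = ‖ξ‖ / 2 := by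
          rw [norm_smul]; norm_num; ring
        have h3 := ih ((2⁻¹ : ℝ) • ξ) (by rw [h2]; rw [pow_succ] at hξ; linarith)
        have h4 := hG.one_sub_symbol_two_smul_le ((2⁻¹ : ℝ) • ξ)
        rw [smul_smul, mul_inv_cancel₀ two_ne_zero, one_smul] at h4
        rw [h2, max_eq_right (by nlinarith)] at h3
        calc _ ≤ M * ‖ξ‖ ^ 2 := by linarith
          _ ≤ _ := mul_le_mul_of_nonneg_left (le_max_right _ _) hM0
  refine ⟨M * (2 * Real.pi) ^ 2, by positivity, fun ξ => ?_⟩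
  -- `exponent J₀ ξ = 1 - J₀(2πξ)`, so the bound on `J₀` is used at `2πξ`.
  obtain ⟨k, hk⟩ := pow_unbounded_of_one_lt ‖(2 * Real.pi) • ξ‖ one_lt_two
  have hpi : 1 ≤ (2 * Real.pi) ^ 2 := by nlinarith [Real.pi_gt_three]
  calc exponent J₀ ξ ≤ M * max 1 (‖(2 * Real.pi) • ξ‖ ^ 2) := hind k _ hk.le
    _ ≤ M * ((2 * Real.pi) ^ 2 * (1 + ‖ξ‖ ^ 2)) := by
      gcongr
      rw [norm_smul, Real.norm_of_nonneg (by positivity), mul_pow]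
      refine max_le ?_ ?_ <;> nlinarith [sq_nonneg ‖ξ‖]
    _ = _ := by ring

theorem continuous_exponent (hJ : Continuous J₀) : Continuous (exponent J₀) := by
  unfold exponent; fun_prop

end ExponentGrowth

/-! ### The duality between `L¹` and bounded continuous functions -/

section Pairing

variable {n : ℕ}

/-- The pairing `∫ f g` of an integrable function and a bounded continuous function. -/
noncomputable def pairing : L1 n →L[ℝ] BoundedContinuousFunction (Space n) ℝ →L[ℝ] ℝ :=
  have hint : ∀ (f : L1 n) (g : BoundedContinuousFunction (Space n) ℝ),
      Integrable fun x => f x * g x := fun f g =>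
    f.integrable_coe.mul_bdd (c := ‖g‖) g.continuous.aestronglyMeasurable
      (ae_of_all _ g.norm_coe_le_norm)
  LinearMap.mkContinuous₂
    (LinearMap.mk₂ ℝ (fun (f : L1 n) (g : BoundedContinuousFunction (Space n) ℝ) => ∫ x, f x * g x)
      (fun f₁ f₂ g => by
        rw [← integral_add (hint f₁ g) (hint f₂ g)]
        apply integral_congr_ae
        filter_upwards [Lp.coeFn_add f₁ f₂] with x hx
        rw [hx, Pi.add_apply, add_mul])
      (fun c f g => by
        rw [smul_eq_mul, ← integral_const_mul]
        apply integral_congr_ae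
        filter_upwards [Lp.coeFn_smul c f] with x hx
        rw [hx, Pi.smul_apply, smul_eq_mul, mul_assoc])
      (fun f g₁ g₂ => by
        rw [← integral_add (hint f g₁) (hint f g₂)]
        congr 1; ext x
        simp [mul_add])
      (fun c f g => by
        rw [smul_eq_mul, ← integral_const_mul]
        congr 1; ext x
        simp; ring))
    1 (fun f g => by
      rw [one_mul, LinearMap.mk₂_apply, L1.norm_eq_integral_norm, ← integral_mul_const]
      refine norm_integral_le_of_norm_le (f.integrable_coe.norm.mul_const _) (ae_of_all _ fun x => ?_)
      rw [norm_mul]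
      gcongr
      exact g.norm_coe_le_norm x)

theorem pairing_apply (f : L1 n) (g : BoundedContinuousFunction (Space n) ℝ) :
    pairing f g = ∫ x, f x * g x := rfl

/-- A Schwartz function as a bounded continuous function. -/
noncomputable abbrev toBCF :
    SchwartzMap (Space n) ℝ →L[ℝ] BoundedContinuousFunction (Space n) ℝ :=
  SchwartzMap.toBoundedContinuousFunctionCLM ℝ (Space n) ℝ

/-- The inverse Fourier transform of a real Schwartz function. -/
noncomputable def schwartzInv : SchwartzMap (Space n) ℝ →L[ℝ] SchwartzMap (Space n) ℂ :=
  ((FourierTransform.fourierInvCLM ℂ (SchwartzMap (Space n) ℂ)).restrictScalars ℝ).comp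
    (SchwartzMap.postcompCLM Complex.ofRealCLM)

theorem fourier_schwartzInv (φ : SchwartzMap (Space n) ℝ) (x : Space n) :
    𝓕 (schwartzInv φ : Space n → ℂ) x = ((φ x : ℝ) : ℂ) := by
  have h : (𝓕 (schwartzInv φ) : SchwartzMap (Space n) ℂ) =
      SchwartzMap.postcompCLM Complex.ofRealCLM φ :=
    FourierTransform.fourier_fourierInv_eq (SchwartzMap.postcompCLM Complex.ofRealCLM φ)
  calc 𝓕 (schwartzInv φ : Space n → ℂ) x = (𝓕 (schwartzInv φ) : SchwartzMap (Space n) ℂ) x := rfl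
    _ = _ := by rw [h]; rfl

/-- The function `ξ ↦ (1 + |ξ|²) φ̌(ξ)` as an element of `L¹`, for a Schwartz function `φ`. -/
noncomputable def weightedInv : SchwartzMap (Space n) ℝ →L[ℝ] Lp ℂ 1 (volume : Measure (Space n)) :=
  (SchwartzMap.toLpCLM ℝ ℂ 1 volume).comp
    ((SchwartzMap.smulLeftCLM ℂ (fun ξ : Space n => (1 + ‖ξ‖ ^ 2 : ℝ))).comp schwartzInv)

theorem smulLeft_schwartzInv (φ : SchwartzMap (Space n) ℝ) (ξ : Space n) :
    SchwartzMap.smulLeftCLM ℂ (fun ξ : Space n => (1 + ‖ξ‖ ^ 2 : ℝ)) (schwartzInv φ) ξ =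
      (1 + ‖ξ‖ ^ 2 : ℝ) • schwartzInv φ ξ := by
  rw [SchwartzMap.smulLeftCLM_apply_apply]
  exact (Function.HasTemperateGrowth.const 1).add (Function.hasTemperateGrowth_norm_sq _)

theorem norm_weightedInv (φ : SchwartzMap (Space n) ℝ) :
    ‖weightedInv φ‖ = ∫ ξ, (1 + ‖ξ‖ ^ 2) * ‖schwartzInv φ ξ‖ := by
  have : weightedInv φ = (SchwartzMap.smulLeftCLM ℂ (fun ξ : Space n => (1 + ‖ξ‖ ^ 2 : ℝ))
    (schwartzInv φ)).toLp 1 volume := rfl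
  rw [this, SchwartzMap.norm_toLp_one]
  congr 1; ext ξ
  rw [smulLeft_schwartzInv, norm_smul, Real.norm_of_nonneg (by positivity)]

theorem integrable_weight_schwartzInv (φ : SchwartzMap (Space n) ℝ) :
    Integrable fun ξ => (1 + ‖ξ‖ ^ 2) * ‖schwartzInv φ ξ‖ := by
  have := (SchwartzMap.smulLeftCLM ℂ (fun ξ : Space n => (1 + ‖ξ‖ ^ 2 : ℝ))
    (schwartzInv φ)).integrable (μ := volume)
  refine this.norm.congr (ae_of_all _ fun ξ => ?_)
  simp only
  rw [smulLeft_schwartzInv, norm_smul, Real.norm_of_nonneg (by positivity)]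

theorem pairing_toBCF (f : L1 n) (φ : SchwartzMap (Space n) ℝ) :
    ((pairing f (toBCF φ) : ℝ) : ℂ) = ∫ ξ, hat f ξ * schwartzInv φ ξ := by
  rw [← f.hat_pairing (schwartzInv φ).integrable, pairing_apply]
  simp only [fourier_schwartzInv, ← Complex.ofReal_mul]
  exact integral_ofReal.symm

end Pairing

/-! ### The generator as a Fourier multiplier -/

section Generator

variable {n : ℕ} {J₀ : Space n → ℝ} {G : ℝ → ProbabilityMeasure (Space n)}
  {A : SchwartzMap (Space n) ℝ → Space n → ℝ}

/-- Differentiation of `∫ e^{-hm} q` at `h = 0⁺`. -/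
theorem tendsto_integral_exp_multiplier {m : Space n → ℝ} (hm : Continuous m) (hm0 : ∀ ξ, 0 ≤ m ξ)
    {q : Space n → ℂ} (hq : Integrable q) (hmq : Integrable fun ξ => ((m ξ : ℝ) : ℂ) * q ξ) :
    Tendsto (fun h : ℝ => ((h⁻¹ : ℝ) : ℂ) *
      ((∫ ξ, ((Real.exp (-(h * m ξ)) : ℝ) : ℂ) * q ξ) - ∫ ξ, q ξ)) (𝓝[>] 0)
      (𝓝 (∫ ξ, -((m ξ : ℝ) : ℂ) * q ξ)) := by
  have hlim : Tendsto (fun h : ℝ => ∫ ξ, ((h⁻¹ * (Real.exp (-(h * m ξ)) - 1) : ℝ) : ℂ) * q ξ)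
      (𝓝[>] 0) (𝓝 (∫ ξ, -((m ξ : ℝ) : ℂ) * q ξ)) := by
    apply tendsto_integral_filter_of_dominated_convergence (fun ξ => ‖((m ξ : ℝ) : ℂ) * q ξ‖)
    · refine Eventually.of_forall fun h => ?_
      exact (by fun_prop : Continuous fun ξ =>
        ((h⁻¹ * (Real.exp (-(h * m ξ)) - 1) : ℝ) : ℂ)).aestronglyMeasurable.mul
          hq.aestronglyMeasurable
    · filter_upwards [self_mem_nhdsWithin] with h hh
      refine ae_of_all _ fun ξ => ?_
      have hh' : 0 < h := hh
      rw [norm_mul, norm_mul, Complex.norm_real, Complex.norm_real]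
      gcongr
      have h1 := Real.add_one_le_exp (-(h * m ξ))
      have h2 : Real.exp (-(h * m ξ)) ≤ 1 :=
        Real.exp_le_one_iff.2 (neg_nonpos.2 (mul_nonneg hh'.le (hm0 ξ)))
      rw [Real.norm_of_nonneg (hm0 ξ), norm_mul, norm_inv, Real.norm_of_nonneg hh'.le,
        Real.norm_of_nonpos (by linarith), inv_mul_le_iff₀ hh']
      linarith
    · exact hmq.norm
    · refine ae_of_all _ fun ξ => ?_
      have hd : HasDerivAt (fun h : ℝ => Real.exp (-(h * m ξ))) (-m ξ) 0 := by
        refine (((hasDerivAt_id (0 : ℝ)).mul_const (m ξ)).neg.exp).congr_deriv ?_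
        simp
      have hs := (hasDerivAt_iff_tendsto_slope_zero.1 hd).mono_left
        (nhdsWithin_mono 0 (fun x (hx : x ∈ Set.Ioi (0 : ℝ)) => (ne_of_gt hx : x ≠ 0)))
      have hs2 : Tendsto (fun h : ℝ => h⁻¹ * (Real.exp (-(h * m ξ)) - 1)) (𝓝[>] 0)
          (𝓝 (-m ξ)) := by simpa using hs
      have := ((Complex.continuous_ofReal.tendsto _).comp hs2).mul_const (q ξ)
      rw [Complex.ofReal_neg] at this
      exact this
  refine hlim.congr' ?_
  filter_upwards [self_mem_nhdsWithin] with h hh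
  have hh' : 0 < h := hh
  have hi : Integrable fun ξ => ((Real.exp (-(h * m ξ)) : ℝ) : ℂ) * q ξ := by
    refine hq.bdd_mul (c := 1) (by fun_prop : Continuous fun ξ =>
        ((Real.exp (-(h * m ξ)) : ℝ) : ℂ)).aestronglyMeasurable (ae_of_all _ fun ξ => ?_)
    rw [Complex.norm_real, Real.norm_of_nonneg (Real.exp_pos _).le]
    exact Real.exp_le_one_iff.2 (neg_nonpos.2 (mul_nonneg hh'.le (hm0 ξ)))
  rw [← integral_sub hi hq, ← integral_const_mul]
  congr 1; ext ξ
  push_cast; ring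

theorem IsDiffusionKernel.integrable_exponent_mul (hG : IsDiffusionKernel J₀ G)
    (hJ : Continuous J₀) (φ : SchwartzMap (Space n) ℝ) :
    Integrable fun ξ => ((exponent J₀ ξ : ℝ) : ℂ) * schwartzInv φ ξ := by
  obtain ⟨C, hC, hle⟩ := hG.exists_exponent_le hJ
  refine ((integrable_weight_schwartzInv φ).const_mul C).mono' ?_ (ae_of_all _ fun ξ => ?_)
  · exact ((Complex.continuous_ofReal.comp (continuous_exponent hJ)).mul
      (schwartzInv φ).continuous).aestronglyMeasurable
  · rw [norm_mul, Complex.norm_real, Real.norm_of_nonneg (hG.exponent_nonneg ξ), ← mul_assoc]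
    gcongr
    exact hle ξ

/-- Pointwise Fourier representation of `G(t) * φ`, needed because the generator is defined by
pointwise limits. -/
theorem IsDiffusionKernel.convMeasure_schwartz (hG : IsDiffusionKernel J₀ G)
    {t : ℝ} (ht : 0 < t) (φ : SchwartzMap (Space n) ℝ) (x : Space n) :
    ((convMeasure (G t) (fun y => φ y) x : ℝ) : ℂ) =
      ∫ ξ, ((Real.exp (-(t * exponent J₀ ξ)) : ℝ) : ℂ) *
        (Complex.exp (↑(-2 * Real.pi * inner ℝ ξ x) * Complex.I) * schwartzInv φ ξ) := by
  have h1 : ∀ y, ((φ (x - y) : ℝ) : ℂ) =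
      ∫ ξ, Complex.exp (↑(-2 * Real.pi * inner ℝ ξ (x - y)) * Complex.I) * schwartzInv φ ξ :=
    fun y => by rw [← fourier_schwartzInv, Real.fourier_eq']; rfl
  have hint : Integrable (fun p : Space n × Space n =>
      Complex.exp (↑(-2 * Real.pi * inner ℝ p.2 (x - p.1)) * Complex.I) * schwartzInv φ p.2)
      ((G t : Measure (Space n)).prod volume) := by
    refine ((schwartzInv φ).integrable.comp_snd _).bdd_mul (c := 1) ?_ (ae_of_all _ fun p => ?_)
    · exact (by fun_prop : Continuous fun p : Space n × Space n =>
        Complex.exp (↑(-2 * Real.pi * inner ℝ p.2 (x - p.1)) * Complex.I)).aestronglyMeasurable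
    · rw [Complex.norm_exp_ofReal_mul_I]
  calc ((convMeasure (G t) (fun y => φ y) x : ℝ) : ℂ)
      = ∫ y, ((φ (x - y) : ℝ) : ℂ) ∂(G t : Measure (Space n)) := by
        rw [convMeasure]; exact integral_ofReal.symm
    _ = ∫ y, ∫ ξ, Complex.exp (↑(-2 * Real.pi * inner ℝ ξ (x - y)) * Complex.I) *
          schwartzInv φ ξ ∂volume ∂(G t : Measure (Space n)) := by simp only [h1]
    _ = ∫ ξ, ∫ y, Complex.exp (↑(-2 * Real.pi * inner ℝ ξ (x - y)) * Complex.I) *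
          schwartzInv φ ξ ∂(G t : Measure (Space n)) :=
        integral_integral_swap (f := fun y ξ =>
          Complex.exp (↑(-2 * Real.pi * inner ℝ ξ (x - y)) * Complex.I) * schwartzInv φ ξ) hint
    _ = _ := by
        congr 1; ext ξ
        rw [← hG.exponent_neg, ← hG.integral_exp ht, ← integral_mul_const]
        congr 1; ext y
        rw [← mul_assoc, ← Complex.exp_add]
        congr 2
        rw [inner_sub_right, inner_smul_right, inner_neg_right, real_inner_comm y ξ]
        push_cast; ring

/-- On Schwartz functions the generator is the Fourier multiplier `-m`. -/
theorem IsGenerator.eq_fourier (hA : IsGenerator G A) (hG : IsDiffusionKernel J₀ G)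
    (hJ : Continuous J₀) (φ : SchwartzMap (Space n) ℝ) (x : Space n) :
    ((A φ x : ℝ) : ℂ) = 𝓕 (fun ξ => -((exponent J₀ ξ : ℝ) : ℂ) * schwartzInv φ ξ) x := by
  have hone : ∀ ξ, ‖Complex.exp (↑(-2 * Real.pi * inner ℝ ξ x) * Complex.I)‖ ≤ 1 := fun ξ => by
    rw [Complex.norm_exp_ofReal_mul_I]
  have hcont : Continuous fun ξ : Space n =>
    Complex.exp (↑(-2 * Real.pi * inner ℝ ξ x) * Complex.I) := by fun_prop
  have hq : Integrable fun ξ => Complex.exp (↑(-2 * Real.pi * inner ℝ ξ x) * Complex.I) *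
      schwartzInv φ ξ :=
    (schwartzInv φ).integrable.bdd_mul (c := 1) hcont.aestronglyMeasurable (ae_of_all _ hone)
  have hmq : Integrable fun ξ => ((exponent J₀ ξ : ℝ) : ℂ) *
      (Complex.exp (↑(-2 * Real.pi * inner ℝ ξ x) * Complex.I) * schwartzInv φ ξ) := by
    refine ((hG.integrable_exponent_mul hJ φ).bdd_mul (c := 1) hcont.aestronglyMeasurable
      (ae_of_all _ hone)).congr (ae_of_all _ fun ξ => ?_)
    simp only; ring
  have h1 := tendsto_integral_exp_multiplier (continuous_exponent hJ) hG.exponent_nonneg hq hmq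
  have h2 := (Complex.continuous_ofReal.tendsto _).comp (hA φ x)
  refine (tendsto_nhds_unique (h2.congr' ?_) h1).trans ?_
  · filter_upwards [self_mem_nhdsWithin] with h hh
    have e1 : ((φ x : ℝ) : ℂ) = ∫ ξ, Complex.exp (↑(-2 * Real.pi * inner ℝ ξ x) * Complex.I) *
        schwartzInv φ ξ := by rw [← fourier_schwartzInv, Real.fourier_eq']; rfl
    rw [Function.comp_apply, Complex.ofReal_mul, Complex.ofReal_sub, hG.convMeasure_schwartz hh, e1]
  · rw [Real.fourier_eq']
    congr 1; ext ξ
    rw [smul_eq_mul]; ring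

/-- The generator is continuous from the Schwartz space to the bounded continuous functions. -/
theorem IsGenerator.exists_clm (hA : IsGenerator G A) (hG : IsDiffusionKernel J₀ G)
    (hJ : Continuous J₀) :
    ∃ B : SchwartzMap (Space n) ℝ →L[ℝ] BoundedContinuousFunction (Space n) ℝ,
      ∀ φ x, B φ x = A φ x := by
  have hint : ∀ φ : SchwartzMap (Space n) ℝ,
      Integrable fun ξ => -((exponent J₀ ξ : ℝ) : ℂ) * schwartzInv φ ξ := fun φ => by
    simpa using (hG.integrable_exponent_mul hJ φ).neg
  obtain ⟨C, hC, hle⟩ := hG.exists_exponent_le hJ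
  have hbound : ∀ φ x, ‖A φ x‖ ≤ C * ‖weightedInv φ‖ := by
    intro φ x
    have h1 : ‖A φ x‖ = ‖((A φ x : ℝ) : ℂ)‖ := (Complex.norm_real _).symm
    rw [h1, hA.eq_fourier hG hJ, norm_weightedInv, ← integral_const_mul, Real.fourier_eq']
    refine norm_integral_le_of_norm_le ((integrable_weight_schwartzInv φ).const_mul C)
      (ae_of_all _ fun ξ => ?_)
    rw [norm_smul, Complex.norm_exp_ofReal_mul_I, one_mul, norm_mul, norm_neg, Complex.norm_real,
      Real.norm_of_nonneg (hG.exponent_nonneg ξ), ← mul_assoc]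
    gcongr
    exact hle ξ
  have hcont : ∀ φ, Continuous (A φ) := by
    intro φ
    have h1 : Continuous fun x => ((A φ x : ℝ) : ℂ) := by
      simp only [hA.eq_fourier hG hJ]
      exact VectorFourier.fourierIntegral_continuous Real.continuous_fourierChar
        (innerSL ℝ).continuous₂ (hint φ)
    exact Complex.continuous_re.comp h1
  have hadd : ∀ φ ψ x, A (φ + ψ) x = A φ x + A ψ x := by
    intro φ ψ x
    apply Complex.ofReal_injective
    rw [Complex.ofReal_add, hA.eq_fourier hG hJ, hA.eq_fourier hG hJ, hA.eq_fourier hG hJ,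
      Real.fourier_eq, Real.fourier_eq, Real.fourier_eq, ← integral_add
      ((Real.fourierIntegral_convergent_iff x).2 (hint φ))
      ((Real.fourierIntegral_convergent_iff x).2 (hint ψ))]
    congr 1; ext ξ
    simp [mul_add, Circle.smul_def]
  have hsmul : ∀ (c : ℝ) φ x, A (c • φ) x = c * A φ x := by
    intro c φ x
    apply Complex.ofReal_injective
    rw [Complex.ofReal_mul, hA.eq_fourier hG hJ, hA.eq_fourier hG hJ, Real.fourier_eq',
      Real.fourier_eq', ← integral_const_mul]
    congr 1; ext ξ
    simp; ring
  let T : SchwartzMap (Space n) ℝ →ₗ[ℝ] BoundedContinuousFunction (Space n) ℝ :=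
    { toFun := fun φ => BoundedContinuousFunction.ofNormedAddCommGroup (A φ) (hcont φ) _ (hbound φ)
      map_add' := fun φ ψ => by ext x; exact hadd φ ψ x
      map_smul' := fun c φ => by ext x; exact hsmul c φ x }
  have hT : ∀ φ, ‖T φ‖ ≤ C * ‖weightedInv φ‖ := fun φ =>
    (BoundedContinuousFunction.norm_le (by positivity)).2 (hbound φ)
  refine ⟨⟨T, ?_⟩, fun φ x => rfl⟩
  apply continuous_of_continuousAt_zero T.toAddMonoidHom
  have h0 : Tendsto (fun φ : SchwartzMap (Space n) ℝ => C * ‖weightedInv φ‖) (𝓝 0) (𝓝 0) := by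
    have : Continuous fun φ : SchwartzMap (Space n) ℝ => C * ‖weightedInv φ‖ :=
      weightedInv.continuous.norm.const_mul C
    simpa using this.tendsto 0
  rw [ContinuousAt, map_zero, tendsto_zero_iff_norm_tendsto_zero]
  exact squeeze_zero (fun _ => norm_nonneg _) hT h0

variable {B : SchwartzMap (Space n) ℝ →L[ℝ] BoundedContinuousFunction (Space n) ℝ}

/-- The adjoint of the generator on `L¹`, on the Fourier side. -/
theorem IsGenerator.pairing_eq (hA : IsGenerator G A) (hG : IsDiffusionKernel J₀ G)
    (hJ : Continuous J₀) (hB : ∀ φ x, B φ x = A φ x) (f : L1 n) (φ : SchwartzMap (Space n) ℝ) :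
    ((pairing f (B φ) : ℝ) : ℂ) =
      ∫ ξ, -((exponent J₀ ξ : ℝ) : ℂ) * (hat f ξ * schwartzInv φ ξ) := by
  have hint : Integrable fun ξ => -((exponent J₀ ξ : ℝ) : ℂ) * schwartzInv φ ξ := by
    simpa using (hG.integrable_exponent_mul hJ φ).neg
  have h1 : ((pairing f (B φ) : ℝ) : ℂ) = ∫ x, ((f x : ℝ) : ℂ) *
      𝓕 (fun ξ => -((exponent J₀ ξ : ℝ) : ℂ) * schwartzInv φ ξ) x := by
    rw [pairing_apply]
    simp only [← hA.eq_fourier hG hJ, hB, ← Complex.ofReal_mul]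
    exact integral_ofReal.symm
  rw [h1, f.hat_pairing hint]
  congr 1; ext ξ; ring

/-- Weak differentiability at `h = 0⁺` of the semigroup. -/
theorem IsGenerator.tendsto_pairing (hA : IsGenerator G A) (hG : IsDiffusionKernel J₀ G)
    (hJ : Continuous J₀) (hB : ∀ φ x, B φ x = A φ x) (f : L1 n) (φ : SchwartzMap (Space n) ℝ) :
    Tendsto (fun h : ℝ => h⁻¹ * pairing (kernelOp G h f - f) (toBCF φ)) (𝓝[>] 0)
      (𝓝 (pairing f (B φ))) := by
  have hb : ∀ ξ, ‖hat f ξ‖ ≤ ‖hat f‖ := (hat f).norm_coe_le_norm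
  have hq : Integrable fun ξ => hat f ξ * schwartzInv φ ξ :=
    (schwartzInv φ).integrable.bdd_mul (c := ‖hat f‖) (hat f).continuous.aestronglyMeasurable
      (ae_of_all _ hb)
  have hmq : Integrable fun ξ => ((exponent J₀ ξ : ℝ) : ℂ) * (hat f ξ * schwartzInv φ ξ) := by
    refine ((hG.integrable_exponent_mul hJ φ).bdd_mul (c := ‖hat f‖)
      (hat f).continuous.aestronglyMeasurable (ae_of_all _ hb)).congr (ae_of_all _ fun ξ => ?_)
    simp only; ring
  have h1 := tendsto_integral_exp_multiplier (continuous_exponent hJ) hG.exponent_nonneg hq hmq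
  rw [← hA.pairing_eq hG hJ hB] at h1
  have h2 := (Complex.continuous_re.tendsto _).comp h1
  refine h2.congr' ?_
  filter_upwards [self_mem_nhdsWithin] with h hh
  have hh' : 0 < h := hh
  rw [Function.comp, ← pairing_toBCF]
  have h3 : (∫ ξ, ((Real.exp (-(h * exponent J₀ ξ)) : ℝ) : ℂ) * (hat f ξ * schwartzInv φ ξ)) =
      ((pairing (kernelOp G h f) (toBCF φ) : ℝ) : ℂ) := by
    rw [pairing_toBCF]
    congr 1; ext ξ
    rw [hG.hat_kernelOp hh'.le]; ring
  rw [h3, ← Complex.ofReal_sub, ← Complex.ofReal_mul, Complex.ofReal_re, map_sub,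
    sub_apply]

/-- If `Z = A Y` in the sense of distributions, then `Ẑ = -m Ŷ` everywhere. -/
theorem IsGenerator.hat_eq_of_pairing (hA : IsGenerator G A) (hG : IsDiffusionKernel J₀ G)
    (hJ : Continuous J₀) (hB : ∀ φ x, B φ x = A φ x) {Z Y : L1 n}
    (h : ∀ φ, pairing Z (toBCF φ) = pairing Y (B φ)) (ξ : Space n) :
    hat Z ξ = -((exponent J₀ ξ : ℝ) : ℂ) * hat Y ξ := by
  have hmc := continuous_exponent hJ
  have hcont : Continuous fun ξ => hat Z ξ - -((exponent J₀ ξ : ℝ) : ℂ) * hat Y ξ :=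
    (hat Z).continuous.sub ((Complex.continuous_ofReal.comp hmc).neg.mul (hat Y).continuous)
  have hreal : ∀ φ : SchwartzMap (Space n) ℝ,
      ∫ ξ, (hat Z ξ - -((exponent J₀ ξ : ℝ) : ℂ) * hat Y ξ) * schwartzInv φ ξ = 0 ∧
      Integrable fun ξ => (hat Z ξ - -((exponent J₀ ξ : ℝ) : ℂ) * hat Y ξ) * schwartzInv φ ξ := by
    intro φ
    have i1 : Integrable fun ξ => hat Z ξ * schwartzInv φ ξ :=
      (schwartzInv φ).integrable.bdd_mul (c := ‖hat Z‖) (hat Z).continuous.aestronglyMeasurable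
        (ae_of_all _ (hat Z).norm_coe_le_norm)
    have i2 : Integrable fun ξ => -((exponent J₀ ξ : ℝ) : ℂ) * (hat Y ξ * schwartzInv φ ξ) := by
      refine ((hG.integrable_exponent_mul hJ φ).neg.bdd_mul (c := ‖hat Y‖)
        (hat Y).continuous.aestronglyMeasurable
        (ae_of_all _ (hat Y).norm_coe_le_norm)).congr (ae_of_all _ fun ξ => ?_)
      simp only [Pi.neg_apply]; ring
    have e : ∀ ξ, (hat Z ξ - -((exponent J₀ ξ : ℝ) : ℂ) * hat Y ξ) * schwartzInv φ ξ =
        hat Z ξ * schwartzInv φ ξ - -((exponent J₀ ξ : ℝ) : ℂ) * (hat Y ξ * schwartzInv φ ξ) :=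
      fun ξ => by ring
    simp only [e]
    refine ⟨?_, i1.sub i2⟩
    rw [integral_sub i1 i2, ← pairing_toBCF, ← hA.pairing_eq hG hJ hB, h φ, sub_self]
  have hzero := ae_eq_zero_of_integral_contDiff_smul_eq_zero (hcont.locallyIntegrable (μ := volume)) ?_
  · have h1 : (fun ξ => hat Z ξ - -((exponent J₀ ξ : ℝ) : ℂ) * hat Y ξ) = fun _ => 0 :=
      (hcont.ae_eq_iff_eq volume continuous_const).1 hzero
    exact sub_eq_zero.1 (congrFun h1 ξ)
  intro g hg hgc
  have hgc' : HasCompactSupport fun x => ((g x : ℝ) : ℂ) :=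
    hgc.comp_left (g := fun r : ℝ => (r : ℂ)) (by simp)
  have hg' : ContDiff ℝ (⊤ : ℕ∞) fun x => ((g x : ℝ) : ℂ) := Complex.ofRealCLM.contDiff.comp hg
  let χ : SchwartzMap (Space n) ℂ := hgc'.toSchwartzMap hg'
  -- Split the complex Schwartz function `𝓕 χ` into its real and imaginary parts.
  let φ₁ : SchwartzMap (Space n) ℝ := SchwartzMap.postcompCLM Complex.reCLM (𝓕 χ)
  let φ₂ : SchwartzMap (Space n) ℝ := SchwartzMap.postcompCLM Complex.imCLM (𝓕 χ)
  have hχ : χ = schwartzInv φ₁ + Complex.I • schwartzInv φ₂ := by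
    have e1 : (𝓕 χ : SchwartzMap (Space n) ℂ) = SchwartzMap.postcompCLM Complex.ofRealCLM φ₁ +
        Complex.I • SchwartzMap.postcompCLM Complex.ofRealCLM φ₂ := by
      ext x
      change (𝓕 χ : SchwartzMap (Space n) ℂ) x =
        (((𝓕 χ : SchwartzMap (Space n) ℂ) x).re : ℂ) +
          Complex.I • (((𝓕 χ : SchwartzMap (Space n) ℂ) x).im : ℂ)
      rw [smul_eq_mul, mul_comm]
      exact (Complex.re_add_im _).symm
    calc χ = 𝓕⁻ (𝓕 χ : SchwartzMap (Space n) ℂ) := (FourierTransform.fourierInv_fourier_eq χ).symm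
      _ = _ := by
        rw [e1]
        change FourierTransform.fourierInvCLM ℂ (SchwartzMap (Space n) ℂ) _ = _
        rw [map_add, map_smul]
        rfl
  have e2 : ∀ x, g x • (hat Z x - -((exponent J₀ x : ℝ) : ℂ) * hat Y x) =
      (hat Z x - -((exponent J₀ x : ℝ) : ℂ) * hat Y x) * schwartzInv φ₁ x +
      Complex.I * ((hat Z x - -((exponent J₀ x : ℝ) : ℂ) * hat Y x) * schwartzInv φ₂ x) := by
    intro x
    have : ((g x : ℝ) : ℂ) = schwartzInv φ₁ x + Complex.I * schwartzInv φ₂ x := by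
      change χ x = _
      rw [hχ]; rfl
    rw [Complex.real_smul, this]; ring
  simp only [e2]
  rw [integral_add (hreal φ₁).2 ((hreal φ₂).2.const_mul _), integral_const_mul, (hreal φ₁).1,
    (hreal φ₂).1]
  simp

end Generator

/-! ### Mild and weak solutions of the linear problem -/

section WeakFormulation

theorem ContractionSemigroup.tendsto_inv_smul_duhamel {X : Type*} [NormedAddCommGroup X]
    [NormedSpace ℝ X] [CompleteSpace X] (S : ContractionSemigroup X) {k : ℝ → X} (hk : Continuous k) :
    Tendsto (fun h : ℝ => h⁻¹ • S.duhamel k h) (𝓝[>] 0) (𝓝 (k 0)) := by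
  rw [Metric.tendsto_nhds]
  intro ε hε
  have hc : Continuous fun p : ℝ × ℝ => S.op (p.1 - p.2) (k p.2) :=
    ContractionSemigroup.continuous_duhamel_integrand hk
  have h0 := hc.tendsto (0, 0)
  simp only [sub_zero, S.op_zero] at h0
  obtain ⟨δ, hδ, hball⟩ := Metric.tendsto_nhds_nhds.1 h0 (ε / 2) (by positivity)
  have hsmall : Set.Ioo (0 : ℝ) δ ∈ 𝓝[>] (0 : ℝ) := Ioo_mem_nhdsGT hδ
  filter_upwards [hsmall] with h hh
  have hh0 : 0 < h := hh.1
  have e : h⁻¹ • S.duhamel k h - k 0 = h⁻¹ • ∫ s in (0 : ℝ)..h, (S.op (h - s) (k s) - k 0) := by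
    rw [intervalIntegral.integral_sub
      ((ContractionSemigroup.continuous_duhamel_integrand_right hk h).intervalIntegrable _ _)
      (intervalIntegrable_const), intervalIntegral.integral_const, smul_sub, sub_zero, smul_smul,
      inv_mul_cancel₀ hh0.ne', one_smul]
    rfl
  rw [dist_eq_norm, e, norm_smul, norm_inv, Real.norm_of_nonneg hh0.le]
  have hb : ‖∫ s in (0 : ℝ)..h, (S.op (h - s) (k s) - k 0)‖ ≤ ε / 2 * |h - 0| := by
    apply intervalIntegral.norm_integral_le_of_norm_le_const
    intro s hs
    rw [Set.uIoc_of_le hh0.le] at hs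
    rw [← dist_eq_norm]
    refine (hball (x := (h, s)) ?_).le
    rw [Prod.dist_eq, Real.dist_0_eq_abs, Real.dist_0_eq_abs]
    refine max_lt ?_ ?_
    · rw [abs_of_pos hh0]; exact hh.2
    · rw [abs_of_pos hs.1]; exact hs.2.trans_lt hh.2
  rw [sub_zero, abs_of_pos hh0] at hb
  calc _ ≤ h⁻¹ * (ε / 2 * h) := by gcongr
    _ = ε / 2 := by field_simp
    _ < ε := by linarith

variable {n : ℕ} {J₀ : Space n → ℝ} {G : ℝ → ProbabilityMeasure (Space n)}
  {A : SchwartzMap (Space n) ℝ → Space n → ℝ}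
  {B : SchwartzMap (Space n) ℝ →L[ℝ] BoundedContinuousFunction (Space n) ℝ}

theorem continuousOn_pairing {s : Set ℝ} {V : ℝ → L1 n}
    {f : ℝ → BoundedContinuousFunction (Space n) ℝ} (hV : ContinuousOn V s)
    (hf : ContinuousOn f s) : ContinuousOn (fun t => pairing (V t) (f t)) s :=
  (pairing (n := n)).continuous₂.comp_continuousOn (hV.prodMk hf)

theorem tendsto_pairing_of_tendsto {ι : Type*} {l : Filter ι} {V : ι → L1 n} {V₀ : L1 n}
    {f : ι → BoundedContinuousFunction (Space n) ℝ} {f₀ : BoundedContinuousFunction (Space n) ℝ}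
    (hV : Tendsto V l (𝓝 V₀)) (hf : Tendsto f l (𝓝 f₀)) :
    Tendsto (fun i => pairing (V i) (f i)) l (𝓝 (pairing V₀ f₀)) :=
  ((pairing (n := n)).continuous₂.tendsto (V₀, f₀)).comp (hV.prodMk_nhds hf)

theorem IsC1TestFunction.hasDerivWithinAt {T : ℝ} {φ dφ : ℝ → SchwartzMap (Space n) ℝ}
    (h : IsC1TestFunction T φ dφ) {t : ℝ} (ht : t ∈ Set.Icc 0 T) :
    HasDerivWithinAt (fun t => toBCF (φ t)) (toBCF (dφ t)) (Set.Icc 0 T) t := by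
  rw [hasDerivWithinAt_iff_tendsto_slope]
  refine (((toBCF (n := n)).continuous.tendsto _).comp (h.2.2 t ht)).congr fun s => ?_
  simp only [Function.comp_apply, slope, vsub_eq_sub, map_smul, map_sub]

/-- A mild solution of the inhomogeneous linear problem is a weak solution. The function
`t ↦ ∫ V(t) φ(t)` is differentiable from the right, although `V` need not be differentiable. -/
theorem IsGenerator.weak_of_isMild (hA : IsGenerator G A) (hG : IsDiffusionKernel J₀ G)
    (hJ : Continuous J₀) (hB : ∀ φ x, B φ x = A φ x) {g V : ℝ → L1 n} {v₀ : L1 n}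
    (hg : Continuous g) (hV : hG.semigroup.IsMild (fun s _ => g s) v₀ V) {T : ℝ} (hT : 0 ≤ T)
    {φ dφ : ℝ → SchwartzMap (Space n) ℝ} (hφ : IsC1TestFunction T φ dφ) :
    ∫ t in (0 : ℝ)..T, (pairing (V t) (toBCF (dφ t) + B (φ t)) + pairing (g t) (toBCF (φ t))) =
      pairing (V T) (toBCF (φ T)) - pairing v₀ (toBCF (φ 0)) := by
  have hVc := hV.continuous
  have hφc : ContinuousOn (fun t => toBCF (φ t)) (Set.Icc 0 T) :=
    (toBCF (n := n)).continuous.comp_continuousOn hφ.1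
  have hdφc : ContinuousOn (fun t => toBCF (dφ t)) (Set.Icc 0 T) :=
    (toBCF (n := n)).continuous.comp_continuousOn hφ.2.1
  have hBc : ContinuousOn (fun t => B (φ t)) (Set.Icc 0 T) := B.continuous.comp_continuousOn hφ.1
  have hcont : ContinuousOn (fun t => pairing (V t) (toBCF (φ t))) (Set.Icc 0 T) :=
    continuousOn_pairing hVc.continuousOn hφc
  have hcont' : ContinuousOn (fun t => pairing (V t) (toBCF (dφ t) + B (φ t)) +
      pairing (g t) (toBCF (φ t))) (Set.Icc 0 T) :=
    (continuousOn_pairing hVc.continuousOn (hdφc.add hBc)).add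
      (continuousOn_pairing hg.continuousOn hφc)
  conv_rhs => rw [← hV.zero]
  refine intervalIntegral.integral_eq_sub_of_hasDeriv_right
    (f := fun t => pairing (V t) (toBCF (φ t))) (by rwa [Set.uIcc_of_le hT]) ?_
    (hcont'.intervalIntegrable_of_Icc hT)
  rw [min_eq_left hT, max_eq_right hT]
  intro t ht
  rw [hasDerivWithinAt_iff_tendsto_slope' (by simp)]
  have hIoi : 𝓝[>] t ≤ 𝓝[Set.Icc 0 T \ {t}] t := by
    rw [nhdsWithin_le_iff]
    filter_upwards [Ioo_mem_nhdsGT ht.2] with s hs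
    exact ⟨⟨(ht.1.trans hs.1).le, hs.2.le⟩, hs.1.ne'⟩
  have hslope : Tendsto (slope (fun t => toBCF (φ t)) t) (𝓝[>] t) (𝓝 (toBCF (dφ t))) :=
    (hasDerivWithinAt_iff_tendsto_slope.1 (hφ.hasDerivWithinAt ⟨ht.1.le, ht.2.le⟩)).mono_left hIoi
  have h1 : Tendsto (fun s => pairing (V s) (slope (fun t => toBCF (φ t)) t s)) (𝓝[>] t)
      (𝓝 (pairing (V t) (toBCF (dφ t)))) :=
    tendsto_pairing_of_tendsto ((hVc.tendsto t).mono_left nhdsWithin_le_nhds) hslope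
  have hshift : Tendsto (fun s : ℝ => s - t) (𝓝[>] t) (𝓝[>] 0) := by
    refine tendsto_nhdsWithin_iff.2 ⟨?_, ?_⟩
    · have : Tendsto (fun s : ℝ => s - t) (𝓝 t) (𝓝 0) :=
        (continuous_id.sub continuous_const).tendsto' _ _ (by simp)
      exact this.mono_left nhdsWithin_le_nhds
    · filter_upwards [self_mem_nhdsWithin] with s hs
      exact sub_pos.2 (Set.mem_Ioi.1 hs)
  have h2 : Tendsto (fun s => (s - t)⁻¹ * pairing (kernelOp G (s - t) (V t) - V t) (toBCF (φ t)))
      (𝓝[>] t) (𝓝 (pairing (V t) (B (φ t)))) :=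
    (hA.tendsto_pairing hG hJ hB (V t) (φ t)).comp hshift
  have hgt : Continuous fun r => g (t + r) := hg.comp (continuous_const.add continuous_id)
  have h3 : Tendsto (fun s => pairing ((s - t)⁻¹ • hG.semigroup.duhamel (fun r => g (t + r)) (s - t))
      (toBCF (φ t))) (𝓝[>] t) (𝓝 (pairing (g t) (toBCF (φ t)))) := by
    have h4 := (hG.semigroup.tendsto_inv_smul_duhamel hgt).comp hshift
    rw [add_zero] at h4
    exact tendsto_pairing_of_tendsto h4 tendsto_const_nhds
  have h5 := (h1.add h2).add h3
  rw [map_add]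
  refine h5.congr' ?_
  filter_upwards [self_mem_nhdsWithin] with s hs
  have hs' : t < s := hs
  have hr := hV.restart (F := fun s _ => g s) (hg.comp continuous_fst) ht.1.le (sub_nonneg.2 hs'.le)
  rw [add_sub_cancel, hG.semigroup_op] at hr
  have h6 : V s - V t = (kernelOp G (s - t) (V t) - V t) +
      hG.semigroup.duhamel (fun r => g (t + r)) (s - t) := by rw [hr]; abel
  have h7 := congrArg (fun v => pairing v (toBCF (φ t))) h6
  simp only [slope, vsub_eq_sub, map_smul, map_sub, smul_eq_mul, smul_apply]
  simp only [map_sub, map_add, sub_apply, add_apply] at h7 ⊢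
  linear_combination (-(s - t)⁻¹) * h7

variable {Z : ℝ → L1 n} {T : ℝ}

/-- A weak solution of the homogeneous linear problem with zero initial value, tested against a
Schwartz function: separated test functions `θ(t) φ(x)` give the time-integrated equation. -/
theorem pairing_eq_integral_of_weak (hZ : Continuous Z) (hT : 0 < T)
    (hweak : ∀ φ dφ : ℝ → SchwartzMap (Space n) ℝ, IsC1TestFunction T φ dφ →
      ∫ t in (0 : ℝ)..T, pairing (Z t) (toBCF (dφ t) + B (φ t)) = pairing (Z T) (toBCF (φ T)))
    (ρ : SchwartzMap (Space n) ℝ) {t : ℝ} (ht : t ∈ Set.Icc 0 T) :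
    pairing (Z t) (toBCF ρ) = ∫ s in (0 : ℝ)..t, pairing (Z s) (B ρ) := by
  set p : ℝ → ℝ := fun t => pairing (Z t) (toBCF ρ) with hp
  set q : ℝ → ℝ := fun t => pairing (Z t) (B ρ) with hq
  have hpc : Continuous p := (pairing (n := n)).continuous₂.comp (hZ.prodMk continuous_const)
  have hqc : Continuous q := (pairing (n := n)).continuous₂.comp (hZ.prodMk continuous_const)
  set D : ℝ → ℝ := fun t => p t - ∫ s in (0 : ℝ)..t, q s with hD
  have hMd : ∀ t, HasDerivAt (fun t => ∫ s in (0 : ℝ)..t, q s) (q t) t := fun t =>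
    intervalIntegral.integral_hasDerivAt_right (hqc.intervalIntegrable _ _)
      (hqc.stronglyMeasurableAtFilter _ _) hqc.continuousAt
  have hMc : Continuous fun t => ∫ s in (0 : ℝ)..t, q s :=
    continuous_iff_continuousAt.2 fun t => (hMd t).continuousAt
  have hDc : Continuous D := hpc.sub hMc
  -- Testing with `θ(t) = ∫_T^t D` yields `∫ D² = 0`.
  set θ : ℝ → ℝ := fun t => ∫ s in T..t, D s with hθ
  have hθd : ∀ t, HasDerivAt θ (D t) t := fun t =>
    intervalIntegral.integral_hasDerivAt_right (hDc.intervalIntegrable _ _)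
      (hDc.stronglyMeasurableAtFilter _ _) hDc.continuousAt
  have hθc : Continuous θ := continuous_iff_continuousAt.2 fun t => (hθd t).continuousAt
  have hθT : θ T = 0 := by simp [hθ]
  have hsm : ∀ {f : ℝ → ℝ}, Continuous f → Continuous fun t => f t • ρ := fun hf =>
    hf.smul continuous_const
  have h1 := hweak (fun t => θ t • ρ) (fun t => D t • ρ) ⟨(hsm hθc).continuousOn,
    (hsm hDc).continuousOn, fun t _ => by
      have hs := (hasDerivAt_iff_tendsto_slope.1 (hθd t)).mono_left
        (nhdsWithin_mono t (fun x (hx : x ∈ Set.Icc 0 T \ {t}) => (hx.2 : x ∈ ({t}ᶜ : Set ℝ))))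
      refine (hs.smul_const ρ).congr fun s => ?_
      simp only [slope, vsub_eq_sub, smul_eq_mul, ← sub_smul, smul_smul]⟩
  simp only [map_add, map_smul, hθT, zero_smul, map_zero, smul_eq_mul] at h1
  have h2 : ∫ t in (0 : ℝ)..T, (q t * θ t + (∫ s in (0 : ℝ)..t, q s) * D t) = 0 := by
    rw [intervalIntegral.integral_eq_sub_of_hasDerivAt
      (f := fun t => (∫ s in (0 : ℝ)..t, q s) * θ t)
      (fun t _ => (hMd t).mul (hθd t))
      (((hqc.mul hθc).add (hMc.mul hDc)).intervalIntegrable _ _)]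
    simp [hθT]
  have h3 : ∫ t in (0 : ℝ)..T, D t * D t = 0 := by
    have hi1 : IntervalIntegrable (fun t => D t * p t + θ t * q t) volume 0 T :=
      ((hDc.mul hpc).add (hθc.mul hqc)).intervalIntegrable _ _
    have hi2 : IntervalIntegrable (fun t => q t * θ t + (∫ s in (0 : ℝ)..t, q s) * D t) volume 0 T :=
      ((hqc.mul hθc).add (hMc.mul hDc)).intervalIntegrable _ _
    have h4 := intervalIntegral.integral_sub hi1 hi2
    rw [h1, h2, sub_zero] at h4
    rw [← h4]
    congr 1; ext t
    simp only [hD]; ring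
  have h5 : D t = 0 := by
    by_contra hne
    have := intervalIntegral.integral_pos hT (hDc.mul hDc).continuousOn
      (fun x _ => mul_self_nonneg _) ⟨t, ht, mul_self_pos.2 hne⟩
    simp only [Pi.mul_apply] at this
    linarith
  exact sub_eq_zero.1 h5

/-- Uniqueness of weak solutions of the linear problem. With `Y(t) = ∫_0^t Z`, the equation reads
`Ẑ = -m Ŷ` on the Fourier side, hence `Ŷ' = -m Ŷ` and `Ŷ(0) = 0` at every frequency. -/
theorem IsGenerator.eq_zero_of_weak (hA : IsGenerator G A) (hG : IsDiffusionKernel J₀ G)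
    (hJ : Continuous J₀) (hB : ∀ φ x, B φ x = A φ x) (hZ : Continuous Z) (hT : 0 < T)
    (hweak : ∀ φ dφ : ℝ → SchwartzMap (Space n) ℝ, IsC1TestFunction T φ dφ →
      ∫ t in (0 : ℝ)..T, pairing (Z t) (toBCF (dφ t) + B (φ t)) = pairing (Z T) (toBCF (φ T)))
    {t : ℝ} (ht : t ∈ Set.Icc 0 T) : Z t = 0 := by
  set Y : ℝ → L1 n := fun t => ∫ s in (0 : ℝ)..t, Z s with hY
  have hYd : ∀ t, HasDerivAt Y (Z t) t := fun t =>
    intervalIntegral.integral_hasDerivAt_right (hZ.intervalIntegrable _ _)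
      (hZ.stronglyMeasurableAtFilter _ _) hZ.continuousAt
  have hpair : ∀ t ∈ Set.Icc 0 T, ∀ ρ, pairing (Z t) (toBCF ρ) = pairing (Y t) (B ρ) := by
    intro t ht ρ
    rw [pairing_eq_integral_of_weak hZ hT hweak ρ ht]
    have := ContinuousLinearMap.intervalIntegral_comp_comm ((pairing (n := n)).flip (B ρ))
      (hZ.intervalIntegrable (μ := volume) 0 t)
    simpa using this
  have hhat : ∀ t ∈ Set.Icc 0 T, ∀ ξ, hat (Z t) ξ = -((exponent J₀ ξ : ℝ) : ℂ) * hat (Y t) ξ :=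
    fun t ht ξ => hA.hat_eq_of_pairing hG hJ hB (hpair t ht) ξ
  apply L1.hat_injective
  rw [map_zero]
  ext ξ
  let ev : L1 n →L[ℝ] ℂ := (BoundedContinuousFunction.evalCLM ℝ ξ).comp hat
  have hev : ∀ f, ev f = hat f ξ := fun f => rfl
  have hyd : ∀ t, HasDerivAt (fun t => hat (Y t) ξ) (hat (Z t) ξ) t := fun t =>
    ev.hasFDerivAt.comp_hasDerivAt t (hYd t)
  have hbound := norm_le_gronwallBound_of_norm_deriv_right_le (f := fun t => hat (Y t) ξ)
    (f' := fun t => hat (Z t) ξ) (δ := 0) (K := exponent J₀ ξ) (ε := 0) (a := 0) (b := T)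
    (fun t _ => (hyd t).continuousAt.continuousWithinAt)
    (fun t _ => (hyd t).hasDerivWithinAt) (by simp [hY])
    (fun t ht => by
      rw [hhat t ⟨ht.1, ht.2.le⟩, norm_mul, norm_neg, Complex.norm_real,
        Real.norm_of_nonneg (hG.exponent_nonneg ξ), add_zero]) t ht
  rw [gronwallBound_ε0_δ0] at hbound
  rw [hhat t ht, norm_le_zero_iff.1 hbound]
  simp

end WeakFormulation

/-! ### The truncated nonlinearity -/

section Nonlinearity

/-- The derivative `(α + 1) |r|^α` of `|r|^α r`, frozen for `|r| ≥ M`. -/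
noncomputable def truncDeriv (α M r : ℝ) : ℝ := (α + 1) * (min |r| M) ^ α

/-- A `C¹` function with bounded derivative that agrees with `|r|^α r` for `|r| ≤ M` and is affine
on either side of this interval. -/
noncomputable def truncPow (α M r : ℝ) : ℝ := ∫ s in (0 : ℝ)..r, truncDeriv α M s

variable {α M : ℝ}

theorem continuous_truncDeriv (hα : 0 < α) : Continuous (truncDeriv α M) := by
  unfold truncDeriv
  exact continuous_const.mul ((continuous_abs.min continuous_const).rpow_const fun _ => Or.inr hα.le)

theorem truncDeriv_nonneg (hα : 0 < α) (hM : 0 ≤ M) (r : ℝ) : 0 ≤ truncDeriv α M r := by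
  have : 0 ≤ min |r| M := le_min (abs_nonneg _) hM
  unfold truncDeriv; positivity

theorem truncDeriv_le (hα : 0 < α) (hM : 0 ≤ M) (r : ℝ) :
    truncDeriv α M r ≤ (α + 1) * M ^ α := by
  unfold truncDeriv
  have h0 : 0 ≤ min |r| M := le_min (abs_nonneg _) hM
  gcongr
  exact min_le_right _ _

theorem abs_truncDeriv_le (hα : 0 < α) (hM : 0 ≤ M) (r : ℝ) :
    |truncDeriv α M r| ≤ (α + 1) * M ^ α := by
  rw [abs_of_nonneg (truncDeriv_nonneg hα hM r)]; exact truncDeriv_le hα hM r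

theorem uniformContinuous_truncDeriv (hα : 0 < α) (hM : 0 ≤ M) :
    UniformContinuous (truncDeriv α M) := by
  let k : Set.Icc (0 : ℝ) M → ℝ := fun s => (α + 1) * (s : ℝ) ^ α
  have hk : UniformContinuous k := CompactSpace.uniformContinuous_of_continuous
    (continuous_const.mul (continuous_subtype_val.rpow_const fun _ => Or.inr hα.le))
  let c : ℝ → Set.Icc (0 : ℝ) M := fun r => ⟨min |r| M, le_min (abs_nonneg _) hM, min_le_right _ _⟩
  have hc : LipschitzWith 1 c := LipschitzWith.of_dist_le_mul fun x y => by
    rw [Subtype.dist_eq, Real.dist_eq, Real.dist_eq, NNReal.coe_one, one_mul]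
    calc |min |x| M - min |y| M| ≤ max |(|x| - |y|)| |M - M| := abs_min_sub_min_le_max _ _ _ _
      _ ≤ |x - y| := max_le (abs_abs_sub_abs_le _ _) (by simp)
  exact hk.comp hc.uniformContinuous

theorem hasDerivAt_truncPow (hα : 0 < α) (r : ℝ) :
    HasDerivAt (truncPow α M) (truncDeriv α M r) r :=
  have hc := continuous_truncDeriv (M := M) hα
  intervalIntegral.integral_hasDerivAt_right (hc.intervalIntegrable _ _)
    (hc.stronglyMeasurableAtFilter _ _) hc.continuousAt

@[simp] theorem truncPow_zero : truncPow α M 0 = 0 := by simp [truncPow]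

theorem truncPow_neg (r : ℝ) : truncPow α M (-r) = -truncPow α M r := by
  have h := intervalIntegral.integral_comp_neg (a := 0) (b := r) (truncDeriv α M)
  have he : ∀ s, truncDeriv α M (-s) = truncDeriv α M s := fun s => by simp [truncDeriv]
  simp only [he, neg_zero] at h
  rw [truncPow, truncPow, h, ← intervalIntegral.integral_symm]

theorem truncPow_nonneg (hα : 0 < α) (hM : 0 ≤ M) {r : ℝ} (hr : 0 ≤ r) : 0 ≤ truncPow α M r :=
  intervalIntegral.integral_nonneg hr fun s _ => truncDeriv_nonneg hα hM s

theorem truncPow_eq (hα : 0 < α) {r : ℝ} (hr : |r| ≤ M) : truncPow α M r = |r| ^ α * r := by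
  have key : ∀ r : ℝ, 0 ≤ r → r ≤ M → truncPow α M r = |r| ^ α * r := by
    intro r h0 h1
    have h2 : truncPow α M r = ∫ s in (0 : ℝ)..r, (α + 1) * s ^ α := by
      apply intervalIntegral.integral_congr
      intro s hs
      rw [Set.uIcc_of_le h0] at hs
      simp only [truncDeriv]
      rw [abs_of_nonneg hs.1, min_eq_left (hs.2.trans h1)]
    rw [h2, intervalIntegral.integral_const_mul, integral_rpow (Or.inl (by linarith)),
      Real.zero_rpow (by linarith), sub_zero, abs_of_nonneg h0, Real.rpow_add_one' h0 (by linarith)]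
    field_simp
  rcases le_total 0 r with h | h
  · exact key r h (by rwa [abs_of_nonneg h] at hr)
  · have := key (-r) (by linarith) (by rwa [abs_of_nonpos h] at hr)
    rw [truncPow_neg, abs_neg] at this
    linarith

theorem abs_truncPow_sub_le (hα : 0 < α) (hM : 0 ≤ M) (r s : ℝ) :
    |truncPow α M r - truncPow α M s| ≤ (α + 1) * M ^ α * |r - s| := by
  have := Convex.norm_image_sub_le_of_norm_hasDerivWithin_le (f := truncPow α M) (s := Set.univ)
    (fun x _ => (hasDerivAt_truncPow (M := M) hα x).hasDerivWithinAt)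
    (fun x _ => by rw [Real.norm_eq_abs]; exact abs_truncDeriv_le hα hM x)
    convex_univ (Set.mem_univ s) (Set.mem_univ r)
  simpa [Real.norm_eq_abs] using this

theorem lipschitzWith_truncPow (hα : 0 < α) (hM : 0 ≤ M) :
    LipschitzWith (Real.toNNReal ((α + 1) * M ^ α)) (truncPow α M) :=
  LipschitzWith.of_dist_le_mul fun r s => by
    rw [Real.coe_toNNReal _ (by positivity), Real.dist_eq, Real.dist_eq]
    exact abs_truncPow_sub_le hα hM r s

/-- Uniform first-order expansion of the truncated nonlinearity. -/
theorem exists_truncPow_expansion (hα : 0 < α) (hM : 0 ≤ M) {η : ℝ} (hη : 0 < η) :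
    ∃ δ > 0, ∀ a b : ℝ, |b - a| ≤ δ →
      |truncPow α M b - truncPow α M a - truncDeriv α M a * (b - a)| ≤ η * |b - a| := by
  obtain ⟨δ, hδ, h⟩ := Metric.uniformContinuous_iff.1 (uniformContinuous_truncDeriv hα hM) η hη
  refine ⟨δ / 2, by positivity, fun a b hab => ?_⟩
  have := Convex.norm_image_sub_le_of_norm_hasDerivWithin_le
    (f := fun x => truncPow α M x - truncDeriv α M a * x) (s := Set.uIcc a b) (C := η)
    (f' := fun x => truncDeriv α M x - truncDeriv α M a)
    (fun x _ => by
      have h1 := (hasDerivAt_truncPow (M := M) hα x).sub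
        ((hasDerivAt_id x).const_mul (truncDeriv α M a))
      simp only [mul_one] at h1
      exact h1.hasDerivWithinAt)
    (fun x hx => by
      have h2 : |x - a| ≤ |b - a| := Set.abs_sub_left_of_mem_uIcc hx
      exact (h (a := x) (b := a) (by rw [Real.dist_eq]; linarith)).le)
    (convex_uIcc a b) Set.left_mem_uIcc Set.right_mem_uIcc
  rw [Real.norm_eq_abs, Real.norm_eq_abs] at this
  convert this using 2
  ring

end Nonlinearity

/-! ### The superposition operator on `L¹` -/

section Superposition

variable {n : ℕ}

theorem L1.norm_eq (f : L1 n) : ‖f‖ = ∫ x, |f x| := L1.norm_eq_integral_norm f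

/-- Uniform integrability: an integrable weight is small on the set where a function of small
`L¹` norm exceeds a given level. -/
theorem L1.exists_integral_le (z : L1 n) {c η δ : ℝ} (hc : 0 ≤ c) (hη : 0 < η) (hδ : 0 < δ) :
    ∃ κ > 0, ∀ p : L1 n, ‖p‖ < κ →
      Integrable (fun x => |z x| * (if |p x| ≤ δ then η else c)) ∧
      ∫ x, |z x| * (if |p x| ≤ δ then η else c) ≤ η * ‖z‖ + η := by
  obtain ⟨κ, hκ, hsmall⟩ := exists_pos_setLIntegral_lt_of_measure_lt (μ := volume)
    (f := fun x => ENNReal.ofReal |z x|) (by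
      have := z.integrable_coe.abs.lintegral_lt_top
      exact this.ne) (ε := ENNReal.ofReal (η / (c + 1))) (by simp; positivity)
  have hmeas : ∀ p : L1 n, MeasurableSet {x | |p x| ≤ δ} := fun p =>
    measurableSet_le (Lp.stronglyMeasurable p).measurable.abs measurable_const
  obtain ⟨κ', hκ'0, hκ'⟩ : ∃ κ' : ℝ, 0 < κ' ∧ ENNReal.ofReal κ' ≤ κ := by
    rcases eq_or_ne κ ⊤ with rfl | hne
    · exact ⟨1, one_pos, le_top⟩
    · exact ⟨κ.toReal, ENNReal.toReal_pos hκ.ne' hne, by rw [ENNReal.ofReal_toReal hne]⟩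
  refine ⟨δ * κ', by positivity, fun p hp => ?_⟩
  set s : Set (Space n) := {x | |p x| ≤ δ}ᶜ with hs
  have hsm : MeasurableSet s := (hmeas p).compl
  have hμ : volume s < κ := by
    refine lt_of_lt_of_le ?_ hκ'
    have h1 := meas_ge_le_lintegral_div (μ := volume)
      (f := fun x => ENNReal.ofReal |p x|) p.integrable_coe.abs.aestronglyMeasurable.aemeasurable.ennreal_ofReal
      (ε := ENNReal.ofReal δ) (by simpa using hδ) (by simp)
    have h2 : volume s ≤ volume {x | ENNReal.ofReal δ ≤ ENNReal.ofReal |p x|} :=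
      measure_mono fun x hx => ENNReal.ofReal_le_ofReal (not_le.1 (show ¬ |p x| ≤ δ from hx)).le
    refine (h2.trans h1).trans_lt ?_
    rw [← ofReal_integral_eq_lintegral_ofReal p.integrable_coe.abs (ae_of_all _ fun x => abs_nonneg _),
      ← L1.norm_eq, ← ENNReal.ofReal_div_of_pos hδ]
    rw [ENNReal.ofReal_lt_ofReal_iff hκ'0, div_lt_iff₀ hδ]
    linarith
  have hsI : ∫ x in s, |z x| ≤ η / (c + 1) := by
    rw [integral_eq_lintegral_of_nonneg_ae (ae_of_all _ fun x => abs_nonneg _)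
      z.integrable_coe.abs.aestronglyMeasurable.restrict]
    exact ENNReal.toReal_le_of_le_ofReal (by positivity) (hsmall s hμ).le
  have hsplit : ∀ x, |z x| * (if |p x| ≤ δ then η else c) ≤ η * |z x| + c * s.indicator (fun x => |z x|) x := by
    intro x
    by_cases h : |p x| ≤ δ
    · have : x ∉ s := fun hx => hx h
      rw [if_pos h, Set.indicator_of_notMem this]; linarith
    · have : x ∈ s := h
      rw [if_neg h, Set.indicator_of_mem this]
      have := mul_nonneg hη.le (abs_nonneg (z x)); linarith
  have hR : Integrable fun x => η * |z x| + c * s.indicator (fun x => |z x|) x :=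
    (z.integrable_coe.abs.const_mul η).add ((z.integrable_coe.abs.indicator hsm).const_mul c)
  have hnn : ∀ x, 0 ≤ |z x| * (if |p x| ≤ δ then η else c) := fun x =>
    mul_nonneg (abs_nonneg _) (by split_ifs <;> linarith)
  refine ⟨hR.mono' ?_ (ae_of_all _ fun x => ?_), ?_⟩
  · exact z.integrable_coe.abs.aestronglyMeasurable.mul
      (Measurable.ite (hmeas p) measurable_const measurable_const).aestronglyMeasurable
  · rw [Real.norm_of_nonneg (hnn x)]; exact hsplit x
  · refine (integral_mono_of_nonneg (ae_of_all _ hnn) hR (ae_of_all _ hsplit)).trans ?_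
    rw [integral_add (z.integrable_coe.abs.const_mul η)
      ((z.integrable_coe.abs.indicator hsm).const_mul c), integral_const_mul, integral_const_mul,
      integral_indicator hsm, ← L1.norm_eq]
    have : c * ∫ x in s, |z x| ≤ c * (η / (c + 1)) := by gcongr
    have h3 : c * (η / (c + 1)) ≤ η := by
      rw [mul_div_assoc', div_le_iff₀ (by positivity)]; nlinarith
    linarith

/-- The product of an integrable function `z` with a bounded continuous function of `u`. -/
noncomputable def mulL1 (k : BoundedContinuousFunction ℝ ℝ) (u z : L1 n) : L1 n :=
  (z.integrable_coe.bdd_mul (c := ‖k‖) (f := fun x => k (u x))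
    (k.continuous.comp_aestronglyMeasurable (Lp.aestronglyMeasurable u))
    (ae_of_all _ fun _ => k.norm_coe_le_norm _)).toL1 _

theorem coeFn_mulL1 (k : BoundedContinuousFunction ℝ ℝ) (u z : L1 n) :
    mulL1 k u z =ᵐ[volume] fun x => k (u x) * z x := Integrable.coeFn_toL1 _

theorem norm_mulL1_sub_le (k : BoundedContinuousFunction ℝ ℝ) (u z w : L1 n) :
    ‖mulL1 k u z - mulL1 k u w‖ ≤ ‖k‖ * ‖z - w‖ := by
  apply Lp.norm_le_mul_norm_of_ae_le_mul
  filter_upwards [Lp.coeFn_sub (mulL1 k u z) (mulL1 k u w), Lp.coeFn_sub z w, coeFn_mulL1 k u z,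
    coeFn_mulL1 k u w] with x h1 h2 h3 h4
  rw [h1, h2, Pi.sub_apply, Pi.sub_apply, h3, h4, ← mul_sub, norm_mul]
  gcongr
  exact k.norm_coe_le_norm _

theorem mulL1_zero (k : BoundedContinuousFunction ℝ ℝ) (u : L1 n) : mulL1 k u 0 = 0 := by
  apply Lp.ext
  filter_upwards [coeFn_mulL1 k u 0, Lp.coeFn_zero ℝ 1 (volume : Measure (Space n))] with x h1 h2
  rw [h1, h2]; simp

/-- Joint continuity of `(u, z) ↦ k(u) z`. For fixed `z`, the set where `u` has moved by more than `δ`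
has small measure and carries little of `z`. -/
theorem continuous_mulL1 (k : BoundedContinuousFunction ℝ ℝ) (hk : UniformContinuous k) :
    Continuous fun p : L1 n × L1 n => mulL1 k p.1 p.2 := by
  rw [continuous_iff_continuousAt]
  rintro ⟨u₀, z₀⟩
  rw [ContinuousAt, Metric.tendsto_nhds]
  intro ε hε
  -- This makes `η ‖z₀‖ + η = ε / 4`.
  set η : ℝ := ε / (2 * (‖z₀‖ + 1) * 2) with hη
  have hη0 : 0 < η := by positivity
  obtain ⟨δ, hδ, hkδ⟩ := Metric.uniformContinuous_iff.1 hk η hη0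
  obtain ⟨κ, hκ, h⟩ := z₀.exists_integral_le (c := 2 * ‖k‖) (δ := δ / 2) (by positivity) hη0
    (by positivity)
  have h1 : ∀ᶠ p : L1 n × L1 n in 𝓝 (u₀, z₀), ‖p.1 - u₀‖ < κ := by
    have : Continuous fun p : L1 n × L1 n => ‖p.1 - u₀‖ := by fun_prop
    exact (this.tendsto' (u₀, z₀) 0 (by simp)).eventually_lt_const hκ
  have h2 : ∀ᶠ p : L1 n × L1 n in 𝓝 (u₀, z₀), ‖k‖ * ‖p.2 - z₀‖ < ε / 2 := by
    have : Continuous fun p : L1 n × L1 n => ‖k‖ * ‖p.2 - z₀‖ := by fun_prop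
    exact (this.tendsto' (u₀, z₀) 0 (by simp)).eventually_lt_const (by positivity)
  filter_upwards [h1, h2] with p hp1 hp2
  have h3 := h _ hp1
  have h4 : ‖mulL1 k p.1 z₀ - mulL1 k u₀ z₀‖ ≤ η * ‖z₀‖ + η := by
    rw [L1.norm_eq]
    refine le_trans (integral_mono_of_nonneg (ae_of_all _ fun _ => abs_nonneg _) h3.1 ?_) h3.2
    filter_upwards [Lp.coeFn_sub (mulL1 k p.1 z₀) (mulL1 k u₀ z₀), Lp.coeFn_sub p.1 u₀,
      coeFn_mulL1 k p.1 z₀, coeFn_mulL1 k u₀ z₀] with x e1 e2 e3 e4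
    rw [e1, e2, Pi.sub_apply, Pi.sub_apply, e3, e4, ← sub_mul, abs_mul, mul_comm]
    gcongr
    split_ifs with hle
    · exact (hkδ (by rw [Real.dist_eq]; linarith)).le
    · have a1 := k.norm_coe_le_norm (p.1 x)
      have a2 := k.norm_coe_le_norm (u₀ x)
      calc _ ≤ |k (p.1 x)| + |k (u₀ x)| := abs_sub _ _
        _ ≤ 2 * ‖k‖ := by rw [Real.norm_eq_abs] at a1 a2; linarith
  have h5 : η * ‖z₀‖ + η ≤ ε / 2 := by
    have : η * (‖z₀‖ + 1) = ε / 4 := by rw [hη]; field_simp; norm_num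
    linarith
  rw [dist_eq_norm]
  calc ‖mulL1 k p.1 p.2 - mulL1 k u₀ z₀‖
      ≤ ‖mulL1 k p.1 p.2 - mulL1 k p.1 z₀‖ + ‖mulL1 k p.1 z₀ - mulL1 k u₀ z₀‖ :=
        norm_sub_le_norm_sub_add_norm_sub _ _ _
    _ ≤ ‖k‖ * ‖p.2 - z₀‖ + (η * ‖z₀‖ + η) := add_le_add (norm_mulL1_sub_le _ _ _ _) h4
    _ < ε := by linarith

variable {α M : ℝ}

/-- The superposition operator of the truncated nonlinearity on `L¹`. -/
noncomputable def truncL1 (hα : 0 < α) (hM : 0 ≤ M) (u : L1 n) : L1 n :=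
  (lipschitzWith_truncPow hα hM).compLp truncPow_zero u

theorem coeFn_truncL1 (hα : 0 < α) (hM : 0 ≤ M) (u : L1 n) :
    truncL1 hα hM u =ᵐ[volume] fun x => truncPow α M (u x) :=
  LipschitzWith.coeFn_compLp _ _ u

theorem norm_truncL1_sub_le (hα : 0 < α) (hM : 0 ≤ M) (u v : L1 n) :
    ‖truncL1 hα hM u - truncL1 hα hM v‖ ≤ (α + 1) * M ^ α * ‖u - v‖ := by
  have := (lipschitzWith_truncPow hα hM).norm_compLp_sub_le truncPow_zero u v
  rwa [Real.coe_toNNReal _ (by positivity)] at this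

theorem continuous_truncL1 (hα : 0 < α) (hM : 0 ≤ M) :
    Continuous (truncL1 hα hM : L1 n → L1 n) :=
  (lipschitzWith_truncPow hα hM).continuous_compLp truncPow_zero

theorem truncL1_zero (hα : 0 < α) (hM : 0 ≤ M) : truncL1 hα hM (0 : L1 n) = 0 := by
  apply Lp.ext
  filter_upwards [coeFn_truncL1 hα hM (0 : L1 n),
    Lp.coeFn_zero ℝ 1 (volume : Measure (Space n))] with x h1 h2
  rw [h1, h2]; simp

/-- The derivative of the truncated nonlinearity as a bounded continuous function. -/
noncomputable def truncDerivBCF (hα : 0 < α) (hM : 0 ≤ M) : BoundedContinuousFunction ℝ ℝ :=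
  BoundedContinuousFunction.ofNormedAddCommGroup (truncDeriv α M) (continuous_truncDeriv hα) _
    (abs_truncDeriv_le hα hM)

theorem norm_truncDerivBCF_le (hα : 0 < α) (hM : 0 ≤ M) :
    ‖truncDerivBCF hα hM‖ ≤ (α + 1) * M ^ α :=
  BoundedContinuousFunction.norm_ofNormedAddCommGroup_le _ (by positivity) _

/-- First-order expansion of the superposition operator on `L¹` along differences `v - u` that are
close to `h z` for a fixed integrable function `z`. -/
theorem exists_truncL1_expansion (hα : 0 < α) (hM : 0 ≤ M) (z : L1 n) {η : ℝ} (hη : 0 < η) :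
    ∃ κ > 0, ∀ u v : L1 n, ‖v - u‖ < κ → ∀ h : ℝ,
      ‖truncL1 hα hM v - truncL1 hα hM u - h • mulL1 (truncDerivBCF hα hM) u z‖ ≤
        (3 * ((α + 1) * M ^ α) + 1) * ‖v - u - h • z‖ + η * |h| := by
  set L : ℝ := (α + 1) * M ^ α with hL
  have hL0 : 0 ≤ L := by positivity
  -- The first entry keeps the coefficient of `‖v - u - h z‖` below `3L + 1`, the second one makes
  -- the remainder at most `η |h|`.
  set η' : ℝ := min (2 * L + 1) (η / (‖z‖ + 1)) with hη'
  have hη'0 : 0 < η' := lt_min (by positivity) (by positivity)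
  obtain ⟨δ, hδ, hexp⟩ := exists_truncPow_expansion hα hM hη'0
  obtain ⟨κ, hκ, hsmall⟩ := z.exists_integral_le (c := 2 * L) (by positivity) hη'0 hδ
  refine ⟨κ, hκ, fun u v huv h => ?_⟩
  obtain ⟨hi, hle⟩ := hsmall _ huv
  have hD : Integrable fun x => |(v - u - h • z : L1 n) x| := (L1.integrable_coe _).abs
  have hη'' : η' * ‖z‖ + η' ≤ η := by
    have h1 : η' ≤ η / (‖z‖ + 1) := min_le_right _ _
    rw [le_div_iff₀ (by positivity)] at h1
    linarith
  have hmain : ‖truncL1 hα hM v - truncL1 hα hM u - h • mulL1 (truncDerivBCF hα hM) u z‖ ≤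
      ∫ x, ((3 * L + 1) * |(v - u - h • z : L1 n) x| +
        |h| * (|z x| * (if |(v - u : L1 n) x| ≤ δ then η' else 2 * L))) := by
    rw [L1.norm_eq]
    refine integral_mono_of_nonneg (ae_of_all _ fun _ => abs_nonneg _)
      ((hD.const_mul _).add (hi.const_mul _)) ?_
    filter_upwards [Lp.coeFn_sub (truncL1 hα hM v - truncL1 hα hM u)
      (h • mulL1 (truncDerivBCF hα hM) u z), Lp.coeFn_sub (truncL1 hα hM v) (truncL1 hα hM u),
      Lp.coeFn_smul h (mulL1 (truncDerivBCF hα hM) u z), coeFn_truncL1 hα hM v,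
      coeFn_truncL1 hα hM u, coeFn_mulL1 (truncDerivBCF hα hM) u z, Lp.coeFn_sub (v - u) (h • z),
      Lp.coeFn_sub v u, Lp.coeFn_smul h z] with x e1 e2 e3 e4 e5 e6 e7 e8 e9
    rw [e1, e7, Pi.sub_apply, Pi.sub_apply, e2, e3, e8, e9, Pi.sub_apply, Pi.sub_apply,
      Pi.smul_apply, Pi.smul_apply, e4, e5, e6, smul_eq_mul, smul_eq_mul]
    change |truncPow α M (v x) - truncPow α M (u x) - h * (truncDeriv α M (u x) * z x)| ≤ _
    set a := u x
    set b := v x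
    set ζ := z x
    set θ : ℝ := if |b - a| ≤ δ then η' else 2 * L with hθ
    have hdL := abs_truncDeriv_le hα hM a
    have hθ0 : 0 ≤ θ := by rw [hθ]; split_ifs <;> positivity
    have hθ1 : θ ≤ 2 * L + 1 := by
      rw [hθ]; split_ifs
      · exact min_le_left _ _
      · linarith
    have hrem : |truncPow α M b - truncPow α M a - truncDeriv α M a * (b - a)| ≤
        θ * |b - a| := by
      rw [hθ]; split_ifs with hle
      · exact hexp a b hle
      · have h1 := abs_truncPow_sub_le hα hM b a
        have h2 : |truncDeriv α M a * (b - a)| ≤ L * |b - a| := by rw [abs_mul]; gcongr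
        have h3 := abs_sub (truncPow α M b - truncPow α M a) (truncDeriv α M a * (b - a))
        linarith
    have hba : |b - a| ≤ |b - a - h * ζ| + |h| * |ζ| := by
      rw [← abs_mul]
      simpa using abs_add_le (b - a - h * ζ) (h * ζ)
    have h4 : |truncDeriv α M a * (b - a - h * ζ)| ≤ L * |b - a - h * ζ| := by
      rw [abs_mul]; gcongr
    have h5 : truncPow α M b - truncPow α M a - h * (truncDeriv α M a * ζ) =
        (truncPow α M b - truncPow α M a - truncDeriv α M a * (b - a)) +
        truncDeriv α M a * (b - a - h * ζ) := by ring
    have h6 : θ * |b - a| ≤ θ * (|b - a - h * ζ| + |h| * |ζ|) := by gcongr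
    have h7 : θ * |b - a - h * ζ| ≤ (2 * L + 1) * |b - a - h * ζ| := by gcongr
    rw [h5]
    refine (abs_add_le _ _).trans ?_
    linarith
  refine hmain.trans ?_
  rw [integral_add (hD.const_mul _) (hi.const_mul _), integral_const_mul, integral_const_mul,
    ← L1.norm_eq]
  have : |h| * ∫ x, |z x| * (if |(v - u : L1 n) x| ≤ δ then η' else 2 * L) ≤ |h| * η := by
    gcongr; linarith
  linarith

end Superposition

/-! ### Time regularity for the truncated problem -/

section Regularity

variable {n : ℕ} {α M : ℝ} {S : ContractionSemigroup (L1 n)}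

/-- Propagation of time differentiability for the truncated semilinear problem. -/
theorem ContractionSemigroup.IsMild.exists_continuous_hasDerivAt_trunc (hα : 0 < α) (hM : 0 ≤ M)
    {u₀ : L1 n} {U : ℝ → L1 n} (hU : S.IsMild (fun _ => truncL1 hα hM) u₀ U) {t₀ : ℝ}
    (ht₀ : 0 < t₀) {z₀ : L1 n} (hz₀ : HasDerivAt U z₀ t₀) :
    ∃ z : ℝ → L1 n, Continuous z ∧ ∀ t, t₀ ≤ t → HasDerivAt U (z t) t := by
  have hL0 : 0 ≤ (α + 1) * M ^ α := by positivity
  have huc : UniformContinuous (truncDerivBCF hα hM) := uniformContinuous_truncDeriv hα hM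
  refine hU.exists_continuous_hasDerivAt (L := (α + 1) * M ^ α)
    (C := 3 * ((α + 1) * M ^ α) + 1) hL0 (by linarith) (norm_truncL1_sub_le hα hM)
    (continuous_truncL1 hα hM) (V := fun s z => mulL1 (truncDerivBCF hα hM) (U s) z) ?_ ?_ ?_ ?_
    ht₀ hz₀
  · exact (continuous_mulL1 _ huc).comp
      ((hU.continuous.comp continuous_fst).prodMk continuous_snd)
  · intro s x y
    exact (norm_mulL1_sub_le _ _ _ _).trans
      (mul_le_mul_of_nonneg_right (norm_truncDerivBCF_le hα hM) (norm_nonneg _))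
  · exact fun s => mulL1_zero _ _
  · intro s z η hη
    obtain ⟨κ, hκ, hexp⟩ := exists_truncL1_expansion hα hM z hη
    have h1 : Tendsto (fun h => ‖U (s + h) - U s‖) (𝓝[≠] 0) (𝓝 0) := by
      have : Continuous fun h => ‖U (s + h) - U s‖ :=
        ((hU.continuous.comp (continuous_const.add continuous_id)).sub continuous_const).norm
      exact (this.tendsto' 0 0 (by simp)).mono_left nhdsWithin_le_nhds
    filter_upwards [h1.eventually_lt_const hκ] with h hh
    exact hexp _ _ hh h

end Regularity

/-! ### Odd extensions -/

section OddExtension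

variable {n : ℕ}

/-- The reflection `(x', x_N) ↦ (x', -x_N)` as a linear isometry. -/
noncomputable def reflectIso (n : ℕ) : Space n ≃ₗᵢ[ℝ] Space n :=
  LinearIsometryEquiv.piLpCongrRight 2 fun i : Fin (n + 1) =>
    if i = Fin.last n then LinearIsometryEquiv.neg ℝ else LinearIsometryEquiv.refl ℝ ℝ

theorem reflectIso_apply (x : Space n) : reflectIso n x = reflectNormal x := by
  ext i
  simp only [reflectIso, reflectNormal, LinearIsometryEquiv.piLpCongrRight_apply]
  split_ifs with h <;> simp

@[simp] theorem lastCoord_reflectNormal (x : Space n) :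
    lastCoord (reflectNormal x) = -lastCoord x := by
  simp [lastCoord, reflectNormal]

@[simp] theorem reflectNormal_reflectNormal (x : Space n) :
    reflectNormal (reflectNormal x) = x := by
  ext i
  simp only [reflectNormal]
  split_ifs <;> simp

theorem reflectNormal_sub (x y : Space n) :
    reflectNormal (x - y) = reflectNormal x - reflectNormal y := by
  simp only [← reflectIso_apply, map_sub]

theorem measurePreserving_reflectNormal :
    MeasurePreserving (reflectNormal : Space n → Space n) := by
  have := (reflectIso n).measurePreserving
  rwa [show (reflectIso n : Space n → Space n) = reflectNormal from funext reflectIso_apply] at this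

theorem continuous_reflectNormal : Continuous (reflectNormal : Space n → Space n) := by
  have := (reflectIso n).continuous
  rwa [show (reflectIso n : Space n → Space n) = reflectNormal from funext reflectIso_apply] at this

theorem continuous_lastCoord : Continuous (lastCoord : Space n → ℝ) := by
  unfold lastCoord; fun_prop

theorem measurableSet_halfSpace : MeasurableSet (halfSpace n) :=
  (isOpen_lt continuous_const continuous_lastCoord).measurableSet

theorem abs_lastCoord_le (x : Space n) : |lastCoord x| ≤ ‖x‖ := by
  have := PiLp.norm_apply_le x (Fin.last n)
  rwa [Real.norm_eq_abs] at this

/-- The boundary hyperplane is a null set. -/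
theorem ae_lastCoord_ne_zero : ∀ᵐ x : Space n, lastCoord x ≠ 0 := by
  let l : Space n →L[ℝ] ℝ := EuclideanSpace.proj (Fin.last n)
  have hl : ∀ x, l x = lastCoord x := fun x => rfl
  have h := Measure.addHaar_submodule (volume : Measure (Space n)) (LinearMap.ker l.toLinearMap) (by
    intro htop
    have h1 : (EuclideanSpace.single (Fin.last n) (1 : ℝ) : Space n) ∈
        LinearMap.ker l.toLinearMap := by
      rw [htop]; trivial
    have h2 : l (EuclideanSpace.single (Fin.last n) (1 : ℝ) : Space n) = 0 := h1
    simp [hl, lastCoord] at h2)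
  rw [ae_iff]
  have hset : {x : Space n | ¬ lastCoord x ≠ 0} = (LinearMap.ker l.toLinearMap : Set (Space n)) := by
    ext x
    simp [← hl]
  rw [hset, h]

/-- The odd extension as a difference of a function supported in the half-space and its
reflection. -/
theorem oddExt_eq (f : Space n → ℝ) (x : Space n) :
    oddExt f x = (halfSpace n).indicator f x - (halfSpace n).indicator f (reflectNormal x) := by
  rcases lt_trichotomy (lastCoord x) 0 with h | h | h
  · have h1 : x ∉ halfSpace n := not_lt.2 h.le
    have h2 : reflectNormal x ∈ halfSpace n := by simpa [halfSpace] using h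
    simp [oddExt, h, h.not_gt, h1, h2]
  · have h1 : x ∉ halfSpace n := not_lt.2 h.le
    have h2 : reflectNormal x ∉ halfSpace n := by simp [halfSpace, h]
    simp [oddExt, h, h1, h2]
  · have h1 : x ∈ halfSpace n := h
    have h2 : reflectNormal x ∉ halfSpace n := by simpa [halfSpace] using h.le
    simp [oddExt, h, h1, h2]

theorem oddExt_of_mem {f : Space n → ℝ} {x : Space n} (hx : x ∈ halfSpace n) :
    oddExt f x = f x := if_pos hx

theorem oddExt_reflectNormal (f : Space n → ℝ) (x : Space n) :
    oddExt f (reflectNormal x) = -oddExt f x := by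
  rw [oddExt_eq, oddExt_eq, reflectNormal_reflectNormal]; ring

theorem oddExt_congr_ae {f g : Space n → ℝ} (h : f =ᵐ[halfVolume n] g) :
    oddExt f =ᵐ[volume] oddExt g := by
  have h1 : (halfSpace n).indicator f =ᵐ[volume] (halfSpace n).indicator g :=
    by
      filter_upwards [(ae_restrict_iff' measurableSet_halfSpace).1 h] with x hx
      by_cases hm : x ∈ halfSpace n
      · simp [hm, hx hm]
      · simp [hm]
  have h2 := measurePreserving_reflectNormal.quasiMeasurePreserving.ae_eq_comp h1
  filter_upwards [h1, h2] with x e1 e2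
  simp only [Function.comp_apply] at e2
  rw [oddExt_eq, oddExt_eq, e1, e2]

theorem ae_half_of_ae {p : Space n → Prop} (h : ∀ᵐ x, p x) : ∀ᵐ x ∂(halfVolume n), p x :=
  ae_restrict_of_ae h

theorem memLp_oddExt {f : Space n → ℝ} {p : ENNReal} (hf : MemLp f p (halfVolume n)) :
    MemLp (oddExt f) p volume := by
  have h1 : MemLp ((halfSpace n).indicator f) p volume :=
    (memLp_indicator_iff_restrict measurableSet_halfSpace).2 hf
  have h2 := h1.comp_measurePreserving measurePreserving_reflectNormal
  have h3 := h1.sub h2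
  exact h3.ae_eq (ae_of_all _ fun x => (oddExt_eq f x).symm)

theorem eLpNorm_one_oddExt_le {f : Space n → ℝ} (hf : AEStronglyMeasurable f (halfVolume n)) :
    eLpNorm (oddExt f) 1 volume ≤ 2 * eLpNorm f 1 (halfVolume n) := by
  have hm : AEStronglyMeasurable ((halfSpace n).indicator f) volume :=
    (aestronglyMeasurable_indicator_iff measurableSet_halfSpace).2 hf
  have h1 : oddExt f = (halfSpace n).indicator f -
      (halfSpace n).indicator f ∘ reflectNormal := funext fun x => oddExt_eq f x
  rw [h1]
  refine (eLpNorm_sub_le hm (hm.comp_measurePreserving measurePreserving_reflectNormal)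
    le_rfl).trans ?_
  rw [eLpNorm_comp_measurePreserving hm measurePreserving_reflectNormal,
    eLpNorm_indicator_eq_eLpNorm_restrict measurableSet_halfSpace, two_mul]
  rfl

end OddExtension

/-! ### The cone of odd functions that are nonnegative in the half-space -/

section OddCone

variable {n : ℕ} {J₀ : Space n → ℝ} {G : ℝ → ProbabilityMeasure (Space n)}

/-- Reflection of integrable functions. -/
noncomputable def reflectL1 : L1 n →ₗᵢ[ℝ] L1 n :=
  Lp.compMeasurePreservingₗᵢ ℝ reflectNormal measurePreserving_reflectNormal

theorem coeFn_reflectL1 (f : L1 n) : reflectL1 f =ᵐ[volume] fun x => f (reflectNormal x) :=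
  Lp.coeFn_compMeasurePreserving _ _

/-- The closed convex cone of integrable functions that are odd with respect to `x_N` and
nonnegative in the half-space. -/
def oddCone (n : ℕ) : Set (L1 n) := {f | reflectL1 f = -f ∧ ∀ᵐ x ∂(halfVolume n), 0 ≤ f x}

theorem isClosed_oddCone : IsClosed (oddCone n) := by
  have h1 : IsClosed {f : L1 n | reflectL1 f = -f} :=
    isClosed_eq reflectL1.continuous continuous_neg
  have h2 : IsClosed {f : L1 n | ∀ᵐ x ∂(halfVolume n), 0 ≤ f x} := by
    let r := LpToLpRestrictCLM (Space n) ℝ ℝ volume 1 (halfSpace n)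
    have : {f : L1 n | ∀ᵐ x ∂(halfVolume n), 0 ≤ f x} = {f : L1 n | 0 ≤ r f} := by
      ext f
      rw [Set.mem_ofPred_eq, Set.mem_ofPred_eq, ← Lp.coeFn_nonneg]
      have h3 : r f =ᵐ[halfVolume n] f := LpToLpRestrictCLM_coeFn ℝ (halfSpace n) f
      constructor
      · intro h
        filter_upwards [h, h3] with x e1 e2
        rw [Pi.zero_apply, e2]; exact e1
      · intro h
        filter_upwards [h, h3] with x e1 e2
        rw [← e2]; exact e1
    rw [this]
    exact isClosed_le continuous_const r.continuous
  exact h1.inter h2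

theorem zero_mem_oddCone : (0 : L1 n) ∈ oddCone n := by
  refine ⟨by simp, ae_half_of_ae ?_⟩
  filter_upwards [Lp.coeFn_zero ℝ 1 (volume : Measure (Space n))] with x hx
  rw [hx]; simp

theorem add_mem_oddCone {f g : L1 n} (hf : f ∈ oddCone n) (hg : g ∈ oddCone n) :
    f + g ∈ oddCone n := by
  refine ⟨by rw [map_add, hf.1, hg.1, neg_add], ?_⟩
  filter_upwards [hf.2, hg.2, ae_half_of_ae (Lp.coeFn_add f g)] with x h1 h2 h3
  rw [h3]; exact add_nonneg h1 h2

theorem smul_mem_oddCone {c : ℝ} (hc : 0 ≤ c) {f : L1 n} (hf : f ∈ oddCone n) :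
    c • f ∈ oddCone n := by
  refine ⟨by rw [map_smul, hf.1, smul_neg], ?_⟩
  filter_upwards [hf.2, ae_half_of_ae (Lp.coeFn_smul c f)] with x h1 h2
  rw [h2]; exact mul_nonneg hc h1

theorem convex_oddCone : Convex ℝ (oddCone n) := fun _ hf _ hg _ _ ha hb _ =>
  add_mem_oddCone (smul_mem_oddCone ha hf) (smul_mem_oddCone hb hg)

theorem integral_mem_oddCone {p : ℝ → L1 n} (hp : Continuous p) {t : ℝ} (ht : 0 ≤ t)
    (h : ∀ s ∈ Set.Icc 0 t, p s ∈ oddCone n) : ∫ s in (0 : ℝ)..t, p s ∈ oddCone n := by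
  rcases ht.eq_or_lt with rfl | ht'
  · simpa using zero_mem_oddCone
  have hav := convex_oddCone.set_average_mem (μ := volume) (t := Set.Ioc 0 t) (f := p)
    isClosed_oddCone (by simpa using ht') (by simp)
    ((ae_restrict_iff' measurableSet_Ioc).2 (ae_of_all _ fun s hs => h s ⟨hs.1.le, hs.2⟩))
    (hp.intervalIntegrable 0 t).1
  have h2 := smul_mem_oddCone ht'.le hav
  rw [setAverage_eq, smul_smul, Real.volume_real_Ioc_of_le ht'.le, sub_zero,
    mul_inv_cancel₀ ht'.ne', one_smul] at h2
  rwa [intervalIntegral.integral_of_le ht'.le]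

/-- An odd function is determined by its values in the half-space. -/
theorem ae_eq_oddExt_of_odd {f : Space n → ℝ}
    (hf : ∀ᵐ x, f (reflectNormal x) = -f x) : f =ᵐ[volume] oddExt f := by
  filter_upwards [hf, ae_lastCoord_ne_zero] with x h1 h2
  rcases lt_or_gt_of_ne h2 with h | h
  · rw [oddExt, if_neg h.not_gt, if_pos h, h1, neg_neg]
  · rw [oddExt, if_pos h]

theorem ae_reflect_of_mem_oddCone {f : L1 n} (hf : f ∈ oddCone n) :
    ∀ᵐ x, f (reflectNormal x) = -f x := by
  have h := coeFn_reflectL1 f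
  rw [hf.1] at h
  filter_upwards [h, Lp.coeFn_neg f] with x h1 h2
  rw [← h1, h2, Pi.neg_apply]

theorem ae_eq_oddExt {f : L1 n} (hf : f ∈ oddCone n) : f =ᵐ[volume] oddExt f :=
  ae_eq_oddExt_of_odd (ae_reflect_of_mem_oddCone hf)

theorem mem_oddCone_of_ae {f : L1 n} {u : Space n → ℝ} (hfu : f =ᵐ[volume] oddExt u)
    (hu : ∀ᵐ x ∂(halfVolume n), 0 ≤ u x) : f ∈ oddCone n := by
  constructor
  · apply Lp.ext
    have h1 := measurePreserving_reflectNormal.quasiMeasurePreserving.ae_eq_comp hfu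
    filter_upwards [coeFn_reflectL1 f, Lp.coeFn_neg f, hfu, h1] with x e1 e2 e3 e4
    simp only [Function.comp_apply] at e4
    rw [e1, e4, e2, Pi.neg_apply, e3, oddExt_reflectNormal]
  · filter_upwards [hu, ae_half_of_ae hfu, ae_restrict_mem measurableSet_halfSpace] with x e1 e2 e3
    rw [e2, oddExt_of_mem e3]; exact e1

/-- The kernels are invariant under the reflection. -/
theorem IsDiffusionKernel.map_reflectNormal (hG : IsDiffusionKernel J₀ G) {t : ℝ} (ht : 0 < t) :
    (G t : Measure (Space n)).map reflectNormal = G t := by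
  have hmeas := (continuous_reflectNormal (n := n)).measurable
  have : IsProbabilityMeasure ((G t : Measure (Space n)).map reflectNormal) :=
    Measure.isProbabilityMeasure_map hmeas.aemeasurable
  apply ext_of_forall_integral_eq_of_IsFiniteMeasure
  intro f
  rw [integral_map hmeas.aemeasurable f.continuous.aestronglyMeasurable]
  let f' : BoundedContinuousFunction (Space n) ℝ :=
    f.compContinuous ⟨reflectNormal, continuous_reflectNormal⟩
  have hf' : ∀ x, f' x = f (reflectNormal x) := fun x => rfl
  have h := hG.even_normal t ht (f - f') (fun x => by
    simp only [BoundedContinuousFunction.coe_sub, Pi.sub_apply, hf', reflectNormal_reflectNormal]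
    ring)
  have h2 : ∫ x, (f x - f' x) ∂(G t : Measure (Space n)) = 0 := h
  rw [integral_sub (f.integrable _) (f'.integrable _)] at h2
  simp only [hf'] at h2
  linarith

theorem IsDiffusionKernel.convMeasure_reflect (hG : IsDiffusionKernel J₀ G) {t : ℝ} (ht : 0 < t)
    (f : Space n → ℝ) (x : Space n) :
    convMeasure (G t) f (reflectNormal x) = convMeasure (G t) (fun y => f (reflectNormal y)) x := by
  have hmp : MeasurePreserving (reflectIso n).toHomeomorph.toMeasurableEquiv
      (G t : Measure (Space n)) (G t : Measure (Space n)) := by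
    refine ⟨MeasurableEquiv.measurable _, ?_⟩
    conv_rhs => rw [← hG.map_reflectNormal ht]
    congr 1
    exact funext reflectIso_apply
  rw [convMeasure, convMeasure, ← hmp.integral_comp']
  congr 1; ext y
  rw [show (reflectIso n).toHomeomorph.toMeasurableEquiv y = reflectNormal y from
    reflectIso_apply y, reflectNormal_sub]

/-- The comparison principle extends from admissible data to all nonnegative measurable integrable
functions, by truncation. -/
theorem LinearComparison.convMeasure_oddExt_nonneg (hcomp : LinearComparison G) {t : ℝ}
    (ht : 0 < t) {g : Space n → ℝ} (hg : Measurable g) (hg0 : ∀ x, 0 ≤ g x)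
    (hgi : Integrable g) : ∀ᵐ x ∂(halfVolume n), 0 ≤ convMeasure (G t) (oddExt g) x := by
  -- Truncating both the size and the support makes `g` bounded with a finite first moment.
  let gk : ℕ → Space n → ℝ := fun k x => if ‖x‖ ≤ k then min (g x) k else 0
  have hgk_nn : ∀ k x, 0 ≤ gk k x := fun k x => by
    simp only [gk]; split_ifs
    · exact le_min (hg0 x) (Nat.cast_nonneg k)
    · exact le_rfl
  have hgk_le : ∀ k x, gk k x ≤ g x := fun k x => by
    simp only [gk]; split_ifs
    · exact min_le_left _ _
    · exact hg0 x
  have hgk_lek : ∀ k x, gk k x ≤ k := fun k x => by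
    simp only [gk]; split_ifs
    · exact min_le_right _ _
    · exact Nat.cast_nonneg k
  have hgk_m : ∀ k, Measurable (gk k) := fun k =>
    Measurable.ite (measurableSet_le measurable_norm measurable_const)
      (hg.min measurable_const) measurable_const
  have hgk_i : ∀ k, Integrable (gk k) := fun k =>
    hgi.mono' (hgk_m k).aestronglyMeasurable
      (ae_of_all _ fun x => by rw [Real.norm_of_nonneg (hgk_nn k x)]; exact hgk_le k x)
  have hk : ∀ k, ∀ᵐ x ∂(halfVolume n), 0 ≤ convMeasure (G t) (oddExt (gk k)) x := by
    intro k
    -- An admissible datum is not identically zero, so vanishing truncations are treated apart.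
    by_cases h0 : gk k =ᵐ[halfVolume n] 0
    · have hi : Integrable (oddExt (gk k)) :=
        memLp_one_iff_integrable.1 (memLp_oddExt ((memLp_one_iff_integrable.2 (hgk_i k)).restrict _))
      have h1 := convMeasure_congr_ae (G t) hi (oddExt_congr_ae h0)
      filter_upwards [ae_half_of_ae h1] with x hx
      rw [hx]
      simp [convMeasure, oddExt]
    · refine hcomp (gk k) ⟨(memLp_one_iff_integrable.2 (hgk_i k)).restrict _, ?_, h0,
        ae_of_all _ (hgk_nn k), ?_⟩ t ht
      · exact memLp_top_of_bound (hgk_m k).aestronglyMeasurable k (ae_of_all _ fun x => by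
          rw [Real.norm_of_nonneg (hgk_nn k x)]; exact hgk_lek k x)
      · rw [firstMoment]
        have hle : ∀ x, ENNReal.ofReal (lastCoord x * gk k x) ≤ ENNReal.ofReal (k * g x) := by
          intro x
          apply ENNReal.ofReal_le_ofReal
          by_cases hx : ‖x‖ ≤ k
          · exact mul_le_mul (((le_abs_self _).trans (abs_lastCoord_le x)).trans hx) (hgk_le k x)
              (hgk_nn k x) (Nat.cast_nonneg k)
          · simp only [gk, if_neg hx, mul_zero]
            exact mul_nonneg (Nat.cast_nonneg k) (hg0 x)
        refine lt_of_le_of_lt (lintegral_mono hle) ?_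
        exact ((hgi.const_mul (k : ℝ)).restrict (s := halfSpace n)).lintegral_lt_top
  have hi : Integrable (oddExt g) :=
    memLp_one_iff_integrable.1 (memLp_oddExt ((memLp_one_iff_integrable.2 hgi).restrict _))
  have hodd_m : ∀ k, Measurable (oddExt (gk k)) := fun k => by
    have h1 : Measurable ((halfSpace n).indicator (gk k)) := (hgk_m k).indicator measurableSet_halfSpace
    have : oddExt (gk k) = fun x => (halfSpace n).indicator (gk k) x -
      (halfSpace n).indicator (gk k) (reflectNormal x) := funext fun x => oddExt_eq _ x
    rw [this]
    exact h1.sub (h1.comp continuous_reflectNormal.measurable)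
  have hdom : ∀ k x, |oddExt (gk k) x| ≤ |oddExt g x| := by
    have h1 : ∀ k x, |gk k x| ≤ |g x| := fun k x => by
      rw [abs_of_nonneg (hgk_nn k x), abs_of_nonneg (hg0 x)]; exact hgk_le k x
    intro k x
    simp only [oddExt]
    split_ifs
    · exact h1 k x
    · rw [abs_neg, abs_neg]; exact h1 k _
    · exact le_rfl
  have hgk_lim : ∀ x, Tendsto (fun k => gk k x) atTop (𝓝 (g x)) := fun x => by
    refine tendsto_const_nhds.congr' ?_
    obtain ⟨k₀, hk₀⟩ := exists_nat_ge (max ‖x‖ (g x))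
    filter_upwards [eventually_ge_atTop k₀] with k hk
    have h1 : max ‖x‖ (g x) ≤ k := hk₀.trans (by exact_mod_cast hk)
    simp only [gk]
    rw [if_pos ((le_max_left _ _).trans h1), min_eq_left ((le_max_right _ _).trans h1)]
  have hlim : ∀ x, Tendsto (fun k => oddExt (gk k) x) atTop (𝓝 (oddExt g x)) := fun x => by
    simp only [oddExt]
    split_ifs
    · exact hgk_lim x
    · exact (hgk_lim _).neg
    · exact tendsto_const_nhds
  filter_upwards [ae_all_iff.2 hk, ae_half_of_ae (ae_integrable_sub (G t) hi)] with x h1 h2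
  refine ge_of_tendsto' (f := fun k => convMeasure (G t) (oddExt (gk k)) x) (x := atTop) ?_ h1
  refine tendsto_integral_of_dominated_convergence (fun y => |oddExt g (x - y)|) (fun k => ?_)
    h2.abs (fun k => ae_of_all _ fun y => hdom k _) (ae_of_all _ fun y => hlim _)
  exact ((hodd_m k).comp (measurable_const.sub measurable_id)).aestronglyMeasurable

/-- The semigroup preserves the cone of odd functions that are nonnegative in the half-space. -/
theorem LinearComparison.kernelOp_mem_oddCone (hcomp : LinearComparison G)
    (hG : IsDiffusionKernel J₀ G) (t : ℝ) {f : L1 n} (hf : f ∈ oddCone n) :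
    kernelOp G t f ∈ oddCone n := by
  rcases le_or_gt t 0 with h | ht
  · rwa [kernelOp_of_nonpos h]
  rw [kernelOp_of_pos ht]
  have hmeas : Measurable f := (Lp.stronglyMeasurable f).measurable
  have hae : f =ᵐ[volume] oddExt (fun x => max (f x) 0) := by
    refine (ae_eq_oddExt hf).trans (oddExt_congr_ae ?_)
    filter_upwards [hf.2] with x hx
    rw [max_eq_left hx]
  have hpos := hcomp.convMeasure_oddExt_nonneg ht (hmeas.max measurable_const)
    (fun x => le_max_right _ _) f.integrable_coe.pos_part
  have hconv : convL1 (G t) f =ᵐ[volume] convMeasure (G t) (oddExt fun x => max (f x) 0) :=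
    (coeFn_convL1 _ _).trans (convMeasure_congr_ae _ f.integrable_coe hae)
  constructor
  · apply Lp.ext
    have h1 := measurePreserving_reflectNormal.quasiMeasurePreserving.ae_eq_comp hconv
    filter_upwards [coeFn_reflectL1 (convL1 (G t) f), Lp.coeFn_neg (convL1 (G t) f), hconv, h1]
      with x e1 e2 e3 e4
    simp only [Function.comp_apply] at e4
    rw [e1, e4, e2, Pi.neg_apply, e3, hG.convMeasure_reflect ht]
    simp only [oddExt_reflectNormal, convMeasure, integral_neg]
  · filter_upwards [hpos, ae_half_of_ae hconv] with x e1 e2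
    rw [e2]; exact e1

end OddCone

/-! ### Decay of the linear evolution of odd data -/

section LinearDecay

variable {n : ℕ} {a β : ℝ} {J₀ : Space n → ℝ} {G : ℝ → ProbabilityMeasure (Space n)}

/-- The exponent is bounded below by `c ‖ξ‖^β` near the origin and by `c` away from it. -/
theorem IsSymbol.exists_exponent_ge (hJ : IsSymbol a β J₀) :
    ∃ c : ℝ, 0 < c ∧ ∀ ξ : Space n,
      c * ‖ξ‖ ^ β ≤ exponent J₀ ξ ∨ c ≤ exponent J₀ ξ := by
  have h1 := hJ.expansion.def (half_pos hJ.a_pos)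
  obtain ⟨δ, hδ, hball⟩ := Metric.eventually_nhds_iff.1 h1
  obtain ⟨c', hc', haway⟩ := hJ.away δ hδ
  refine ⟨min (a / 2) (1 - c'), lt_min (half_pos hJ.a_pos) (by linarith), fun ξ => ?_⟩
  have hπ : 1 ≤ 2 * Real.pi := by linarith [Real.pi_gt_three]
  have hnorm : ‖(2 * Real.pi) • ξ‖ = 2 * Real.pi * ‖ξ‖ := by
    rw [norm_smul, Real.norm_of_nonneg (by positivity)]
  rcases lt_or_ge ‖(2 * Real.pi) • ξ‖ δ with h | h
  · left
    have h2 := hball (y := (2 * Real.pi) • ξ) (by rwa [dist_zero_right])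
    rw [Real.norm_eq_abs, Real.norm_of_nonneg (Real.rpow_nonneg (norm_nonneg _) _)] at h2
    have h3 := (abs_le.1 h2).2
    have h4 : ‖ξ‖ ^ β ≤ ‖(2 * Real.pi) • ξ‖ ^ β := by
      refine Real.rpow_le_rpow (norm_nonneg _) ?_ hJ.beta_pos.le
      rw [hnorm]
      exact le_mul_of_one_le_left (norm_nonneg _) hπ
    calc min (a / 2) (1 - c') * ‖ξ‖ ^ β ≤ a / 2 * ‖(2 * Real.pi) • ξ‖ ^ β :=
          mul_le_mul (min_le_left _ _) h4 (by positivity) (half_pos hJ.a_pos).le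
      _ ≤ exponent J₀ ξ := by rw [exponent]; linarith
  · right
    have := haway _ h
    exact (min_le_right _ _).trans (by rw [exponent]; linarith)

theorem exp_neg_mul_le_rpow {c p t : ℝ} (hc : 0 < c) (hp : 0 < p) (ht : 0 < t) :
    Real.exp (-(c * t)) ≤ (p / c) ^ p * t ^ (-p) := by
  have h1 : c * t / p ≤ Real.exp (c * t / p) := by linarith [Real.add_one_le_exp (c * t / p)]
  have h2 : (c * t / p) ^ p ≤ Real.exp (c * t) := by
    refine (Real.rpow_le_rpow (by positivity) h1 hp.le).trans (le_of_eq ?_)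
    rw [← Real.exp_mul]; congr 1; field_simp
  have h3 : (p / c) ^ p * t ^ (-p) = ((c * t / p) ^ p)⁻¹ := by
    rw [Real.rpow_neg ht.le, ← Real.inv_rpow ht.le, ← Real.mul_rpow (by positivity) (by positivity),
      ← Real.inv_rpow (by positivity)]
    congr 1; field_simp
  rw [h3, Real.exp_neg]
  exact inv_anti₀ (by positivity) h2

/-- The order of decay of solutions of the linear problem with odd data. -/
noncomputable def decayRate (n : ℕ) (β : ℝ) : ℝ := (((n + 1 : ℕ) : ℝ) + 1) / β

theorem integrable_norm_mul_exp (hβ : 0 < β) {b : ℝ} (hb : 0 < b) :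
    Integrable (fun ξ : Space n => ‖ξ‖ * Real.exp (-b * ‖ξ‖ ^ β)) := by
  have := integrable_fun_norm_addHaar (volume : Measure (Space n))
    (f := fun y => y * Real.exp (-b * y ^ β))
  rw [this]
  have h2 := integrableOn_rpow_mul_exp_neg_mul_rpow (s := (n : ℝ) + 1) (p := β) (b := b)
    (by have : (0 : ℝ) ≤ n := Nat.cast_nonneg n
        linarith) hβ hb
  refine h2.congr_fun (fun y hy => ?_) measurableSet_Ioi
  have hy0 : (0 : ℝ) < y := hy
  simp only [finrank_euclideanSpace, Fintype.card_fin, Nat.add_sub_cancel, smul_eq_mul]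
  rw [Real.rpow_add_one hy0.ne', Real.rpow_natCast]; ring

/-- Polar coordinates turn the integral into a Gamma integral. -/
theorem exists_integral_norm_mul_exp (n : ℕ) (hβ : 0 < β) :
    ∃ C : ℝ, 0 ≤ C ∧ ∀ b : ℝ, 0 < b →
      ∫ ξ : Space n, ‖ξ‖ * Real.exp (-b * ‖ξ‖ ^ β) = C * b ^ (-decayRate n β) := by
  have hg : 0 < ((n : ℝ) + 1 + 1) / β := by positivity
  refine ⟨(n + 1) * ((volume : Measure (Space n)).real (Metric.ball 0 1) * ((1 / β) *
    Real.Gamma (((n : ℝ) + 1 + 1) / β))), by have := Real.Gamma_pos_of_pos hg; positivity,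
    fun b hb => ?_⟩
  rw [integral_fun_norm_addHaar (volume : Measure (Space n))
    (fun y => y * Real.exp (-b * y ^ β))]
  have h1 : ∫ y in Set.Ioi (0 : ℝ), y ^ (Module.finrank ℝ (Space n) - 1) •
      (y * Real.exp (-b * y ^ β)) =
      ∫ y in Set.Ioi (0 : ℝ), y ^ ((n : ℝ) + 1) * Real.exp (-b * y ^ β) := by
    refine setIntegral_congr_fun measurableSet_Ioi fun y hy => ?_
    have hy0 : (0 : ℝ) < y := hy
    simp only [finrank_euclideanSpace, Fintype.card_fin, Nat.add_sub_cancel, smul_eq_mul]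
    rw [Real.rpow_add_one hy0.ne', Real.rpow_natCast]; ring
  rw [h1, integral_rpow_mul_exp_neg_mul_rpow hβ (by
    have : (0 : ℝ) ≤ n := Nat.cast_nonneg n
    linarith) hb]
  simp only [finrank_euclideanSpace, Fintype.card_fin, smul_eq_mul, nsmul_eq_mul, decayRate]
  push_cast
  rw [neg_div]
  ring

/-- Decay of `∫ e^{-t m} ‖hat f‖` for functions whose Fourier transform vanishes to first order at
the origin. -/
theorem IsSymbol.exists_integral_exp_mul_hat_le (hJ : IsSymbol a β J₀)
    (hG : IsDiffusionKernel J₀ G) :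
    ∃ K : ℝ, 0 < K ∧ ∀ (f : L1 n) (B : ℝ), 0 ≤ B → (∀ ξ, ‖hat f ξ‖ ≤ B * ‖ξ‖) →
      Integrable (hat f) → ∀ t : ℝ, 0 ≤ t →
      Integrable (hat (kernelOp G t f)) ∧
      ∫ ξ, ‖hat (kernelOp G t f) ξ‖ ≤ K * (B + ∫ ξ, ‖hat f ξ‖) * (1 + t) ^ (-decayRate n β) := by
  obtain ⟨c, hc, hexp⟩ := hJ.exists_exponent_ge
  obtain ⟨C, hC0, hC⟩ := exists_integral_norm_mul_exp n hJ.beta_pos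
  set p := decayRate n β with hp_def
  have hp : 0 < p := by have := hJ.beta_pos; rw [hp_def, decayRate]; positivity
  let K₁ := C * c ^ (-p) + (p / c) ^ p + 1
  have hK₁ : 1 ≤ K₁ := by
    have : 0 ≤ C * c ^ (-p) + (p / c) ^ p := by positivity
    simp only [K₁]; linarith
  refine ⟨2 ^ p * K₁, by positivity, fun f B hB hfB hfi t ht => ?_⟩
  have hnorm : ∀ ξ, ‖hat (kernelOp G t f) ξ‖ = Real.exp (-(t * exponent J₀ ξ)) * ‖hat f ξ‖ :=
    fun ξ => by
      rw [hG.hat_kernelOp ht, norm_mul, Complex.norm_real, Real.norm_of_nonneg (Real.exp_pos _).le]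
  have hle : ∀ ξ, ‖hat (kernelOp G t f) ξ‖ ≤ ‖hat f ξ‖ := fun ξ => by
    rw [hnorm]
    refine mul_le_of_le_one_left (norm_nonneg _) (Real.exp_le_one_iff.2 ?_)
    exact neg_nonpos.2 (mul_nonneg ht (hG.exponent_nonneg ξ))
  have hint : Integrable (hat (kernelOp G t f)) :=
    hfi.mono (hat _).continuous.aestronglyMeasurable (ae_of_all _ hle)
  refine ⟨hint, ?_⟩
  set D := ∫ ξ, ‖hat f ξ‖ with hD
  have hD0 : 0 ≤ D := integral_nonneg fun _ => norm_nonneg _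
  rcases le_or_gt t 1 with h1 | h1
  · have e1 : ∫ ξ, ‖hat (kernelOp G t f) ξ‖ ≤ D :=
      integral_mono hint.norm hfi.norm hle
    have e2 : 1 ≤ 2 ^ p * (1 + t) ^ (-p) := by
      rw [Real.rpow_neg (by linarith), ← div_eq_mul_inv, one_le_div (by positivity)]
      exact Real.rpow_le_rpow (by linarith) (by linarith) hp.le
    calc _ ≤ D := e1
      _ ≤ B + D := by linarith
      _ ≤ K₁ * (B + D) := le_mul_of_one_le_left (by linarith) hK₁
      _ ≤ (2 ^ p * (1 + t) ^ (-p)) * (K₁ * (B + D)) := le_mul_of_one_le_left (by positivity) e2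
      _ = _ := by ring
  · have ht0 : 0 < t := by linarith
    have e1 : ∀ ξ, ‖hat (kernelOp G t f) ξ‖ ≤
        B * (‖ξ‖ * Real.exp (-(t * c) * ‖ξ‖ ^ β)) + Real.exp (-(c * t)) * ‖hat f ξ‖ := by
      intro ξ
      rw [hnorm]
      rcases hexp ξ with h | h
      · have h2 : Real.exp (-(t * exponent J₀ ξ)) ≤ Real.exp (-(t * c) * ‖ξ‖ ^ β) := by
          apply Real.exp_le_exp.2
          nlinarith [mul_le_mul_of_nonneg_left h ht]
        have h3 : Real.exp (-(t * exponent J₀ ξ)) * ‖hat f ξ‖ ≤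
            Real.exp (-(t * c) * ‖ξ‖ ^ β) * (B * ‖ξ‖) :=
          mul_le_mul h2 (hfB ξ) (norm_nonneg _) (Real.exp_pos _).le
        have h4 : 0 ≤ Real.exp (-(c * t)) * ‖hat f ξ‖ := by positivity
        linarith
      · have h2 : Real.exp (-(t * exponent J₀ ξ)) ≤ Real.exp (-(c * t)) := by
          apply Real.exp_le_exp.2
          nlinarith [mul_le_mul_of_nonneg_left h ht]
        have h3 := mul_le_mul_of_nonneg_right h2 (norm_nonneg (hat f ξ))
        have h4 : 0 ≤ B * (‖ξ‖ * Real.exp (-(t * c) * ‖ξ‖ ^ β)) := by positivity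
        linarith
    have i1 := (integrable_norm_mul_exp (n := n) hJ.beta_pos (mul_pos ht0 hc)).const_mul B
    have i2 := hfi.norm.const_mul (Real.exp (-(c * t)))
    have e2 : ∫ ξ, ‖hat (kernelOp G t f) ξ‖ ≤
        B * (C * (t * c) ^ (-p)) + Real.exp (-(c * t)) * D := by
      refine (integral_mono hint.norm (i1.add i2) e1).trans (le_of_eq ?_)
      rw [integral_add' i1 i2, integral_const_mul, integral_const_mul, hC _ (mul_pos ht0 hc)]
    have e3 : t ^ (-p) ≤ 2 ^ p * (1 + t) ^ (-p) := by
      have : ((1 + t) / 2) ^ (-p) = 2 ^ p * (1 + t) ^ (-p) := by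
        rw [Real.div_rpow (by linarith) (by norm_num), Real.rpow_neg (by norm_num : (0:ℝ) ≤ 2),
          div_inv_eq_mul, mul_comm]
      rw [← this]
      exact Real.rpow_le_rpow_of_nonpos (by linarith) (by linarith) (by linarith)
    have e4 := exp_neg_mul_le_rpow hc hp ht0
    have htp : 0 < t ^ (-p) := by positivity
    have hC1 : 0 ≤ C * c ^ (-p) := by positivity
    have hC2 : 0 ≤ (p / c) ^ p := by positivity
    calc _ ≤ B * (C * (t * c) ^ (-p)) + Real.exp (-(c * t)) * D := e2
      _ ≤ B * (C * (t * c) ^ (-p)) + ((p / c) ^ p * t ^ (-p)) * D := by gcongr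
      _ = (B * (C * c ^ (-p)) + D * (p / c) ^ p) * t ^ (-p) := by
          rw [Real.mul_rpow ht0.le hc.le]; ring
      _ ≤ (B * K₁ + D * K₁) * t ^ (-p) := by
          refine mul_le_mul_of_nonneg_right (add_le_add ?_ ?_) htp.le
          · exact mul_le_mul_of_nonneg_left (by simp only [K₁]; linarith) hB
          · exact mul_le_mul_of_nonneg_left (by simp only [K₁]; linarith) hD0
      _ ≤ (B * K₁ + D * K₁) * (2 ^ p * (1 + t) ^ (-p)) := by
          refine mul_le_mul_of_nonneg_left e3 (by positivity)
      _ = _ := by ring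

theorem norm_exp_sub_exp_le (r s : ℝ) :
    ‖Complex.exp ((r : ℂ) * Complex.I) - Complex.exp ((s : ℂ) * Complex.I)‖ ≤ |r - s| := by
  have h : Complex.exp ((r : ℂ) * Complex.I) - Complex.exp ((s : ℂ) * Complex.I) =
      Complex.exp ((s : ℂ) * Complex.I) * (Complex.exp (Complex.I * ((r - s : ℝ) : ℂ)) - 1) := by
    rw [mul_sub, ← Complex.exp_add, mul_one]
    congr 2; push_cast; ring
  rw [h, norm_mul, Complex.norm_exp_ofReal_mul_I, one_mul]
  exact Real.norm_exp_I_mul_ofReal_sub_one_le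

theorem norm_sub_reflectNormal (x : Space n) : ‖x - reflectNormal x‖ = 2 * |lastCoord x| := by
  have : x - reflectNormal x = EuclideanSpace.single (Fin.last n) (2 * lastCoord x) := by
    ext i
    simp only [reflectNormal, lastCoord, PiLp.sub_apply, PiLp.single_apply]
    split_ifs with h
    · subst h; ring
    · ring
  rw [this, PiLp.norm_single, Real.norm_eq_abs, abs_mul, abs_two]

/-- The Fourier transform of a function that is odd with respect to `x_N` vanishes to first order
at the origin, with a constant given by the first moment. -/
theorem norm_hat_le_of_odd {f : L1 n} (hodd : ∀ᵐ x, f (reflectNormal x) = -f x)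
    (hmom : Integrable fun x => |lastCoord x| * f x) (ξ : Space n) :
    ‖hat f ξ‖ ≤ 2 * Real.pi * (∫ x, |(|lastCoord x| * f x)|) * ‖ξ‖ := by
  let e : Space n → ℂ := fun x => Complex.exp (((-2 * Real.pi * inner ℝ x ξ : ℝ) : ℂ) * Complex.I)
  have he : Continuous e := by fun_prop
  have hn : ∀ x, ‖e x‖ ≤ 1 := fun x => (Complex.norm_exp_ofReal_mul_I _).le
  have h1 : hat f ξ = ∫ x, e x * ((f x : ℝ) : ℂ) := by
    rw [hat_apply, Real.fourier_eq']; rfl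
  have h2 : hat f ξ = -∫ x, e (reflectNormal x) * ((f x : ℝ) : ℂ) := by
    have hmp : MeasurePreserving (reflectIso n).toHomeomorph.toMeasurableEquiv
        (volume : Measure (Space n)) volume := (reflectIso n).measurePreserving
    rw [h1, ← hmp.integral_comp', ← integral_neg]
    apply integral_congr_ae
    filter_upwards [hodd] with x hx
    rw [show (reflectIso n).toHomeomorph.toMeasurableEquiv x = reflectNormal x from
      reflectIso_apply x, hx]
    push_cast; ring
  have i1 : Integrable fun x => e x * ((f x : ℝ) : ℂ) :=
    f.integrable_ofReal.bdd_mul he.aestronglyMeasurable (ae_of_all _ hn)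
  have i2 : Integrable fun x => e (reflectNormal x) * ((f x : ℝ) : ℂ) :=
    f.integrable_ofReal.bdd_mul (he.comp continuous_reflectNormal).aestronglyMeasurable
      (ae_of_all _ fun x => hn _)
  have h3 : 2 * hat f ξ = ∫ x, (e x - e (reflectNormal x)) * ((f x : ℝ) : ℂ) := by
    rw [two_mul]
    nth_rw 1 [h1]
    rw [h2, ← sub_eq_add_neg, ← integral_sub i1 i2]
    congr 1; ext x; ring
  have h4 : ∀ x, ‖(e x - e (reflectNormal x)) * ((f x : ℝ) : ℂ)‖ ≤
      4 * Real.pi * ‖ξ‖ * |(|lastCoord x| * f x)| := by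
    intro x
    rw [norm_mul, Complex.norm_real, abs_mul, abs_abs, Real.norm_eq_abs]
    have h5 : ‖e x - e (reflectNormal x)‖ ≤ 4 * Real.pi * ‖ξ‖ * |lastCoord x| := by
      refine (norm_exp_sub_exp_le _ _).trans ?_
      rw [← mul_sub, ← inner_sub_left, abs_mul, show |-2 * Real.pi| = 2 * Real.pi by
        rw [neg_mul, abs_neg, abs_of_pos Real.two_pi_pos]]
      have h6 := abs_real_inner_le_norm (x - reflectNormal x) ξ
      rw [norm_sub_reflectNormal] at h6
      calc _ ≤ 2 * Real.pi * (2 * |lastCoord x| * ‖ξ‖) :=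
            mul_le_mul_of_nonneg_left h6 Real.two_pi_pos.le
        _ = _ := by ring
    calc _ ≤ 4 * Real.pi * ‖ξ‖ * |lastCoord x| * |f x| :=
          mul_le_mul_of_nonneg_right h5 (abs_nonneg _)
      _ = _ := by ring
  have h7 : ‖2 * hat f ξ‖ ≤ 4 * Real.pi * ‖ξ‖ * ∫ x, |(|lastCoord x| * f x)| := by
    rw [h3, ← integral_const_mul]
    refine (norm_integral_le_integral_norm _).trans ?_
    exact integral_mono_of_nonneg (ae_of_all _ fun _ => norm_nonneg _) (hmom.abs.const_mul _)
      (ae_of_all _ h4)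
  rw [norm_mul, Complex.norm_ofNat] at h7
  linarith

end LinearDecay

/-! ### Admissible data -/

section Datum

variable {n : ℕ} {a β : ℝ} {J₀ : Space n → ℝ} {G : ℝ → ProbabilityMeasure (Space n)}
  {u₀ : Space n → ℝ}

theorem IsInitialDatum.integrable_oddExt (h : IsInitialDatum u₀) : Integrable (oddExt u₀) :=
  memLp_one_iff_integrable.1 (memLp_oddExt h.memL1)

/-- The odd extension of an admissible datum as an element of `L¹(ℝ^N)`. -/
noncomputable def IsInitialDatum.toL1 (h : IsInitialDatum u₀) : L1 n :=
  h.integrable_oddExt.toL1 _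

theorem IsInitialDatum.coeFn_toL1 (h : IsInitialDatum u₀) : h.toL1 =ᵐ[volume] oddExt u₀ :=
  h.integrable_oddExt.coeFn_toL1

theorem IsInitialDatum.toL1_mem_oddCone (h : IsInitialDatum u₀) : h.toL1 ∈ oddCone n :=
  mem_oddCone_of_ae h.coeFn_toL1 h.nonneg

theorem oddExt_abs_lastCoord_mul (f : Space n → ℝ) (x : Space n) :
    oddExt (fun y => |lastCoord y| * f y) x = |lastCoord x| * oddExt f x := by
  simp only [oddExt, lastCoord_reflectNormal, abs_neg]
  split_ifs <;> ring

/-- Each half-space contributes `firstMoment u₀` to the moment of the odd extension. -/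
theorem IsInitialDatum.eLpNorm_moment_le (h : IsInitialDatum u₀) :
    eLpNorm (fun x => |lastCoord x| * h.toL1 x) 1 volume ≤ 2 * firstMoment u₀ := by
  have h1 : (fun x => |lastCoord x| * h.toL1 x) =ᵐ[volume]
      oddExt (fun y => |lastCoord y| * u₀ y) := by
    filter_upwards [h.coeFn_toL1] with x hx
    rw [hx, oddExt_abs_lastCoord_mul]
  have hm : AEStronglyMeasurable (fun y => |lastCoord y| * u₀ y) (halfVolume n) :=
    continuous_lastCoord.abs.aestronglyMeasurable.mul h.memL1.1
  rw [eLpNorm_congr_ae h1]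
  refine (eLpNorm_one_oddExt_le hm).trans (mul_le_mul_right (le_of_eq ?_) _)
  rw [eLpNorm_one_eq_lintegral_enorm, firstMoment]
  apply lintegral_congr_ae
  filter_upwards [h.nonneg, ae_restrict_mem measurableSet_halfSpace] with x h2 h3
  have h4 : 0 < lastCoord x := h3
  rw [abs_of_pos h4, Real.enorm_of_nonneg (mul_nonneg h4.le h2)]

theorem hat_eq_fourierHat {f : L1 n} {g : Space n → ℝ} (hfg : f =ᵐ[volume] g) (ξ : Space n) :
    hat f ξ = fourierHat g ((2 * Real.pi) • ξ) := by
  rw [hat_apply, Real.fourier_eq', fourierHat]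
  apply integral_congr_ae
  filter_upwards [hfg] with x hx
  rw [hx, smul_eq_mul, inner_smul_right]
  congr 2; push_cast; ring

/-- Dilating the frequency by `2π ≥ 1` does not increase the `L¹` norm. -/
theorem eLpNorm_hat_le {f : L1 n} {g : Space n → ℝ} (hfg : f =ᵐ[volume] g) :
    eLpNorm (hat f) 1 volume ≤ eLpNorm (fourierHat g) 1 volume := by
  have hπ : 1 ≤ 2 * Real.pi := by linarith [Real.pi_gt_three]
  have hπ0 : 2 * Real.pi ≠ 0 := by positivity
  have h1 : (hat f : Space n → ℂ) = fourierHat g ∘ ((2 * Real.pi) • ·) :=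
    funext fun ξ => hat_eq_fourierHat hfg ξ
  have hemb : MeasurableEmbedding ((2 * Real.pi) • · : Space n → Space n) :=
    (Homeomorph.smulOfNeZero (2 * Real.pi) hπ0).measurableEmbedding
  rw [h1, ← hemb.eLpNorm_map_measure, Measure.map_addHaar_smul _ hπ0]
  refine eLpNorm_mono_measure _ (Measure.le_iff.2 fun s _ => ?_)
  rw [Measure.smul_apply, smul_eq_mul]
  refine mul_le_of_le_one_left bot_le ?_
  rw [← ENNReal.ofReal_one]
  refine ENNReal.ofReal_le_ofReal ?_
  rw [abs_of_nonneg (by positivity)]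
  exact inv_le_one_of_one_le₀ (one_le_pow₀ hπ)

/-- Decay of the solutions of the linear problem, uniformly in the datum. -/
theorem IsSymbol.exists_linear_decay (hJ : IsSymbol a β J₀) (hG : IsDiffusionKernel J₀ G) :
    ∃ K : ℝ, 0 < K ∧ ∀ (u₀ : Space n → ℝ) (h : IsInitialDatum u₀) (ε : ℝ),
      firstMoment u₀ + eLpNorm (fourierHat (oddExt u₀)) 1 volume < ENNReal.ofReal ε →
      ∀ t : ℝ, 0 ≤ t →
        ∀ᵐ x, |kernelOp G t h.toL1 x| ≤ K * ε * (1 + t) ^ (-decayRate n β) := by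
  obtain ⟨K, hK, hdecay⟩ := hJ.exists_integral_exp_mul_hat_le hG
  refine ⟨K * (4 * Real.pi), by positivity, fun u₀ h ε hε t ht => ?_⟩
  have hF := eLpNorm_hat_le h.coeFn_toL1
  have hFtop : eLpNorm (fourierHat (oddExt u₀)) 1 volume ≠ ⊤ :=
    ((le_add_left le_rfl).trans_lt (hε.trans ENNReal.ofReal_lt_top)).ne
  have hm := h.eLpNorm_moment_le
  have hmtop : firstMoment u₀ ≠ ⊤ := h.moment_lt_top.ne
  have hi : Integrable (hat h.toL1) := memLp_one_iff_integrable.1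
    ⟨(hat _).continuous.aestronglyMeasurable, hF.trans_lt hFtop.lt_top⟩
  have hmi : Integrable fun x => |lastCoord x| * h.toL1 x := memLp_one_iff_integrable.1
    ⟨continuous_lastCoord.abs.aestronglyMeasurable.mul (Lp.aestronglyMeasurable _),
      hm.trans_lt (ENNReal.mul_lt_top (by simp) hmtop.lt_top)⟩
  have hsum : (firstMoment u₀).toReal + (eLpNorm (fourierHat (oddExt u₀)) 1 volume).toReal ≤ ε := by
    rw [← ENNReal.toReal_add hmtop hFtop]
    exact ENNReal.toReal_le_of_le_ofReal (by
      by_contra hneg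
      rw [ENNReal.ofReal_of_nonpos (not_le.1 hneg).le] at hε
      exact not_lt_zero hε) hε.le
  have hD : ∫ ξ, ‖hat h.toL1 ξ‖ ≤ (eLpNorm (fourierHat (oddExt u₀)) 1 volume).toReal := by
    rw [integral_norm_eq_lintegral_enorm hi.1, ← eLpNorm_one_eq_lintegral_enorm]
    exact ENNReal.toReal_mono hFtop hF
  have hM : ∫ x, |(|lastCoord x| * h.toL1 x)| ≤ 2 * (firstMoment u₀).toReal := by
    have e : ∫ x, |(|lastCoord x| * h.toL1 x)| =
        (eLpNorm (fun x => |lastCoord x| * h.toL1 x) 1 volume).toReal := by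
      rw [eLpNorm_one_eq_lintegral_enorm, ← integral_norm_eq_lintegral_enorm hmi.1]
      rfl
    rw [e, show 2 * (firstMoment u₀).toReal = (2 * firstMoment u₀).toReal by
      simp [ENNReal.toReal_mul]]
    exact ENNReal.toReal_mono (ENNReal.mul_ne_top (by simp) hmtop) hm
  have hM0 : 0 ≤ ∫ x, |(|lastCoord x| * h.toL1 x)| := integral_nonneg fun _ => abs_nonneg _
  obtain ⟨h1, h2⟩ := hdecay h.toL1 (2 * Real.pi * ∫ x, |(|lastCoord x| * h.toL1 x)|)
    (by positivity) (norm_hat_le_of_odd (ae_reflect_of_mem_oddCone h.toL1_mem_oddCone) hmi) hi t ht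
  filter_upwards [L1.ae_norm_le _ h1] with x hx
  refine hx.trans (h2.trans ?_)
  refine mul_le_mul_of_nonneg_right ?_ (Real.rpow_nonneg (by linarith) _)
  rw [mul_assoc K]
  refine mul_le_mul_of_nonneg_left ?_ hK.le
  have hπ := Real.pi_gt_three
  have hF0 : 0 ≤ (eLpNorm (fourierHat (oddExt u₀)) 1 volume).toReal := ENNReal.toReal_nonneg
  calc _ ≤ 2 * Real.pi * (2 * (firstMoment u₀).toReal) +
        (eLpNorm (fourierHat (oddExt u₀)) 1 volume).toReal :=
        add_le_add (mul_le_mul_of_nonneg_left hM (by positivity)) hD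
    _ ≤ 4 * Real.pi * ((firstMoment u₀).toReal +
        (eLpNorm (fourierHat (oddExt u₀)) 1 volume).toReal) := by nlinarith
    _ ≤ 4 * Real.pi * ε := mul_le_mul_of_nonneg_left hsum (by positivity)

end Datum

/-! ### Global solutions below twice the linear evolution -/

section Existence

variable {n : ℕ} {α M : ℝ} {J₀ : Space n → ℝ} {G : ℝ → ProbabilityMeasure (Space n)}

theorem truncL1_mem_oddCone (hα : 0 < α) (hM : 0 ≤ M) {f : L1 n} (hf : f ∈ oddCone n) :
    truncL1 hα hM f ∈ oddCone n := by
  refine mem_oddCone_of_ae (u := fun x => truncPow α M (f x)) ?_ ?_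
  · filter_upwards [coeFn_truncL1 hα hM f, ae_eq_oddExt hf] with x h1 h2
    rw [h1, h2]
    simp only [oddExt]
    split_ifs
    · rfl
    · exact truncPow_neg _
    · exact truncPow_zero
  · filter_upwards [hf.2] with x hx
    exact truncPow_nonneg hα hM hx

/-- Comparison of the nonlinearity with the linear evolution: on the order interval
`0 ≤ f ≤ 2 g` in the half-space, where `g ≤ b`, one has `f^α f ≤ 2 (2b)^α g`. -/
theorem smul_sub_truncL1_mem_oddCone (hα : 0 < α) (hM : 0 ≤ M) {f g : L1 n} {b : ℝ}
    (hbM : 2 * b ≤ M) (hf : f ∈ oddCone n) (hg : g ∈ oddCone n) (hgb : ∀ᵐ x, |g x| ≤ b)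
    (hfg : (2 : ℝ) • g - f ∈ oddCone n) :
    (2 * (2 * b) ^ α) • g - truncL1 hα hM f ∈ oddCone n := by
  refine ⟨by rw [map_sub, map_smul, hg.1, (truncL1_mem_oddCone hα hM hf).1, smul_neg]; abel, ?_⟩
  filter_upwards [hf.2, hfg.2, ae_half_of_ae hgb, ae_half_of_ae (coeFn_truncL1 hα hM f),
    ae_half_of_ae (Lp.coeFn_sub ((2 : ℝ) • g) f), ae_half_of_ae (Lp.coeFn_smul (2 : ℝ) g),
    ae_half_of_ae (Lp.coeFn_sub ((2 * (2 * b) ^ α) • g) (truncL1 hα hM f)),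
    ae_half_of_ae (Lp.coeFn_smul (2 * (2 * b) ^ α) g)] with x h1 h2 h3 h4 h5 h6 h7 h8
  rw [h5, Pi.sub_apply, h6, Pi.smul_apply, smul_eq_mul] at h2
  rw [h7, Pi.sub_apply, h8, Pi.smul_apply, smul_eq_mul, h4]
  have h9 : f x ≤ 2 * b := by linarith [(abs_le.1 h3).2]
  rw [truncPow_eq hα (by rw [abs_of_nonneg h1]; linarith), abs_of_nonneg h1]
  have h10 : f x ^ α ≤ (2 * b) ^ α := Real.rpow_le_rpow h1 h9 hα.le
  have h11 : f x ^ α * f x ≤ (2 * b) ^ α * (2 * g x) :=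
    mul_le_mul h10 (by linarith) h1 (Real.rpow_nonneg (h1.trans h9) _)
  linarith

theorem LinearComparison.duhamel_mem_oddCone (hcomp : LinearComparison G)
    (hG : IsDiffusionKernel J₀ G) {g : ℝ → L1 n} (hg : Continuous g) {t : ℝ} (ht : 0 ≤ t)
    (h : ∀ s, 0 ≤ s → g s ∈ oddCone n) : hG.semigroup.duhamel g t ∈ oddCone n :=
  integral_mem_oddCone
    (ContractionSemigroup.continuous_duhamel_integrand_right (S := hG.semigroup) hg t) ht
    fun s hs => hcomp.kernelOp_mem_oddCone hG _ (h s hs.1)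

theorem ContractionSemigroup.duhamel_smul_orbit {X : Type*} [NormedAddCommGroup X]
    [NormedSpace ℝ X] [CompleteSpace X] (S : ContractionSemigroup X) (c : ℝ → ℝ) (x : X) {t : ℝ}
    (ht : 0 ≤ t) :
    S.duhamel (fun s => c s • S.op s x) t = (∫ s in (0 : ℝ)..t, c s) • S.op t x := by
  rw [duhamel, ← intervalIntegral.integral_smul_const]
  apply intervalIntegral.integral_congr
  intro s hs
  rw [Set.uIcc_of_le ht] at hs
  simp only [map_smul]
  rw [← S.op_add _ _ (by linarith [hs.2]) hs.1, sub_add_cancel]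

/-- Global mild solutions that stay below twice the linear evolution, when the linear evolution is
bounded by `b` and `∫ 2 (2b)^α ≤ 1`. -/
theorem LinearComparison.exists_isMild_trunc (hcomp : LinearComparison G)
    (hG : IsDiffusionKernel J₀ G) (hα : 0 < α) (hM : 0 ≤ M) {w₀ : L1 n} (hw₀ : w₀ ∈ oddCone n)
    {b : ℝ → ℝ} (hb : Continuous b) (hbM : ∀ t, 2 * b t ≤ M)
    (hdec : ∀ t, 0 ≤ t → ∀ᵐ x, |kernelOp G t w₀ x| ≤ b t)
    (hint : ∀ t, 0 ≤ t → ∫ s in (0 : ℝ)..t, 2 * (2 * b s) ^ α ≤ 1) :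
    ∃ U, hG.semigroup.IsMild (fun _ => truncL1 hα hM) w₀ U ∧ ∀ t, 0 ≤ t →
      U t ∈ oddCone n ∧ (2 : ℝ) • kernelOp G t w₀ - U t ∈ oddCone n := by
  have hF : Continuous (Function.uncurry fun _ : ℝ => (truncL1 hα hM : L1 n → L1 n)) :=
    (continuous_truncL1 hα hM).comp continuous_snd
  have hS : ∀ t, kernelOp G t w₀ ∈ oddCone n := fun t => hcomp.kernelOp_mem_oddCone hG t hw₀
  refine ContractionSemigroup.exists_isMild hF (L := (α + 1) * M ^ α) (by positivity)
    (fun _ => norm_truncL1_sub_le hα hM) (fun _ => truncL1_zero hα hM) w₀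
    (fun t => {f | f ∈ oddCone n ∧ (2 : ℝ) • kernelOp G t w₀ - f ∈ oddCone n}) ?_ ?_ ?_
  · intro t
    exact isClosed_oddCone.inter
      (isClosed_oddCone.preimage (continuous_const.sub continuous_id))
  · intro t _
    refine ⟨hS t, ?_⟩
    rw [hG.semigroup_op, two_smul, add_sub_cancel_right]
    exact hS t
  · intro v hv hvK t ht
    set c : ℝ → ℝ := fun s => 2 * (2 * b s) ^ α with hc
    have hcc : Continuous c :=
      continuous_const.mul ((continuous_const.mul hb).rpow_const fun _ => Or.inr hα.le)
    have hFv : Continuous fun s => truncL1 hα hM (v s) := (continuous_truncL1 hα hM).comp hv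
    have hSc : Continuous fun s => c s • hG.semigroup.op s w₀ :=
      hcc.smul (hG.semigroup.continuous_orbit w₀)
    have h1 : hG.semigroup.duhamel (fun s => truncL1 hα hM (v s)) t ∈ oddCone n :=
      hcomp.duhamel_mem_oddCone hG hFv ht fun s hs => truncL1_mem_oddCone hα hM (hvK s hs).1
    have h2 : hG.semigroup.duhamel
        (fun s => c s • hG.semigroup.op s w₀ - truncL1 hα hM (v s)) t ∈ oddCone n :=
      hcomp.duhamel_mem_oddCone hG (hSc.sub hFv) ht fun s hs =>
        smul_sub_truncL1_mem_oddCone hα hM (hbM s) (hvK s hs).1 (hS s) (hdec s hs) (hvK s hs).2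
    rw [← ContractionSemigroup.duhamel_sub _ hSc hFv,
      ContractionSemigroup.duhamel_smul_orbit _ _ _ ht, hG.semigroup_op] at h2
    refine ⟨add_mem_oddCone (hS t) h1, ?_⟩
    have h3 := add_mem_oddCone (smul_mem_oddCone (sub_nonneg.2 (hint t ht)) (hS t)) h2
    rw [hG.semigroup_op]
    convert h3 using 1
    rw [two_smul, sub_smul, one_smul]
    abel

theorem integral_one_add_rpow_le {q : ℝ} (hq : 1 < q) {t : ℝ} (ht : 0 ≤ t) :
    ∫ s in (0 : ℝ)..t, (1 + |s|) ^ (-q) ≤ 1 / (q - 1) := by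
  have h1 : ∫ s in (0 : ℝ)..t, (1 + |s|) ^ (-q) = ∫ s in (0 : ℝ)..t, (1 + s) ^ (-q) := by
    apply intervalIntegral.integral_congr
    intro s hs
    rw [Set.uIcc_of_le ht] at hs
    simp only [abs_of_nonneg hs.1]
  have h2 := intervalIntegral.integral_comp_add_left (a := 0) (b := t)
    (fun s : ℝ => s ^ (-q)) 1
  rw [h1, h2, integral_rpow (Or.inr ⟨by linarith, by
    rw [Set.uIcc_of_le (by linarith)]; intro h; linarith [h.1]⟩)]
  rw [add_zero, Real.one_rpow, show -q + 1 = -(q - 1) by ring, div_neg, ← neg_div, neg_sub]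
  have : 0 ≤ (1 + t) ^ (-(q - 1)) := Real.rpow_nonneg (by linarith) _
  gcongr
  linarith

/-- If `f` is dominated by `2g` in the half-space, it is bounded by `2 sup g`. -/
theorem ae_abs_le_of_mem_oddCone {f g : L1 n} {b : ℝ} (hf : f ∈ oddCone n)
    (hgb : ∀ᵐ x, |g x| ≤ b) (hfg : (2 : ℝ) • g - f ∈ oddCone n) : ∀ᵐ x, |f x| ≤ 2 * b := by
  have h1 : ∀ᵐ x, x ∈ halfSpace n → |f x| ≤ 2 * b := by
    rw [← ae_restrict_iff' (measurableSet_halfSpace (n := n))]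
    filter_upwards [hf.2, hfg.2, ae_restrict_of_ae hgb,
      ae_restrict_of_ae (Lp.coeFn_sub ((2 : ℝ) • g) f),
      ae_restrict_of_ae (Lp.coeFn_smul (2 : ℝ) g)] with x h1 h2 h3 h5 h6
    rw [h5, Pi.sub_apply, h6, Pi.smul_apply, smul_eq_mul] at h2
    rw [abs_of_nonneg h1]
    linarith [(abs_le.1 h3).2]
  have h2 := measurePreserving_reflectNormal.quasiMeasurePreserving.ae h1
  filter_upwards [h1, h2, ae_reflect_of_mem_oddCone hf, ae_lastCoord_ne_zero] with x e1 e2 e3 e4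
  rcases lt_or_gt_of_ne e4 with h | h
  · have hx : 0 < lastCoord (reflectNormal x) := by rw [lastCoord_reflectNormal]; linarith
    have := e2 hx
    rwa [e3, abs_neg] at this
  · exact e1 h

end Existence

/-! ### Weak solutions of the semilinear problem -/

section WeakSolutions

variable {n : ℕ} {α M T : ℝ} {J₀ : Space n → ℝ} {G : ℝ → ProbabilityMeasure (Space n)}
  {A : SchwartzMap (Space n) ℝ → Space n → ℝ}
  {B : SchwartzMap (Space n) ℝ →L[ℝ] BoundedContinuousFunction (Space n) ℝ}

/-- Interpolation of `L^{α+1}` between `L¹` and `L^∞`. -/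
theorem eLpNorm_add_one_le (hα : 0 < α) {f : Space n → ℝ} (hfM : ∀ᵐ x, |f x| ≤ M) :
    eLpNorm f (ENNReal.ofReal (α + 1)) volume ≤
      (ENNReal.ofReal M ^ α * eLpNorm f 1 volume) ^ (1 / (α + 1)) := by
  rw [eLpNorm_eq_lintegral_rpow_enorm_toReal (by simp; linarith) ENNReal.ofReal_ne_top,
    ENNReal.toReal_ofReal (by linarith), eLpNorm_one_eq_lintegral_enorm]
  refine ENNReal.rpow_le_rpow ?_ (by positivity)
  rw [← lintegral_const_mul' _ _ (ENNReal.rpow_ne_top_of_nonneg hα.le ENNReal.ofReal_ne_top)]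
  apply lintegral_mono_ae
  filter_upwards [hfM] with x hx
  rw [ENNReal.rpow_add_of_nonneg _ _ hα.le zero_le_one, ENNReal.rpow_one]
  gcongr
  rw [← ofReal_norm]
  exact ENNReal.ofReal_le_ofReal hx

theorem isContInLp_of_continuous {W : ℝ → L1 n} (hW : Continuous W) {w : ℝ → Space n → ℝ}
    (hWw : ∀ t ∈ Set.Icc 0 T, W t =ᵐ[volume] w t) : IsContInLp 1 T w := by
  refine ⟨fun t ht => (memLp_one_iff_integrable.2 (W t).integrable_coe).ae_eq (hWw t ht),
    fun t ht => ?_⟩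
  have h1 : Tendsto (fun s => edist (W s) (W t)) (𝓝[Set.Icc 0 T] t) (𝓝 0) := by
    have : Continuous fun s => edist (W s) (W t) := hW.edist continuous_const
    exact (this.tendsto' t 0 (edist_self _)).mono_left nhdsWithin_le_nhds
  refine h1.congr' ?_
  filter_upwards [self_mem_nhdsWithin] with s hs
  rw [Lp.edist_def]
  exact eLpNorm_congr_ae ((hWw s hs).sub (hWw t ht))

theorem IsContInLp.of_bounded (hα : 0 < α) {w : ℝ → Space n → ℝ} (hw : IsContInLp 1 T w)
    (hwM : ∀ t ∈ Set.Icc 0 T, ∀ᵐ x, |w t x| ≤ M) :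
    IsContInLp (ENNReal.ofReal (α + 1)) T w := by
  have hc : ∀ R : ℝ, ENNReal.ofReal R ^ α ≠ ⊤ := fun R =>
    ENNReal.rpow_ne_top_of_nonneg hα.le ENNReal.ofReal_ne_top
  have hα1 : 0 < 1 / (α + 1) := by positivity
  refine ⟨fun t ht => ⟨(hw.1 t ht).1, (eLpNorm_add_one_le hα (hwM t ht)).trans_lt ?_⟩,
    fun t ht => ?_⟩
  · exact (ENNReal.rpow_ne_top_of_nonneg hα1.le (ENNReal.mul_ne_top (hc M) (hw.1 t ht).2.ne)).lt_top
  · have h1 : Tendsto (fun s => (ENNReal.ofReal (2 * M) ^ α *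
        eLpNorm (fun x => w s x - w t x) 1 volume) ^ (1 / (α + 1))) (𝓝[Set.Icc 0 T] t) (𝓝 0) := by
      have h2 := ENNReal.Tendsto.const_mul (hw.2 t ht) (Or.inr (hc (2 * M)))
      have h3 := (ENNReal.continuous_rpow_const (y := 1 / (α + 1))).tendsto _ |>.comp h2
      rwa [mul_zero, ENNReal.zero_rpow_of_pos hα1] at h3
    refine tendsto_of_tendsto_of_tendsto_of_le_of_le' tendsto_const_nhds h1
      (Eventually.of_forall fun _ => bot_le) ?_
    filter_upwards [self_mem_nhdsWithin] with s hs
    refine eLpNorm_add_one_le hα ?_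
    filter_upwards [hwM s hs, hwM t ht] with x h1 h2
    exact (abs_sub _ _).trans (by linarith)

theorem coeFn_truncL1_of_bounded (hα : 0 < α) (hM : 0 ≤ M) {f : L1 n} (hf : ∀ᵐ x, |f x| ≤ M) :
    truncL1 hα hM f =ᵐ[volume] fun x => |f x| ^ α * f x := by
  filter_upwards [coeFn_truncL1 hα hM f, hf] with x h1 h2
  rw [h1, truncPow_eq hα h2]

theorem integrable_mul_bcf (f : L1 n) (g : BoundedContinuousFunction (Space n) ℝ) :
    Integrable fun x => f x * g x :=
  f.integrable_coe.mul_bdd (c := ‖g‖) g.continuous.aestronglyMeasurable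
    (ae_of_all _ g.norm_coe_le_norm)

/-- The spatial integral in the weak formulation, in terms of the duality pairing. -/
theorem integral_weak_eq (hα : 0 < α) (hM : 0 ≤ M) (hB : ∀ φ x, B φ x = A φ x) {f : L1 n}
    (hf : ∀ᵐ x, |f x| ≤ M) {w : Space n → ℝ} (hfw : f =ᵐ[volume] w)
    (φ ψ : SchwartzMap (Space n) ℝ) :
    ∫ x, (w x * (ψ x + A φ x) + |w x| ^ α * w x * φ x) =
      pairing f (toBCF ψ + B φ) + pairing (truncL1 hα hM f) (toBCF φ) := by
  rw [pairing_apply, pairing_apply, ← integral_add (integrable_mul_bcf _ _)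
    (integrable_mul_bcf _ _)]
  apply integral_congr_ae
  filter_upwards [hfw, coeFn_truncL1_of_bounded hα hM hf] with x h1 h2
  rw [h2, ← h1, ← hB]
  rfl

theorem integral_boundary_eq {f g : L1 n} {w v : Space n → ℝ} (hfw : f =ᵐ[volume] w)
    (hgv : g =ᵐ[volume] v) (φ ψ : SchwartzMap (Space n) ℝ) :
    ∫ x, (w x * φ x - v x * ψ x) = pairing f (toBCF φ) - pairing g (toBCF ψ) := by
  rw [pairing_apply, pairing_apply, ← integral_sub (integrable_mul_bcf _ _)
    (integrable_mul_bcf _ _)]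
  apply integral_congr_ae
  filter_upwards [hfw, hgv] with x h1 h2
  rw [h1, h2]
  rfl

/-- Bounded mild solutions of the truncated problem that do not reach the truncation level are
weak solutions of the original one. -/
theorem IsGenerator.isWeakSolution_of_isMild (hA : IsGenerator G A) (hG : IsDiffusionKernel J₀ G)
    (hJ : Continuous J₀) (hα : 0 < α) (hM : 0 ≤ M) (hT : 0 ≤ T) {U : ℝ → L1 n} {v₀ : L1 n}
    (hU : hG.semigroup.IsMild (fun _ => truncL1 hα hM) v₀ U)
    (hUM : ∀ t ∈ Set.Icc 0 T, ∀ᵐ x, |U t x| ≤ M) {w : ℝ → Space n → ℝ} {w₀ : Space n → ℝ}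
    (hUw : ∀ t ∈ Set.Icc 0 T, U t =ᵐ[volume] w t) (hv₀ : v₀ =ᵐ[volume] w₀) :
    IsWeakSolution A α T w₀ w := by
  obtain ⟨B, hB⟩ := hA.exists_clm hG hJ
  have hwM : ∀ t ∈ Set.Icc 0 T, ∀ᵐ x, |w t x| ≤ M := fun t ht => by
    filter_upwards [hUw t ht, hUM t ht] with x h1 h2
    rwa [← h1]
  have h0 : (0 : ℝ) ∈ Set.Icc 0 T := ⟨le_rfl, hT⟩
  have hTT : T ∈ Set.Icc 0 T := ⟨hT, le_rfl⟩
  have hc1 := isContInLp_of_continuous hU.continuous hUw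
  refine ⟨hc1, hc1.of_bounded hα hwM, ⟨M, hwM⟩, ?_, fun φ dφ hφ => ?_⟩
  · refine (hUw 0 h0).symm.trans ?_
    rw [hU.zero]; exact hv₀
  · have hg : Continuous fun s => truncL1 hα hM (U s) :=
      (continuous_truncL1 hα hM).comp hU.continuous
    have hV : hG.semigroup.IsMild (fun s _ => truncL1 hα hM (U s)) v₀ U :=
      ⟨hU.continuous, hU.eq⟩
    rw [integral_boundary_eq (hUw T hTT) hv₀, ← hA.weak_of_isMild hG hJ hB hg hV hT hφ]
    apply intervalIntegral.integral_congr
    intro t ht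
    rw [Set.uIcc_of_le hT] at ht
    exact integral_weak_eq hα hM hB (hUM t ht) (hUw t ht) _ _

/-- A weak solution as a continuous curve in `L¹`, constant outside `[0, T]`. -/
theorem IsContInLp.exists_curve (hT : 0 ≤ T) {w : ℝ → Space n → ℝ} (hw : IsContInLp 1 T w) :
    ∃ W : ℝ → L1 n, Continuous W ∧ ∀ t ∈ Set.Icc 0 T, W t =ᵐ[volume] w t := by
  let W₀ : Set.Icc (0 : ℝ) T → L1 n := fun t => (hw.1 t t.2).toLp _
  have hW₀ : Continuous W₀ := by
    rw [continuous_iff_continuousAt]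
    intro t
    rw [ContinuousAt, tendsto_iff_edist_tendsto_0]
    have h1 := (hw.2 t t.2).comp (tendsto_nhdsWithin_iff.2
      ⟨(continuous_subtype_val.tendsto t), Eventually.of_forall fun s => s.2⟩)
    refine h1.congr fun s => ?_
    simp only [W₀, Lp.edist_toLp_toLp]
    rfl
  refine ⟨fun t => W₀ (Set.projIcc 0 T hT t), hW₀.comp continuous_projIcc, fun t ht => ?_⟩
  simp only [Set.projIcc_of_mem hT ht]
  exact (hw.1 t ht).coeFn_toLp

theorem truncL1_eq_of_bounded (hα : 0 < α) (hM : 0 ≤ M) {M' : ℝ} (hM' : 0 ≤ M') (hle : M ≤ M')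
    {f : L1 n} (hf : ∀ᵐ x, |f x| ≤ M) : truncL1 hα hM f = truncL1 hα hM' f := by
  apply Lp.ext
  exact (coeFn_truncL1_of_bounded hα hM hf).trans (coeFn_truncL1_of_bounded hα hM'
    (hf.mono fun x hx => hx.trans hle)).symm

/-- Weak solutions are mild: the difference of a weak solution and of the mild solution of the
linear problem with the same right-hand side vanishes. -/
theorem IsGenerator.eq_duhamel_of_weak (hA : IsGenerator G A) (hG : IsDiffusionKernel J₀ G)
    (hJ : Continuous J₀) (hB : ∀ φ x, B φ x = A φ x) (hT : 0 < T) {W g : ℝ → L1 n} {v₀ : L1 n}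
    (hW : Continuous W) (hg : Continuous g)
    (hweak : ∀ φ dφ : ℝ → SchwartzMap (Space n) ℝ, IsC1TestFunction T φ dφ →
      ∫ t in (0 : ℝ)..T, (pairing (W t) (toBCF (dφ t) + B (φ t)) + pairing (g t) (toBCF (φ t))) =
        pairing (W T) (toBCF (φ T)) - pairing v₀ (toBCF (φ 0)))
    {t : ℝ} (ht : t ∈ Set.Icc 0 T) :
    W t = hG.semigroup.op t v₀ + hG.semigroup.duhamel g t := by
  set V : ℝ → L1 n := fun t => hG.semigroup.op t v₀ + hG.semigroup.duhamel g t with hV_def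
  have hVc : Continuous V :=
    (hG.semigroup.continuous_orbit v₀).add (hG.semigroup.continuous_duhamel hg)
  have hV : hG.semigroup.IsMild (fun s _ => g s) v₀ V := ⟨hVc, fun _ _ => rfl⟩
  refine sub_eq_zero.1 (hA.eq_zero_of_weak hG hJ hB (Z := fun t => W t - V t) (hW.sub hVc) hT
    (fun φ dφ hφ => ?_) ht)
  have h1 := hweak φ dφ hφ
  have h2 := hA.weak_of_isMild hG hJ hB hg hV hT.le hφ
  have hφc : ContinuousOn (fun t => toBCF (φ t)) (Set.Icc 0 T) :=
    (toBCF (n := n)).continuous.comp_continuousOn hφ.1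
  have hdφc : ContinuousOn (fun t => toBCF (dφ t)) (Set.Icc 0 T) :=
    (toBCF (n := n)).continuous.comp_continuousOn hφ.2.1
  have hBc : ContinuousOn (fun t => B (φ t)) (Set.Icc 0 T) := B.continuous.comp_continuousOn hφ.1
  have hi : ∀ Y : ℝ → L1 n, Continuous Y → IntervalIntegrable
      (fun t => pairing (Y t) (toBCF (dφ t) + B (φ t)) + pairing (g t) (toBCF (φ t)))
      volume 0 T := fun Y hY =>
    ((continuousOn_pairing hY.continuousOn (hdφc.add hBc)).add
      (continuousOn_pairing hg.continuousOn hφc)).intervalIntegrable_of_Icc hT.le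
  have h3 := intervalIntegral.integral_sub (hi W hW) (hi V hVc)
  rw [h1, h2, sub_sub_sub_cancel_right] at h3
  simp only [map_sub, sub_apply]
  rw [← h3]
  apply intervalIntegral.integral_congr
  intro s _
  simp only [map_add]
  ring

/-- Uniqueness of bounded weak solutions. -/
theorem IsGenerator.ae_eq_of_isWeakSolution (hA : IsGenerator G A) (hG : IsDiffusionKernel J₀ G)
    (hJ : Continuous J₀) (hα : 0 < α) (hM : 0 ≤ M) (hT : 0 < T) {U : ℝ → L1 n} {v₀ : L1 n}
    (hU : hG.semigroup.IsMild (fun _ => truncL1 hα hM) v₀ U)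
    (hUM : ∀ t ∈ Set.Icc 0 T, ∀ᵐ x, |U t x| ≤ M) {w : ℝ → Space n → ℝ} {w₀ : Space n → ℝ}
    (hv₀ : v₀ =ᵐ[volume] w₀) (hw : IsWeakSolution A α T w₀ w) {t : ℝ} (ht : t ∈ Set.Icc 0 T) :
    w t =ᵐ[volume] U t := by
  obtain ⟨B, hB⟩ := hA.exists_clm hG hJ
  obtain ⟨W, hW, hWw⟩ := hw.cont_L1.exists_curve hT.le
  obtain ⟨M₁, hM₁⟩ := hw.bounded
  -- A common truncation level for the two solutions.
  set M' := max M M₁ with hM'_def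
  have hM' : 0 ≤ M' := hM.trans (le_max_left _ _)
  have hWM : ∀ t ∈ Set.Icc 0 T, ∀ᵐ x, |W t x| ≤ M' := fun t ht => by
    filter_upwards [hWw t ht, hM₁ t ht] with x h1 h2
    rw [h1]; exact h2.trans (le_max_right _ _)
  have hFW : Continuous fun s => truncL1 hα hM' (W s) := (continuous_truncL1 hα hM').comp hW
  have hFU : Continuous fun s => truncL1 hα hM' (U s) :=
    (continuous_truncL1 hα hM').comp hU.continuous
  have hWeq : ∀ t ∈ Set.Icc 0 T, W t = hG.semigroup.op t v₀ +
      hG.semigroup.duhamel (fun s => truncL1 hα hM' (W s)) t := fun t ht => by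
    refine hA.eq_duhamel_of_weak hG hJ hB hT hW hFW (fun φ dφ hφ => ?_) ht
    rw [← integral_boundary_eq (hWw T ⟨hT.le, le_rfl⟩) hv₀, ← hw.weak φ dφ hφ]
    apply intervalIntegral.integral_congr
    intro s hs
    rw [Set.uIcc_of_le hT.le] at hs
    exact (integral_weak_eq hα hM' hB (hWM s hs) (hWw s hs) _ _).symm
  have hUeq : ∀ t ∈ Set.Icc 0 T, U t = hG.semigroup.op t v₀ +
      hG.semigroup.duhamel (fun s => truncL1 hα hM' (U s)) t := fun t ht => by
    rw [hU.eq t ht.1]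
    congr 1
    exact hG.semigroup.duhamel_congr ht.1 fun s hs =>
      truncL1_eq_of_bounded hα hM hM' (le_max_left _ _) (hUM s ⟨hs.1, hs.2.trans ht.2⟩)
  have hL : 0 ≤ (α + 1) * M' ^ α := by positivity
  have hWU : W t = U t := by
    refine eq_of_norm_sub_le_integral hW hU.continuous hL (fun t ht => ?_) t ht
    conv_lhs => rw [hWeq t ht, hUeq t ht, add_sub_add_left_eq_sub,
      hG.semigroup.duhamel_sub hFW hFU]
    rw [← intervalIntegral.integral_const_mul]
    exact hG.semigroup.norm_duhamel_le ((hW.sub hU.continuous).norm.const_mul _) ht.1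
      fun s _ => norm_truncL1_sub_le hα hM' _ _
  rw [← hWU]
  exact (hWw t ht).symm

end WeakSolutions

/-! ### Time regularity in the half-space -/

section TimeRegularity

variable {n : ℕ}

/-- Differentiability in time in `L¹` of the half-space gives differentiability of the curve of odd
extensions. -/
theorem hasDerivAt_of_tendsto_half {U : ℝ → L1 n} (hU : ∀ t, 0 ≤ t → U t ∈ oddCone n) {t : ℝ}
    (ht : 0 < t) {v : Space n → ℝ} (hv : MemLp v 1 (halfVolume n))
    (hlim : Tendsto (fun h : ℝ => eLpNorm (fun x => h⁻¹ * (U (t + h) x - U t x) - v x) 1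
      (halfVolume n)) (𝓝[≠] 0) (𝓝 0)) :
    HasDerivAt U ((memLp_oddExt hv).toLp _) t := by
  rw [hasDerivAt_iff_tendsto_slope_zero, tendsto_iff_edist_tendsto_0]
  have h2 := ENNReal.Tendsto.const_mul (a := 2) hlim (Or.inr (by simp))
  rw [mul_zero] at h2
  refine tendsto_of_tendsto_of_tendsto_of_le_of_le' tendsto_const_nhds h2
    (Eventually.of_forall fun _ => bot_le) ?_
  have hpos : ∀ᶠ h : ℝ in 𝓝[≠] 0, 0 < t + h := by
    have : Tendsto (fun h : ℝ => t + h) (𝓝[≠] 0) (𝓝 t) :=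
      ((continuous_const.add continuous_id).tendsto' 0 t (by simp)).mono_left nhdsWithin_le_nhds
    exact this.eventually_const_lt ht
  filter_upwards [hpos] with h hh
  have hae : ⇑(h⁻¹ • (U (t + h) - U t)) - ⇑((memLp_oddExt hv).toLp _ : L1 n) =ᵐ[volume]
      oddExt fun x => h⁻¹ * (U (t + h) x - U t x) - v x := by
    filter_upwards [Lp.coeFn_smul h⁻¹ (U (t + h) - U t), Lp.coeFn_sub (U (t + h)) (U t),
      (memLp_oddExt hv).coeFn_toLp, ae_eq_oddExt (hU _ hh.le), ae_eq_oddExt (hU t ht.le)]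
      with x e1 e2 e3 e4 e5
    rw [Pi.sub_apply, e1, Pi.smul_apply, e2, Pi.sub_apply, e3, e4, e5]
    simp only [oddExt, smul_eq_mul]
    split_ifs <;> ring
  rw [Lp.edist_def, eLpNorm_congr_ae hae]
  refine eLpNorm_one_oddExt_le (AEStronglyMeasurable.sub ?_ hv.1)
  exact ((Lp.aestronglyMeasurable (U (t + h))).restrict.sub
    (Lp.aestronglyMeasurable (U t)).restrict).const_mul _

/-- A curve in `L¹` with a continuous derivative on a neighbourhood of each positive time is `C¹` in
the sense of the half-space. -/
theorem isC1InL1_of_hasDerivAt {U : ℝ → L1 n}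
    (hU : ∀ t, 0 < t → ∃ z : ℝ → L1 n, Continuous z ∧ ∀ᶠ s in 𝓝 t, HasDerivAt U (z s) s) (S : ℝ) :
    IsC1InL1 S (fun t => ⇑(U t)) := by
  have hhalf : ∀ f : Space n → ℝ, eLpNorm f 1 (halfVolume n) ≤ eLpNorm f 1 volume := fun f =>
    eLpNorm_mono_measure f Measure.restrict_le_self
  refine ⟨fun t => ⇑(deriv U t), fun t ht => ?_⟩
  obtain ⟨z, hz, hzU⟩ := hU t ht.1
  have hzt : deriv U t = z t := hzU.self_of_nhds.deriv
  refine ⟨(memLp_one_iff_integrable.2 (deriv U t).integrable_coe).restrict _, ?_, ?_⟩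
  · have h1 := hzU.self_of_nhds
    rw [hasDerivAt_iff_tendsto_slope_zero, tendsto_iff_edist_tendsto_0] at h1
    refine tendsto_of_tendsto_of_tendsto_of_le_of_le tendsto_const_nhds h1
      (fun _ => bot_le) fun h => ?_
    refine (hhalf _).trans (le_of_eq ?_)
    rw [Lp.edist_def]
    apply eLpNorm_congr_ae
    filter_upwards [Lp.coeFn_smul h⁻¹ (U (t + h) - U t), Lp.coeFn_sub (U (t + h)) (U t)]
      with x e1 e2
    rw [Pi.sub_apply, e1, Pi.smul_apply, e2, Pi.sub_apply, hzt, smul_eq_mul]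
  · have h1 : Tendsto (fun s => edist (z s) (z t)) (𝓝 t) (𝓝 0) :=
      (hz.edist continuous_const).tendsto' t 0 (edist_self _)
    refine tendsto_of_tendsto_of_tendsto_of_le_of_le' tendsto_const_nhds h1
      (Eventually.of_forall fun _ => bot_le) ?_
    filter_upwards [hzU] with s hs
    refine (hhalf _).trans (le_of_eq ?_)
    rw [Lp.edist_def, hs.deriv, hzt]
    rfl

/-- Time differentiability on an initial interval propagates to all times. -/
theorem IsC1InL1.extend {α M : ℝ} (hα : 0 < α) (hM : 0 ≤ M) {S : ContractionSemigroup (L1 n)}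
    {U : ℝ → L1 n} {v₀ : L1 n} (hU : S.IsMild (fun _ => truncL1 hα hM) v₀ U)
    (hodd : ∀ t, 0 ≤ t → U t ∈ oddCone n) {T : ℝ} (hT : 0 < T)
    (h : IsC1InL1 T fun t => ⇑(U t)) (S' : ℝ) : IsC1InL1 S' fun t => ⇑(U t) := by
  obtain ⟨v, hv⟩ := h
  refine isC1InL1_of_hasDerivAt (fun t ht => ?_) S'
  have ht₀ : 0 < min t T / 2 := half_pos (lt_min ht hT)
  have ht₀t : min t T / 2 < t := by linarith [min_le_left t T]
  have ht₀T : min t T / 2 < T := by linarith [min_le_right t T]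
  obtain ⟨h1, h2, -⟩ := hv (min t T / 2) ⟨ht₀, ht₀T⟩
  obtain ⟨z, hz, hzU⟩ := hU.exists_continuous_hasDerivAt_trunc hα hM ht₀
    (hasDerivAt_of_tendsto_half hodd ht₀ h1 h2)
  refine ⟨z, hz, ?_⟩
  filter_upwards [lt_mem_nhds ht₀t] with s hs
  exact hzU s hs.le

end TimeRegularity

/-! ### Global solutions for small data -/

theorem theorem2p3 (n : ℕ) (α a β : ℝ) (J₀ : Space n → ℝ)
    (G : ℝ → ProbabilityMeasure (Space n)) (A : SchwartzMap (Space n) ℝ → Space n → ℝ)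
    (hJ : IsSymbol a β J₀) (hG : IsDiffusionKernel J₀ G) (hA : IsGenerator G A)
    (hcomp : LinearComparison G) (hα : β / (((n + 1 : ℕ) : ℝ) + 1) < α) :
    ∃ ε : ℝ, 0 < ε ∧ ∀ u₀ : Space n → ℝ, IsInitialDatum u₀ →
      firstMoment u₀ + eLpNorm (fourierHat (oddExt u₀)) 1 volume < ENNReal.ofReal ε →
      ∃ u : ℝ → Space n → ℝ,
        (∀ T : ℝ, 0 < T → IsHalfSpaceSolution A α T u₀ u) ∧
        (∀ T : ℝ, 0 < T → ∀ w : ℝ → Space n → ℝ, IsHalfSpaceSolution A α T u₀ w →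
          ∀ t ∈ Set.Icc (0 : ℝ) T, w t =ᵐ[halfVolume n] u t) ∧
        (∀ T : ℝ, 0 < T → IsC1InL1 T u → ∀ S : ℝ, 0 < S → IsC1InL1 S u) ∧
        ∃ C : ℝ, 0 < C ∧ ∀ t : ℝ, 0 ≤ t →
          eLpNorm (u t) ⊤ (halfVolume n) ≤
            ENNReal.ofReal (C * (1 + t) ^ (-((((n + 1 : ℕ) : ℝ) + 1) / β))) := by
  have hβ := hJ.beta_pos
  have hα0 : 0 < α := lt_of_le_of_lt (by positivity) hα
  set p := decayRate n β with hp_def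
  have hp : 0 < p := by rw [hp_def, decayRate]; positivity
  have hq : 1 < p * α := by
    rw [hp_def, decayRate, div_mul_eq_mul_div, one_lt_div hβ]
    rwa [div_lt_iff₀ (by positivity), mul_comm] at hα
  obtain ⟨K, hK, hdecay⟩ := hJ.exists_linear_decay hG
  -- `M = 2 K ε` is chosen so that `2 M^α = p α - 1`, which makes `∫ 2 (2b)^α` at most `1`.
  set M : ℝ := ((p * α - 1) / 2) ^ (1 / α) with hM_def
  have hM0 : 0 < M := Real.rpow_pos_of_pos (by linarith) _
  have hMα : 2 * M ^ α = p * α - 1 := by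
    rw [hM_def, ← Real.rpow_mul (by linarith), one_div_mul_cancel hα0.ne', Real.rpow_one]
    ring
  refine ⟨M / (2 * K), by positivity, fun u₀ hu₀ hsmall => ?_⟩
  have hKε : K * (M / (2 * K)) = M / 2 := by field_simp
  have hdec := hdecay u₀ hu₀ _ hsmall
  rw [hKε] at hdec
  let b : ℝ → ℝ := fun t => M / 2 * (1 + |t|) ^ (-p)
  have hb1 : ∀ t : ℝ, 0 < 1 + |t| := fun t => by positivity
  have h2b : ∀ t, 2 * b t = M * (1 + |t|) ^ (-p) := fun t => by simp only [b]; ring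
  have hb : Continuous b := continuous_const.mul
    ((continuous_const.add continuous_abs).rpow_const fun t => Or.inl (hb1 t).ne')
  have hbM : ∀ t, 2 * b t ≤ M := fun t => by
    rw [h2b]
    exact mul_le_of_le_one_right hM0.le
      (Real.rpow_le_one_of_one_le_of_nonpos (by linarith [abs_nonneg t]) (by linarith))
  have hdec' : ∀ t, 0 ≤ t → ∀ᵐ x, |kernelOp G t hu₀.toL1 x| ≤ b t := fun t ht => by
    simp only [b, abs_of_nonneg ht]
    exact hdec t ht
  have hint : ∀ t, 0 ≤ t → ∫ s in (0 : ℝ)..t, 2 * (2 * b s) ^ α ≤ 1 := fun t ht => by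
    have h1 : ∀ s, 2 * (2 * b s) ^ α = (p * α - 1) * (1 + |s|) ^ (-(p * α)) := fun s => by
      rw [h2b, Real.mul_rpow hM0.le (Real.rpow_nonneg (hb1 s).le _), ← Real.rpow_mul (hb1 s).le,
        ← mul_assoc, hMα, neg_mul]
    simp only [h1]
    rw [intervalIntegral.integral_const_mul]
    calc _ ≤ (p * α - 1) * (1 / (p * α - 1)) :=
          mul_le_mul_of_nonneg_left (integral_one_add_rpow_le hq ht) (by linarith)
      _ = 1 := mul_one_div_cancel (by linarith)
  obtain ⟨U, hU, hUK⟩ := hcomp.exists_isMild_trunc hG hα0 hM0.le hu₀.toL1_mem_oddCone hb hbM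
    hdec' hint
  have hU2b : ∀ t, 0 ≤ t → ∀ᵐ x, |U t x| ≤ 2 * b t := fun t ht =>
    ae_abs_le_of_mem_oddCone (hUK t ht).1 (hdec' t ht) (hUK t ht).2
  have hUM : ∀ T : ℝ, ∀ t ∈ Set.Icc 0 T, ∀ᵐ x, |U t x| ≤ M := fun T t ht =>
    (hU2b t ht.1).mono fun x hx => hx.trans (hbM t)
  refine ⟨fun t => ⇑(U t), fun T hT => ?_, fun T hT w hw t ht => ?_, fun T hT hC1 S _ => ?_,
    M, hM0, fun t ht => ?_⟩
  · exact hA.isWeakSolution_of_isMild hG hJ.continuous hα0 hM0.le hT.le hU (hUM T)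
      (fun t ht => ae_eq_oddExt (hUK t ht.1).1) hu₀.coeFn_toL1
  · have h1 := hA.ae_eq_of_isWeakSolution hG hJ.continuous hα0 hM0.le hT hU (hUM T)
      hu₀.coeFn_toL1 hw ht
    filter_upwards [ae_half_of_ae h1, ae_restrict_mem measurableSet_halfSpace] with x h2 h3
    rw [← h2, oddExt_of_mem h3]
  · exact hC1.extend hα0 hM0.le hU (fun t ht => (hUK t ht).1) hT S
  · rw [eLpNorm_exponent_top]
    refine eLpNormEssSup_le_of_ae_bound (ae_half_of_ae ?_)
    filter_upwards [hU2b t ht] with x hx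
    rw [h2b, abs_of_nonneg ht] at hx
    exact hx
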